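/- **Setting.** Let $\Gamma$ be a compact metric graph with $E\ge 1$ edges of lengths $l_1,\dots,l_E>0$ and total length $\mathcal L=\sum_e l_e$; put $L^2(\Gamma)=\bigoplus_e L^2(0,l_e)$. Let $P$ be an orthogonal projector on $\mathbb C^{2E}$ and $L$ a self-adjoint map on $\ker P$. The one-particle Laplacian $-\Delta_1(P,L)$ acts as $F=(f_e)\mapsto(-f_e'')$ on the domain $$\{F\in H^2(\Gamma):\ PF_{bv}=0,\ (1-P)F'_{bv}+L(1-P)F_{bv}=0\},$$ where $F_{bv}=(f_1(0),\dots,f_E(0),f_1(l_1),\dots,f_E(l_E))$ and $F'_{bv}=(f_1'(0),\dots,f_E'(0),-f_1'(l_1),\dots,-f_E'(l_E))$. Dirichlet conditions are $P=1$; Neumann conditions are $P=0$, $L=0$. The free $N$-particle Laplacian $-\Delta_N=\sum_{j=1}^N 1\otimes\dots\otimes(-\Delta_1)\otimes\dots\otimes 1$ is the closure of this operator on the algebraic tensor power of the domain of $-\Delta_1$, and it is restricted to the bosonic (totally symmetric) subspace of $L^2(\Gamma)^{\otimes N}$. In the thermodynamical limit the lengths are replaced by $\eta l_e$ with $\eta\to\infty$,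 while $P$ and $L$ stay fixed. **Proposition.** Suppose that $L$ is negative semi-definite. Then the free Bose gas with one-particle Laplacian $-\Delta_1(P,L)$ shows no Bose-Einstein condensation at any finite temperature in the thermodynamical limit. Precisely, let $0<\beta<\infty$. For all $\eta>0$ and $N\ge1$ the operator $-\Delta_1$ (also with Dirichlet or Neumann conditions in place of $(P,L)$) and the bosonic $-\Delta_N$ on the graph with lengths $\eta l_e$ have complete orthonormal sequences of eigenvectors. Write $k_n^2$ for the eigenvalues of $-\Delta_1$, counted with multiplicity, at scale $\eta$. Then: 1. (Limiting density.) For every $\mu<0$ the grand-canonical expected particle number $N(\beta,\mu)=\sum_n\frac1{e^{\beta(k_n^2-\mu)}-1}$ is finite, and $$\lim_{\eta\to\infty}\frac{N(\beta,\mu)}{\eta\mathcal L}=\rho(\beta,\mu):=\frac1\pi\int_0^\infty\frac{dk}{e^{\beta(k^2-\mu)}-1}.$$ The same holds, with the same limit, for Dirichlet and for Neumann conditions. 2. (No critical density.) $\mu\mapsto\rho(\beta,\mu)$ is a bijection from $(-\infty,0)$ onto $(0,\infty)$. 3. (Grand-canonical ensemble.) Let $\rho_0>0$. For every $\eta>0$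 there is a unique $\mu_\eta<\min_n k_n^2$ with $N(\beta,\mu_\eta)=\rho_0\,\eta\mathcal L$, and no one-particle eigenstate is macroscopically occupied: $$\lim_{\eta\to\infty}\ \frac1{\eta\mathcal L}\ \sup_n\frac1{e^{\beta(k_n^2-\mu_\eta)}-1}=0.$$ 4. (Canonical ensemble.) Let $\rho_0>0$ and let $\eta_N>0$ be such that $N/(\eta_N\mathcal L)\to\rho_0$ as $N\to\infty$. Let $(\Psi_n)$ be a complete orthonormal sequence of eigenvectors of the bosonic $-\Delta_N$ on the graph with lengths $\eta_N l_e$, with eigenvalues $E_n$. Then $Z_N(\beta)=\sum_n e^{-\beta E_n}$ is finite, the reduced one-particle density matrix $\rho_1=N\,\mathrm{tr}_{2\dots N}\,\rho_N$ of the thermal state $\rho_N=Z_N(\beta)^{-1}\sum_n e^{-\beta E_n}|\Psi_n\rangle\langle\Psi_n|$ has a largest eigenvalue $\lambda_{\max}$, and $\lambda_{\max}/N\to0$ as $N\to\infty$. In particular there are no $0<c_1\le c_2$ and $N_0$ with $c_1<\lambda_{\max}/N<c_2$ for all $N\ge N_0$, i.e. there is no BEC in the sense of Penrose and Onsager. 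-/

import Mathlib

open MeasureTheory Filter Topology Set
open scoped InnerProductSpace ENNReal

noncomputable section

namespace QuantumGraph

/-! ### The one-particle Hilbert space and the one-particle Laplacian -/

/-- The disjoint union of the open intervals `(0, l e)`, `e = 1, …, E`, with Lebesgue measure on each
of them, realised inside `Fin E × ℝ`: the point `(e, x)` is the point `x` of the edge `e`. -/
def edgeMeasure {E : ℕ} (l : Fin E → ℝ) : Measure (Fin E × ℝ) :=
  (Measure.count.prod volume).restrict {p | p.2 ∈ Ioo 0 (l p.1)}

instance {E : ℕ} (l : Fin E → ℝ) : SigmaFinite (edgeMeasure l) := by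
  unfold edgeMeasure; infer_instance

/-- The total length of the graph. -/
def totalLength {E : ℕ} (l : Fin E → ℝ) : ℝ := ∑ e, l e

/-- `L²(Γ) = ⨁ₑ L²(0, lₑ)`. -/
abbrev L2 {E : ℕ} (l : Fin E → ℝ) : Type := Lp ℂ 2 (edgeMeasure l)

/-- The space `ℂ^{2E}` of boundary values; `Sum.inl e` is the end `x = 0` and `Sum.inr e` the end
`x = l e` of the edge `e`. -/
abbrev BoundarySpace (E : ℕ) : Type := EuclideanSpace ℂ (Fin E ⊕ Fin E)

/-- Self-adjoint vertex conditions: an orthogonal projector `P` on `ℂ^{2E}` and a self-adjoint map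
`L` on `ker P`. -/
structure VertexConditions (E : ℕ) where
  P : BoundarySpace E →ₗ[ℂ] BoundarySpace E
  isProj : P.IsSymmetricProjection
  L : LinearMap.ker P →ₗ[ℂ] LinearMap.ker P
  isSymm : LinearMap.IsSymmetric (𝕜 := ℂ) (E := LinearMap.ker P) L

/-- `L` is negative semi-definite. -/
def VertexConditions.NegSemidef {E : ℕ} (bc : VertexConditions E) : Prop :=
  ∀ v : LinearMap.ker bc.P, (@inner ℂ (LinearMap.ker bc.P) InnerProductSpace.toInner v (bc.L v)).re ≤ 0

/-- Dirichlet conditions: `P = 1` (so that `L = 0`). -/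
def dirichlet (E : ℕ) : VertexConditions E where
  P := LinearMap.id
  isProj := ⟨rfl, fun _ _ => rfl⟩
  L := 0
  isSymm := LinearMap.IsSymmetric.zero

/-- Neumann conditions: `P = 0` and `L = 0`. -/
def neumann (E : ℕ) : VertexConditions E where
  P := 0
  isProj := ⟨by simp [IsIdempotentElem], fun _ _ => by simp⟩
  L := 0
  isSymm := LinearMap.IsSymmetric.zero

/-- `f ∈ H²(0, a)` with derivatives `f'` and `f''`: on `[0, a]` the functions `f` and `f'` are the
absolutely continuous functions with derivative `f'` and `f'' ∈ L²(0, a)`, respectively. -/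
structure IsSobolevTwo (a : ℝ) (f f' f'' : ℝ → ℂ) : Prop where
  memLp : MemLp f'' 2 (volume.restrict (Ioo 0 a))
  deriv_eq : ∀ x ∈ Icc 0 a, f' x = f' 0 + ∫ t in (0 : ℝ)..x, f'' t
  eq : ∀ x ∈ Icc 0 a, f x = f 0 + ∫ t in (0 : ℝ)..x, f' t

/-- The boundary values `(f₁(0), …, f_E(0), f₁(l₁), …, f_E(l_E))`. -/
def boundaryValue {E : ℕ} (l : Fin E → ℝ) (f : Fin E → ℝ → ℂ) : BoundarySpace E :=
  WithLp.toLp 2 (Sum.elim (fun e => f e 0) (fun e => f e (l e)))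

/-- The boundary derivatives `(f₁'(0), …, f_E'(0), -f₁'(l₁), …, -f_E'(l_E))`, as a function of the
derivatives `f'`. -/
def boundaryDeriv {E : ℕ} (l : Fin E → ℝ) (f' : Fin E → ℝ → ℂ) : BoundarySpace E :=
  WithLp.toLp 2 (Sum.elim (fun e => f' e 0) (fun e => -f' e (l e)))

/-- The graph of the one-particle Laplacian `-Δ₁` with domain
`{F ∈ H²(Γ); P F_bv = 0, (1 - P) F'_bv + L (1 - P) F_bv = 0}`: the pairs `(F, -F'')`.
(On the domain, `(1 - P) F_bv = F_bv`.) -/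
def laplacian {E : ℕ} (bc : VertexConditions E) (l : Fin E → ℝ) : Set (L2 l × L2 l) :=
  {FG | ∃ f f' f'' : Fin E → ℝ → ℂ,
    (∀ e, IsSobolevTwo (l e) (f e) (f' e) (f'' e)) ∧
    (∀ᵐ x ∂edgeMeasure l, FG.1 x = f x.1 x.2) ∧
    (∀ᵐ x ∂edgeMeasure l, FG.2 x = -f'' x.1 x.2) ∧
    ∃ h : bc.P (boundaryValue l f) = 0,
      (boundaryDeriv l f' - bc.P (boundaryDeriv l f'))
        + (bc.L ⟨boundaryValue l f, LinearMap.mem_ker.2 h⟩ : BoundarySpace E) = 0}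

/-! ### Many particles -/

/-- The `N`-particle Hilbert space `L²(D_Γ^N)`, the `N`-fold tensor power of `L²(Γ)`. -/
abbrev L2N {E : ℕ} (l : Fin E → ℝ) (N : ℕ) : Type :=
  Lp ℂ 2 (Measure.pi fun _ : Fin N => edgeMeasure l)

theorem memLp_prod {E : ℕ} (l : Fin E → ℝ) {N : ℕ} (φ : Fin N → L2 l) :
    MemLp (fun x : Fin N → Fin E × ℝ => ∏ j, φ j (x j)) 2
      (Measure.pi fun _ : Fin N => edgeMeasure l) := by
  have hm : AEStronglyMeasurable (fun x : Fin N → Fin E × ℝ => ∏ j, φ j (x j))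
      (Measure.pi fun _ : Fin N => edgeMeasure l) := by
    refine Finset.aestronglyMeasurable_fun_prod _ fun j _ => ?_
    exact (Lp.aestronglyMeasurable (φ j)).comp_quasiMeasurePreserving
      (Measure.quasiMeasurePreserving_eval (fun _ : Fin N => edgeMeasure l) j)
  rw [memLp_two_iff_integrable_sq_norm hm]
  have h : ∀ j, Integrable (fun x => ‖φ j x‖ ^ 2) (edgeMeasure l) := fun j =>
    (memLp_two_iff_integrable_sq_norm (Lp.aestronglyMeasurable (φ j))).1 (Lp.memLp (φ j))
  simpa [norm_prod, Finset.prod_pow] using Integrable.fintype_prod h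

/-- The elementary tensor `φ₁ ⊗ … ⊗ φ_N`. -/
def tensor {E : ℕ} {l : Fin E → ℝ} {N : ℕ} (φ : Fin N → L2 l) : L2N l N :=
  (memLp_prod l φ).toLp _

theorem memLp_cons {E : ℕ} (l : Fin E → ℝ) {N : ℕ} (φ : L2 l) (Ψ : L2N l N) :
    MemLp (fun x : Fin (N + 1) → Fin E × ℝ => φ (x 0) * Ψ (fun i => x i.succ)) 2
      (Measure.pi fun _ : Fin (N + 1) => edgeMeasure l) := by
  have hp := measurePreserving_piFinSuccAbove (fun _ : Fin (N + 1) => edgeMeasure l) 0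
  have hφ : AEStronglyMeasurable (fun z : (Fin E × ℝ) × (Fin N → Fin E × ℝ) => φ z.1 * Ψ z.2)
      ((edgeMeasure l).prod (Measure.pi fun _ : Fin N => edgeMeasure l)) :=
    (Lp.aestronglyMeasurable φ).comp_fst.mul (Lp.aestronglyMeasurable Ψ).comp_snd
  have h : MemLp (fun z : (Fin E × ℝ) × (Fin N → Fin E × ℝ) => φ z.1 * Ψ z.2) 2
      ((edgeMeasure l).prod (Measure.pi fun _ : Fin N => edgeMeasure l)) := by
    rw [memLp_two_iff_integrable_sq_norm hφ]
    have h1 := (memLp_two_iff_integrable_sq_norm (Lp.aestronglyMeasurable φ)).1 (Lp.memLp φ)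
    have h2 := (memLp_two_iff_integrable_sq_norm (Lp.aestronglyMeasurable Ψ)).1 (Lp.memLp Ψ)
    simpa [norm_mul, mul_pow] using h1.mul_prod h2
  exact h.comp_measurePreserving hp

/-- The tensor product `φ ⊗ Ψ` of a one-particle and an `N`-particle vector. -/
def tensorCons {E : ℕ} {l : Fin E → ℝ} {N : ℕ} (φ : L2 l) (Ψ : L2N l N) : L2N l (N + 1) :=
  (memLp_cons l φ Ψ).toLp _

/-- The graph of the free `N`-particle Laplacian
`-Δ_N = ∑ⱼ 1 ⊗ … ⊗ (-Δ₁) ⊗ … ⊗ 1`: the closure of this operator on the algebraic tensor power of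
the domain of `-Δ₁`. -/
def freeLaplacian {E : ℕ} (bc : VertexConditions E) (l : Fin E → ℝ) (N : ℕ) :
    Submodule ℂ (L2N l N × L2N l N) :=
  (Submodule.span ℂ {ΨΦ | ∃ p : Fin N → L2 l × L2 l, (∀ j, p j ∈ laplacian bc l) ∧
    ΨΦ = (tensor fun i => (p i).1,
      ∑ j, tensor (Function.update (fun i => (p i).1) j (p j).2))}).topologicalClosure

theorem measurePreserving_perm {E : ℕ} (l : Fin E → ℝ) {N : ℕ} (σ : Equiv.Perm (Fin N)) :
    MeasurePreserving (fun (x : Fin N → Fin E × ℝ) (i : Fin N) => x (σ i))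
      (Measure.pi fun _ : Fin N => edgeMeasure l) (Measure.pi fun _ : Fin N => edgeMeasure l) := by
  have h := measurePreserving_piCongrLeft (fun _ : Fin N => edgeMeasure l) σ.symm
  convert h using 1
  funext x i
  rw [MeasurableEquiv.coe_piCongrLeft, Equiv.piCongrLeft_apply]
  simp

/-- The bosonic subspace: the vectors that are invariant under all particle exchanges. -/
def bosonic {E : ℕ} (l : Fin E → ℝ) (N : ℕ) : Submodule ℂ (L2N l N) :=
  ⨅ σ : Equiv.Perm (Fin N),
    LinearMap.eqLocus
      (Lp.compMeasurePreservingₗ ℂ (p := 2) (E := ℂ) _ (measurePreserving_perm l σ)) LinearMap.id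

/-- The graph of the bosonic realisation of the free `N`-particle Laplacian. -/
def bosonicLaplacian {E : ℕ} (bc : VertexConditions E) (l : Fin E → ℝ) (N : ℕ) :
    Set (bosonic l N × bosonic l N) :=
  {ΨΦ | ((ΨΦ.1 : L2N l N), (ΨΦ.2 : L2N l N)) ∈ freeLaplacian bc l N}

/-! ### Spectral data and statistical mechanics -/

/-- A complete orthonormal sequence of eigenvectors `vec n`, with eigenvalues `val n`, of the
operator with graph `T`. -/
structure Eigensystem {H : Type*} [NormedAddCommGroup H] [InnerProductSpace ℂ H]
    (T : Set (H × H)) where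
  vec : HilbertBasis ℕ ℂ H
  val : ℕ → ℝ
  eig : ∀ n, (vec n, (val n : ℂ) • vec n) ∈ T

/-- The grand-canonical expected number of bosons in a one-particle state of energy `ε` at inverse
temperature `β` and chemical potential `μ`. -/
def occupation (β μ ε : ℝ) : ℝ := 1 / (Real.exp (β * (ε - μ)) - 1)

/-- `(1 / π) ∫₀^∞ dk / (exp (β (k² - μ)) - 1)`. -/
def limitDensity (β μ : ℝ) : ℝ := (1 / Real.pi) * ∫ k in Ioi (0 : ℝ), occupation β μ (k ^ 2)

/-- The canonical partition function `∑ₙ exp (-β Eₙ)`. -/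
def partitionFunction {H : Type*} [NormedAddCommGroup H] [InnerProductSpace ℂ H]
    {T : Set (H × H)} (S : Eigensystem T) (β : ℝ) : ℝ := ∑' n, Real.exp (-β * S.val n)

/-- The canonical thermal density matrix
`ρ_N = Z_N(β)⁻¹ ∑ₙ exp (-β Eₙ) |Ψₙ⟩⟨Ψₙ|` of the bosonic `N`-particle system. -/
def thermalState {E : ℕ} {bc : VertexConditions E} {l : Fin E → ℝ} {N : ℕ}
    (S : Eigensystem (bosonicLaplacian bc l N)) (β : ℝ) : L2N l N →L[ℂ] L2N l N :=
  ∑' n, ((Real.exp (-β * S.val n) / partitionFunction S β : ℝ) : ℂ) •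
    InnerProductSpace.rankOne ℂ (S.vec n : L2N l N) (S.vec n : L2N l N)

/-- `T` is the partial trace of `A` over the particles `2, …, N + 1`. -/
def IsPartialTrace {E : ℕ} {l : Fin E → ℝ} {N : ℕ}
    (A : L2N l (N + 1) →L[ℂ] L2N l (N + 1)) (T : L2 l →L[ℂ] L2 l) : Prop :=
  ∀ (κ : Type) (b : HilbertBasis κ ℂ (L2N l N)) (φ ψ : L2 l),
    HasSum (fun k => ⟪tensorCons φ (b k), A (tensorCons ψ (b k))⟫_ℂ) ⟪φ, T ψ⟫_ℂ

/-- `T` is the reduced one-particle density matrix `ρ₁ = (N + 1) tr_{2 … N + 1} ρ_{N + 1}` of the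
canonical thermal state of `N + 1` bosons. -/
def IsReducedDensityMatrix {E : ℕ} {bc : VertexConditions E} {l : Fin E → ℝ} {N : ℕ}
    (S : Eigensystem (bosonicLaplacian bc l (N + 1))) (β : ℝ) (T : L2 l →L[ℂ] L2 l) : Prop :=
  IsPartialTrace (((N : ℂ) + 1) • thermalState S β) T

/-- `lam` is the largest eigenvalue of `T`. -/
def IsLargestEigenvalue {H : Type*} [NormedAddCommGroup H] [InnerProductSpace ℂ H]
    (T : H →L[ℂ] H) (lam : ℝ) : Prop :=
  IsGreatest {r : ℝ | Module.End.HasEigenvalue (T : H →ₗ[ℂ] H) (r : ℂ)} lam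

/-- The Penrose-Onsager criterion; `r N` is the largest eigenvalue of the reduced one-particle
density matrix divided by the particle number, along a sequence of systems in which the particle
number increases by one at each step. -/
def PenroseOnsagerBEC (r : ℕ → ℝ) : Prop :=
  ∃ c₁ c₂ : ℝ, ∃ N₀ : ℕ, 0 < c₁ ∧ c₁ ≤ c₂ ∧ ∀ N ≥ N₀, c₁ < r N ∧ r N < c₂

end QuantumGraph

end

/-! Everything rests on a one-dimensional Weyl estimate that is uniform in the scale. For
nonnegative antitone `g` with integrable `k ↦ g (k ^ 2)`, the sum of `g` over the spectrum differs
from `totalLength l / π * ∫ g (k ^ 2)` by at most `5 * E * g 0`, a bound that ignores the lengths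
and the vertex conditions (`Eigensystem.summable_and_abs_tsum_sub_le`). To get it, the spectrum is
compared with that of the exponentials on decoupled edges. Both eigenbases belong to the maximal
Laplacian, and vanishing of all boundary values and derivatives costs only `4 * E` linear
conditions, so a min-max argument bounds the difference of the counting functions
(`card_le_card_add`). Hall's theorem turns this into a comparison of sums, and the integral test
evaluates the sum for the exponentials. Negativity of `L` makes the spectrum nonnegative, so no
bound states can collect particles.

The eigenbasis comes from the resolvent: `H²(Γ)` is parametrised by second derivatives and initial
data, the boundary value problem becomes a compact perturbation of the identity, and the Fredholm
alternative applies (`exists_resolvent`).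

In the grand-canonical ensemble the limiting density diverges as `μ → 0⁻`, since `dk / (k² + |μ|)`
is not integrable at `μ = 0` in dimension one. At a given density, `μ_η` therefore stays eventually
below a fixed `ν < 0`, and all occupations are bounded by that of energy `0` at `ν`.

In the canonical ensemble, an arbitrary eigenbasis of the bosonic Laplacian gives the same thermal
state as the symmetrised tensors of one-particle eigenvectors, so the reduced density matrix has the
mean occupations as eigenvalues (`exists_isReducedDensityMatrix`). These are `∑ j, exp (-β a i) ^ j
* Z (N - j) / Z N`, whose terms are the probabilities of finding at least `j` particles in state
`i`. If one state held `c N` particles, then `Z (N - j) / Z N ≥ c / 2` for every `j ≤ J` once `J ≤ c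
N / 2`, and adding the occupations of all states would give at least `c / 2 * ∑_{j ≤ J} ∑ i, exp (-j
β a i)` particles (`mul_sum_tsum_exp_le`). By the Weyl estimate the inner sums grow like the length
times a multiple of `j ^ (-1/2)`. That series diverges, so a fixed large `J` contradicts the finite
density. No equivalence of ensembles is needed. -/

noncomputable section

namespace QuantumGraph

/-! ### Hilbert bases and compact operators -/

section Hilbert

variable {H : Type*} [NormedAddCommGroup H] [InnerProductSpace ℂ H]

theorem HilbertBasis.eq_zero_of_inner {ι : Type*} (b : HilbertBasis ι ℂ H) {x : H}
    (h : ∀ i, ⟪b i, x⟫_ℂ = 0) : x = 0 := by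
  apply b.repr.injective
  ext i
  simp [b.repr_apply_apply, h]

theorem HilbertBasis.hasSum_norm_sq {ι : Type*} (b : HilbertBasis ι ℂ H) (x : H) :
    HasSum (fun i => ‖⟪b i, x⟫_ℂ‖ ^ 2) (‖x‖ ^ 2) := by
  have h := b.hasSum_inner_mul_inner x x
  have h2 := Complex.hasSum_re h
  convert h2 using 1
  · funext i
    rw [← inner_conj_symm x (b i), Complex.conj_mul']
    norm_cast
  · exact (inner_self_eq_norm_sq (𝕜 := ℂ) x).symm

/-- By Bessel's inequality each `b k` has nonzero overlap with only countably many `v i`, and a `v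
i` without any overlap would vanish. -/
theorem Orthonormal.countable_of_hilbertBasis {ι κ : Type*} [Countable κ] (b : HilbertBasis κ ℂ H)
    {v : ι → H} (hv : Orthonormal ℂ v) : Countable ι := by
  have h : ∀ k, {i | ⟪v i, b k⟫_ℂ ≠ 0}.Countable := by
    intro k
    have := (hv.inner_products_summable (x := b k)).countable_support
    convert this using 1
    ext i; simp [Function.mem_support]
  have h2 : (⋃ k, {i | ⟪v i, b k⟫_ℂ ≠ 0}) = univ := by
    rw [eq_univ_iff_forall]
    intro i
    by_contra hi
    simp only [mem_iUnion, mem_ofPred_eq, not_exists, not_not] at hi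
    have : v i = 0 := HilbertBasis.eq_zero_of_inner b fun k => by
      rw [← inner_conj_symm, hi k, map_zero]
    exact hv.ne_zero i this
  exact Set.countable_univ_iff.1 (h2 ▸ Set.countable_iUnion h)

theorem HilbertBasis.infinite_of_hilbertBasis {ι κ : Type*} [Infinite κ] (b : HilbertBasis κ ℂ H)
    (v : HilbertBasis ι ℂ H) : Infinite ι := by
  by_contra hfin
  rw [not_infinite_iff_finite] at hfin
  have hf : FiniteDimensional ℂ (Submodule.span ℂ (range v)) :=
    FiniteDimensional.span_of_finite ℂ (finite_range v)
  have h1 : Submodule.span ℂ (range v) = ⊤ := by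
    rw [← v.dense_span]
    exact ((Submodule.span ℂ (range v)).closed_of_finiteDimensional).submodule_topologicalClosure_eq.symm
  rw [h1] at hf
  have : FiniteDimensional ℂ H := Module.Finite.equiv (Submodule.topEquiv (R := ℂ) (M := H))
  exact not_finite_iff_infinite.2 ‹Infinite κ› b.orthonormal.linearIndependent.finite

/-- An `Eigensystem` is a sequence, whereas eigenbases arise over other index types. One countably
infinite basis forces every basis to be countably infinite. -/
theorem exists_hilbertBasis_nat [CompleteSpace H] {ι κ : Type*} [Countable κ] [Infinite κ] (b : HilbertBasis κ ℂ H)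
    (v : HilbertBasis ι ℂ H) : ∃ (w : HilbertBasis ℕ ℂ H) (e : ℕ ≃ ι), ∀ n, w n = v (e n) := by
  have := Orthonormal.countable_of_hilbertBasis b v.orthonormal
  have := HilbertBasis.infinite_of_hilbertBasis b v
  obtain ⟨e⟩ := nonempty_equiv_of_countable (α := ℕ) (β := ι)
  refine ⟨HilbertBasis.mk (v.orthonormal.comp e e.injective) ?_, e, fun n => by simp⟩
  rw [EquivLike.range_comp, v.dense_span]

/-- An operator that is Hilbert-Schmidt is compact. -/
theorem isCompactOperator_of_sum_norm_sq_le {K ι : Type*} [NormedAddCommGroup K]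
    [InnerProductSpace ℂ K] [CompleteSpace K] (b : HilbertBasis ι ℂ H) (A : H →L[ℂ] K) (M : ℝ)
    (hM : ∀ s : Finset ι, ∑ i ∈ s, ‖A (b i)‖ ^ 2 ≤ M) : IsCompactOperator A := by
  classical
  have hs : Summable fun i => ‖A (b i)‖ ^ 2 :=
    summable_of_sum_le (fun i => by positivity) hM
  -- Finite-rank truncations of `A`. By Cauchy-Schwarz, `‖F t x - A x‖` is at most `‖x‖` times the
  -- square root of a tail of `∑ ‖A (b i)‖ ^ 2`, so they converge in operator norm.
  let F : Finset ι → H →L[ℂ] K := fun s =>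
    ∑ i ∈ s, (innerSL ℂ (b i)).smulRight (A (b i))
  refine isCompactOperator_of_tendsto (l := atTop) (F := F) ?_ (Eventually.of_forall fun s => ?_)
  · rw [Metric.tendsto_atTop]
    intro ε hε
    have h0 := hs.vanishing (e := Metric.ball 0 ((ε / 2) ^ 2)) (Metric.ball_mem_nhds _ (by positivity))
    obtain ⟨s, hs'⟩ := h0
    refine ⟨s, fun t hst => ?_⟩
    rw [dist_eq_norm]
    refine lt_of_le_of_lt (ContinuousLinearMap.opNorm_le_bound _ (M := ε / 2) (by positivity)
      fun x => ?_) (half_lt_self hε)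
    have hx : HasSum (fun i => ⟪b i, x⟫_ℂ • A (b i)) (A x) := by
      have := (b.hasSum_repr x).mapL A
      simpa [b.repr_apply_apply] using this
    have hlim : Tendsto (fun r : Finset ι => F t x - ∑ i ∈ r, ⟪b i, x⟫_ℂ • A (b i)) atTop
        (𝓝 (F t x - A x)) := tendsto_const_nhds.sub hx
    rw [sub_apply]
    refine le_of_tendsto hlim.norm ?_
    filter_upwards [eventually_ge_atTop t] with r hr
    have h1 : F t x - ∑ i ∈ r, ⟪b i, x⟫_ℂ • A (b i) = -∑ i ∈ r \ t, ⟪b i, x⟫_ℂ • A (b i) := by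
      rw [← Finset.sum_sdiff hr]
      simp [F]
    rw [h1, norm_neg]
    calc ‖∑ i ∈ r \ t, ⟪b i, x⟫_ℂ • A (b i)‖ ≤ ∑ i ∈ r \ t, ‖⟪b i, x⟫_ℂ‖ * ‖A (b i)‖ := by
          refine (norm_sum_le _ _).trans_eq (Finset.sum_congr rfl fun i _ => norm_smul _ _)
      _ ≤ √(∑ i ∈ r \ t, ‖⟪b i, x⟫_ℂ‖ ^ 2) * √(∑ i ∈ r \ t, ‖A (b i)‖ ^ 2) :=
          Real.sum_mul_le_sqrt_mul_sqrt _ _ _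
      _ ≤ ‖x‖ * (ε / 2) := by
          gcongr
          · exact Real.sqrt_le_left (norm_nonneg x) |>.2
              (sum_le_hasSum _ (fun i _ => by positivity) (HilbertBasis.hasSum_norm_sq b x))
          · rw [Real.sqrt_le_left (by positivity)]
            have := hs' (r \ t) (Finset.disjoint_of_subset_right hst Finset.sdiff_disjoint)
            rw [mem_ball_zero_iff, Real.norm_eq_abs] at this
            exact (le_abs_self _).trans this.le
      _ = ε / 2 * ‖x‖ := mul_comm _ _
  · have : ∀ t : Finset ι, IsCompactOperator (F t) := by
      intro t
      induction t using Finset.induction_on with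
      | empty => simpa [F] using isCompactOperator_zero
      | insert a t ha ih =>
        have h : F (insert a t) = (innerSL ℂ (b a)).smulRight (A (b a)) + F t := by
          simp [F, Finset.sum_insert ha]
        rw [h]
        refine IsCompactOperator.add ?_ ih
        have h2 : ((innerSL ℂ (b a)).smulRight (A (b a)) : H →L[ℂ] K) =
          ((ContinuousLinearMap.id ℂ ℂ).smulRight (A (b a))).comp (innerSL ℂ (b a)) := by
          ext x; simp
        rw [h2]
        have h3 : IsCompactOperator ((ContinuousLinearMap.id ℂ ℂ).smulRight (A (b a)) : ℂ →L[ℂ] K) :=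
          isCompactOperator_of_locallyCompactSpace_rng _
        exact h3.comp_clm (innerSL ℂ (b a))
    exact this s

/-- The spectral theorem for an injective compact self-adjoint operator. -/
theorem exists_hilbertBasis_eigenvectors [CompleteSpace H] {κ : Type*} [Countable κ] [Infinite κ]
    (b : HilbertBasis κ ℂ H)
    (R : H →L[ℂ] H) (hR : IsCompactOperator R) (hs : (R : H →ₗ[ℂ] H).IsSymmetric)
    (hi : Function.Injective R) :
    ∃ (w : HilbertBasis ℕ ℂ H) (r : ℕ → ℝ), ∀ n, r n ≠ 0 ∧ R (w n) = (r n : ℂ) • w n := by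
  have hbot := ContinuousLinearMap.orthogonalComplement_iSup_eigenspaces_eq_bot hR hs
  let V : ℂ → Submodule ℂ H := fun z => Module.End.eigenspace (R : H →ₗ[ℂ] H) z
  have hV : ∀ z, IsClosed (V z : Set H) := fun z => by
    have : (V z : Set H) = {x | R x = z • x} := by
      ext x; simp [V]
    rw [this]
    exact isClosed_eq (by fun_prop) (by fun_prop)
  have : ∀ z, CompleteSpace (V z) := fun z => (hV z).completeSpace_coe
  have hb : ∀ z, ∃ (w : Set (V z)) (b : HilbertBasis w ℂ (V z)), ⇑b = ((↑) : w → V z) := fun z =>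
    exists_hilbertBasis ℂ (V z)
  choose S B hB using hb
  have hon : Orthonormal ℂ fun a : Σ z, S z => ((B a.1 a.2 : V a.1) : H) :=
    hs.orthogonalFamily_eigenspaces.orthonormal_sigma_orthonormal (fun z => (B z).orthonormal)
  have hsp : (Submodule.span ℂ (range fun a : Σ z, S z => ((B a.1 a.2 : V a.1) : H)))ᗮ = ⊥ := by
    rw [eq_bot_iff]
    intro x hx
    have hbot' : (⨆ z, V z)ᗮ = ⊥ := hbot
    rw [← hbot', ← Submodule.iInf_orthogonal, Submodule.mem_iInf]
    intro z
    rw [Submodule.mem_orthogonal]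
    intro u hu
    have h1 := ((B z).hasSum_repr ⟨u, hu⟩).mapL (V z).subtypeL
    have h2 := h1.mapL (innerSL ℂ x)
    have h3 : ∀ i, ⟪x, ((B z i : V z) : H)⟫_ℂ = 0 := fun i =>
      (Submodule.mem_orthogonal' _ _).1 hx _ (Submodule.subset_span ⟨⟨z, i⟩, rfl⟩)
    have h4 : ⟪x, u⟫_ℂ = 0 := by
      refine h2.unique ?_
      convert hasSum_zero with i
      simp [h3]
    rw [← inner_conj_symm, h4, map_zero]
  let v := HilbertBasis.mkOfOrthogonalEqBot hon hsp
  have hv : ∀ a : Σ z, S z, R (v a) = a.1 • v a := fun a => by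
    have : v a = ((B a.1 a.2 : V a.1) : H) := by simp [v]
    rw [this]
    exact Module.End.mem_eigenspace_iff.1 (B a.1 a.2).2
  obtain ⟨w, e, hw⟩ := exists_hilbertBasis_nat b v
  refine ⟨w, fun n => (e n).1.re, fun n => ?_⟩
  have hwn : w n ≠ 0 := w.orthonormal.ne_zero n
  have hRw : R (w n) = (e n).1 • w n := by rw [hw, hv]
  have hev : Module.End.HasEigenvalue (R : H →ₗ[ℂ] H) (e n).1 :=
    Module.End.hasEigenvalue_of_hasEigenvector (x := w n)
      ⟨Module.End.mem_eigenspace_iff.2 hRw, hwn⟩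
  have hreal : (((e n).1.re : ℝ) : ℂ) = (e n).1 :=
    Complex.conj_eq_iff_re.1 (hs.conj_eigenvalue_eq_self hev)
  -- Injectivity of `R` excludes the eigenvalue `0`.
  refine ⟨fun h0 => hwn (hi ?_), by rw [hreal, hRw]⟩
  rw [hRw, ← hreal, show (e n).1.re = 0 from h0]; simp

end Hilbert

/-! ### Integration over the edges -/

/-- Counting measure on finitely many edges is a sum of Dirac masses. Through this decomposition
almost-everywhere statements, integrability and integrals reduce to single edges. -/
theorem edgeMeasure_eq {E : ℕ} (l : Fin E → ℝ) :
    edgeMeasure l = ∑ e, (volume.restrict (Ioo 0 (l e))).map (Prod.mk e) := by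
  have h1 : (Measure.count.prod volume : Measure (Fin E × ℝ)) =
      ∑ e : Fin E, (volume : Measure ℝ).map (Prod.mk e) := by
    rw [Measure.count, Measure.prod_sum_left, Measure.sum_fintype]
    simp_rw [Measure.dirac_prod]
  have hm : MeasurableSet {p : Fin E × ℝ | p.2 ∈ Ioo 0 (l p.1)} := by
    have hl : Measurable fun p : Fin E × ℝ => l p.1 := (measurable_of_finite l).comp measurable_fst
    exact (measurableSet_lt measurable_const measurable_snd).inter (measurableSet_lt measurable_snd hl)
  rw [edgeMeasure, h1, ← Measure.sum_fintype, Measure.restrict_sum _ hm, Measure.sum_fintype]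
  refine Finset.sum_congr rfl fun e _ => ?_
  rw [Measure.restrict_map measurable_prodMk_left hm]
  rfl

instance {E : ℕ} (l : Fin E → ℝ) : IsFiniteMeasure (edgeMeasure l) := by
  rw [edgeMeasure_eq]; infer_instance

theorem ae_edgeMeasure_iff {E : ℕ} {l : Fin E → ℝ} {p : Fin E × ℝ → Prop} :
    (∀ᵐ x ∂edgeMeasure l, p x) ↔ ∀ e, ∀ᵐ x ∂volume.restrict (Ioo 0 (l e)), p (e, x) := by
  rw [edgeMeasure_eq, ← Measure.sum_fintype, Measure.ae_sum_iff]
  simp_rw [(measurableEmbedding_prodMk_left _).ae_map_iff]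

theorem integrable_edgeMeasure_iff {E : ℕ} {l : Fin E → ℝ} {F : Type*} [NormedAddCommGroup F]
    {f : Fin E × ℝ → F} :
    Integrable f (edgeMeasure l) ↔
      ∀ e, Integrable (fun x => f (e, x)) (volume.restrict (Ioo 0 (l e))) := by
  rw [edgeMeasure_eq, integrable_finsetSum_measure]
  simp_rw [(measurableEmbedding_prodMk_left _).integrable_map_iff]
  simp [Function.comp_def]

theorem aestronglyMeasurable_edgeMeasure_iff {E : ℕ} {l : Fin E → ℝ} {f : Fin E × ℝ → ℂ} :
    AEStronglyMeasurable f (edgeMeasure l) ↔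
      ∀ e, AEStronglyMeasurable (fun x => f (e, x)) (volume.restrict (Ioo 0 (l e))) := by
  rw [edgeMeasure_eq, ← Measure.sum_fintype, aestronglyMeasurable_sum_measure_iff]
  simp_rw [(measurableEmbedding_prodMk_left _).aestronglyMeasurable_map_iff]
  rfl

theorem memLp_edgeMeasure_iff {E : ℕ} {l : Fin E → ℝ} {f : Fin E × ℝ → ℂ} :
    MemLp f 2 (edgeMeasure l) ↔
      ∀ e, MemLp (fun x => f (e, x)) 2 (volume.restrict (Ioo 0 (l e))) := by
  constructor
  · intro h e
    have hm := aestronglyMeasurable_edgeMeasure_iff.1 h.1 e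
    exact (memLp_two_iff_integrable_sq_norm hm).2
      (integrable_edgeMeasure_iff.1 ((memLp_two_iff_integrable_sq_norm h.1).1 h) e)
  · intro h
    have hm := aestronglyMeasurable_edgeMeasure_iff.2 fun e => (h e).1
    exact (memLp_two_iff_integrable_sq_norm hm).2
      (integrable_edgeMeasure_iff.2 fun e => (memLp_two_iff_integrable_sq_norm (h e).1).1 (h e))

theorem integral_edgeMeasure {E : ℕ} {l : Fin E → ℝ} (hl : ∀ e, 0 < l e) {F : Type*}
    [NormedAddCommGroup F] [NormedSpace ℝ F] {f : Fin E × ℝ → F}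
    (hf : Integrable f (edgeMeasure l)) :
    ∫ x, f x ∂edgeMeasure l = ∑ e, ∫ x in (0 : ℝ)..l e, f (e, x) := by
  rw [edgeMeasure_eq] at hf ⊢
  rw [integrable_finsetSum_measure] at hf
  rw [integral_finsetSum_measure hf]
  refine Finset.sum_congr rfl fun e _ => ?_
  rw [(measurableEmbedding_prodMk_left _).integral_map, intervalIntegral.integral_of_le (hl e).le,
    integral_Ioc_eq_integral_Ioo]

/-- The inner product on `L²(Γ)`, in terms of representatives. -/
theorem inner_eq_sum_intervalIntegral {E : ℕ} {l : Fin E → ℝ} (hl : ∀ e, 0 < l e) {F G : L2 l}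
    {f g : Fin E → ℝ → ℂ} (hF : ∀ᵐ x ∂edgeMeasure l, F x = f x.1 x.2)
    (hG : ∀ᵐ x ∂edgeMeasure l, G x = g x.1 x.2) :
    ⟪F, G⟫_ℂ = ∑ e, ∫ x in (0 : ℝ)..l e, star (f e x) * g e x := by
  have h1 : (fun x => ⟪F x, G x⟫_ℂ) =ᵐ[edgeMeasure l] fun x => star (f x.1 x.2) * g x.1 x.2 := by
    filter_upwards [hF, hG] with x h1 h2
    rw [h1, h2, RCLike.inner_apply, mul_comm]; rfl
  rw [L2.inner_def, integral_congr_ae h1, integral_edgeMeasure hl]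
  exact (L2.integrable_inner F G).congr h1

/-! ### Integration by parts for absolutely continuous functions -/

/-- Integration by parts for derivatives that are merely integrable. The two terms are the integrals
of `φ x * γ y` over the triangles `y ≤ x` and `x < y`, which together fill the square. -/
theorem integral_mul_primitive_add_primitive_mul {a : ℝ} (ha : 0 ≤ a) {φ γ : ℝ → ℂ}
    (hφ : IntervalIntegrable φ volume 0 a) (hγ : IntervalIntegrable γ volume 0 a) :
    (∫ x in (0 : ℝ)..a, φ x * ∫ y in (0 : ℝ)..x, γ y) +
      (∫ y in (0 : ℝ)..a, (∫ x in (0 : ℝ)..y, φ x) * γ y) =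
    (∫ x in (0 : ℝ)..a, φ x) * ∫ y in (0 : ℝ)..a, γ y := by
  set μ : Measure ℝ := volume.restrict (Ioc 0 a) with hμ
  have hφ' : Integrable φ μ := (intervalIntegrable_iff_integrableOn_Ioc_of_le ha).1 hφ
  have hγ' : Integrable γ μ := (intervalIntegrable_iff_integrableOn_Ioc_of_le ha).1 hγ
  have hK : Integrable (fun z : ℝ × ℝ => φ z.1 * γ z.2) (μ.prod μ) := hφ'.mul_prod hγ'
  have hS : MeasurableSet {z : ℝ × ℝ | z.2 ≤ z.1} := measurableSet_le measurable_snd measurable_fst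
  have hT : MeasurableSet {z : ℝ × ℝ | z.1 < z.2} := measurableSet_lt measurable_fst measurable_snd
  have hcompl : {z : ℝ × ℝ | z.2 ≤ z.1}ᶜ = {z : ℝ × ℝ | z.1 < z.2} := by ext; simp
  have h1 : (∫ x in (0 : ℝ)..a, φ x * ∫ y in (0 : ℝ)..x, γ y) =
      ∫ z, ({z : ℝ × ℝ | z.2 ≤ z.1}.indicator fun z : ℝ × ℝ => φ z.1 * γ z.2) z ∂(μ.prod μ) := by
    rw [integral_prod _ (hK.indicator hS), intervalIntegral.integral_of_le ha]
    refine setIntegral_congr_fun measurableSet_Ioc fun x hx => ?_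
    have : ∀ y, ({z : ℝ × ℝ | z.2 ≤ z.1}.indicator fun z : ℝ × ℝ => φ z.1 * γ z.2) (x, y) =
        φ x * (Iic x).indicator γ y := by
      intro y
      by_cases h : y ≤ x <;> simp [indicator, h]
    simp_rw [this]
    rw [integral_const_mul, integral_indicator measurableSet_Iic, hμ,
      Measure.restrict_restrict measurableSet_Iic, intervalIntegral.integral_of_le hx.1.le]
    congr 3
    ext y; simp only [mem_Ioc, mem_inter_iff, mem_Iic]
    exact ⟨fun h => ⟨h.2, h.1, h.2.trans hx.2⟩, fun h => ⟨h.2.1, h.1⟩⟩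
  have h2 : (∫ y in (0 : ℝ)..a, (∫ x in (0 : ℝ)..y, φ x) * γ y) =
      ∫ z, ({z : ℝ × ℝ | z.1 < z.2}.indicator fun z : ℝ × ℝ => φ z.1 * γ z.2) z ∂(μ.prod μ) := by
    rw [integral_prod_symm _ (hK.indicator hT), intervalIntegral.integral_of_le ha]
    refine setIntegral_congr_fun measurableSet_Ioc fun y hy => ?_
    have : ∀ x, ({z : ℝ × ℝ | z.1 < z.2}.indicator fun z : ℝ × ℝ => φ z.1 * γ z.2) (x, y) =
        (Iio y).indicator φ x * γ y := by
      intro x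
      by_cases h : x < y <;> simp [indicator, h]
    simp_rw [this]
    rw [integral_mul_const, integral_indicator measurableSet_Iio, hμ,
      Measure.restrict_restrict measurableSet_Iio, intervalIntegral.integral_of_le hy.1.le,
      integral_Ioc_eq_integral_Ioo]
    congr 3
    ext x; simp only [mem_Ioc, mem_Ioo, mem_inter_iff, mem_Iio]
    exact ⟨fun h => ⟨h.2, h.1, h.2.le.trans hy.2⟩, fun h => ⟨h.2.1, h.1⟩⟩
  rw [h1, h2, ← integral_add (hK.indicator hS) (hK.indicator hT), ← hcompl]
  simp_rw [indicator_self_add_compl_apply]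
  rw [integral_prod_mul, intervalIntegral.integral_of_le ha, intervalIntegral.integral_of_le ha]

theorem continuousOn_of_eq_primitive {a : ℝ} {f φ : ℝ → ℂ}
    (hφ : IntervalIntegrable φ volume 0 a) (ha : 0 ≤ a)
    (hf : ∀ x ∈ Icc 0 a, f x = f 0 + ∫ t in (0 : ℝ)..x, φ t) : ContinuousOn f (Icc 0 a) := by
  have h := intervalIntegral.continuousOn_primitive_interval' (a := 0) hφ (left_mem_uIcc)
  rw [uIcc_of_le ha] at h
  exact (continuousOn_const.add h).congr hf

theorem integral_mul_add_mul_eq_sub {a : ℝ} (ha : 0 ≤ a) {f g φ γ : ℝ → ℂ}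
    (hφ : IntervalIntegrable φ volume 0 a) (hγ : IntervalIntegrable γ volume 0 a)
    (hf : ∀ x ∈ Icc 0 a, f x = f 0 + ∫ t in (0 : ℝ)..x, φ t)
    (hg : ∀ x ∈ Icc 0 a, g x = g 0 + ∫ t in (0 : ℝ)..x, γ t) :
    (∫ x in (0 : ℝ)..a, φ x * g x) + (∫ x in (0 : ℝ)..a, f x * γ x) = f a * g a - f 0 * g 0 := by
  have hcφ := intervalIntegral.continuousOn_primitive_interval' (a := 0) hφ (left_mem_uIcc)
  have hcγ := intervalIntegral.continuousOn_primitive_interval' (a := 0) hγ (left_mem_uIcc)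
  have e1 : (∫ x in (0 : ℝ)..a, φ x * g x) =
      (∫ x in (0 : ℝ)..a, φ x) * g 0 + ∫ x in (0 : ℝ)..a, φ x * ∫ y in (0 : ℝ)..x, γ y := by
    rw [← intervalIntegral.integral_mul_const,
      ← intervalIntegral.integral_add (hφ.mul_const _) (hφ.mul_continuousOn hcγ)]
    refine intervalIntegral.integral_congr fun x hx => ?_
    rw [uIcc_of_le ha] at hx
    simp only [hg x hx]; ring
  have e2 : (∫ x in (0 : ℝ)..a, f x * γ x) =
      f 0 * (∫ x in (0 : ℝ)..a, γ x) + ∫ y in (0 : ℝ)..a, (∫ x in (0 : ℝ)..y, φ x) * γ y := by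
    rw [← intervalIntegral.integral_const_mul,
      ← intervalIntegral.integral_add (hγ.const_mul _) (hγ.continuousOn_mul hcφ)]
    refine intervalIntegral.integral_congr fun x hx => ?_
    rw [uIcc_of_le ha] at hx
    simp only [hf x hx]; ring
  have h := integral_mul_primitive_add_primitive_mul ha hφ hγ
  have ha' : a ∈ Icc 0 a := ⟨ha, le_rfl⟩
  rw [e1, e2, hf a ha', hg a ha']
  linear_combination h

theorem intervalIntegrable_of_memLp {a : ℝ} (ha : 0 ≤ a) {φ : ℝ → ℂ}
    (h : MemLp φ 2 (volume.restrict (Ioo 0 a))) : IntervalIntegrable φ volume 0 a := by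
  rw [intervalIntegrable_iff_integrableOn_Ioo_of_le ha]
  exact h.integrable (by norm_num)

namespace IsSobolevTwo

variable {a : ℝ} {f f' f'' g g' g'' : ℝ → ℂ}

theorem intervalIntegrable (hf : IsSobolevTwo a f f' f'') (ha : 0 ≤ a) :
    IntervalIntegrable f'' volume 0 a :=
  intervalIntegrable_of_memLp ha hf.memLp

theorem continuousOn_deriv (hf : IsSobolevTwo a f f' f'') (ha : 0 ≤ a) :
    ContinuousOn f' (Icc 0 a) :=
  continuousOn_of_eq_primitive (hf.intervalIntegrable ha) ha hf.deriv_eq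

theorem intervalIntegrable_deriv (hf : IsSobolevTwo a f f' f'') (ha : 0 ≤ a) :
    IntervalIntegrable f' volume 0 a :=
  ContinuousOn.intervalIntegrable (by rw [uIcc_of_le ha]; exact hf.continuousOn_deriv ha)

theorem zero : IsSobolevTwo a 0 0 0 :=
  ⟨MemLp.zero, fun x _ => by simp, fun x _ => by simp⟩

theorem add (ha : 0 ≤ a) (hf : IsSobolevTwo a f f' f'') (hg : IsSobolevTwo a g g' g'') :
    IsSobolevTwo a (f + g) (f' + g') (f'' + g'') := by
  have key : ∀ {u v : ℝ → ℂ}, IntervalIntegrable u volume 0 a → IntervalIntegrable v volume 0 a →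
      ∀ x ∈ Icc 0 a, ∫ t in (0 : ℝ)..x, (u + v) t =
        (∫ t in (0 : ℝ)..x, u t) + ∫ t in (0 : ℝ)..x, v t := by
    intro u v hu hv x hx
    have hsub : uIcc 0 x ⊆ uIcc 0 a := by
      rw [uIcc_of_le hx.1, uIcc_of_le ha]; exact Icc_subset_Icc_right hx.2
    simp only [Pi.add_apply]
    exact intervalIntegral.integral_add (hu.mono_set hsub) (hv.mono_set hsub)
  refine ⟨hf.memLp.add hg.memLp, fun x hx => ?_, fun x hx => ?_⟩
  · rw [key (hf.intervalIntegrable ha) (hg.intervalIntegrable ha) x hx]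
    simp only [Pi.add_apply, hf.deriv_eq x hx, hg.deriv_eq x hx]; ring
  · rw [key (hf.intervalIntegrable_deriv ha) (hg.intervalIntegrable_deriv ha) x hx]
    simp only [Pi.add_apply, hf.eq x hx, hg.eq x hx]; ring

theorem smul (c : ℂ) (hf : IsSobolevTwo a f f' f'') :
    IsSobolevTwo a (c • f) (c • f') (c • f'') := by
  refine ⟨hf.memLp.const_smul c, fun x hx => ?_, fun x hx => ?_⟩
  · simp only [Pi.smul_apply, intervalIntegral.integral_smul, ← smul_add, hf.deriv_eq x hx]
  · simp only [Pi.smul_apply, intervalIntegral.integral_smul, ← smul_add, hf.eq x hx]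

theorem star_primitive {u v : ℝ → ℂ} (h : ∀ x ∈ Icc 0 a, u x = u 0 + ∫ t in (0 : ℝ)..x, v t) :
    ∀ x ∈ Icc 0 a, star (u x) = star (u 0) + ∫ t in (0 : ℝ)..x, star (v t) := by
  intro x hx
  have h3 : ∫ t in (0 : ℝ)..x, star (v t) = star (∫ t in (0 : ℝ)..x, v t) := by
    simp only [intervalIntegral.integral_of_le hx.1]
    exact integral_conj
  rw [h x hx, star_add, h3]

/-- Green's formula on an interval. -/
theorem integral_star_mul (ha : 0 ≤ a) (hf : IsSobolevTwo a f f' f'')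
    (hg : IsSobolevTwo a g g' g'') :
    ∫ x in (0 : ℝ)..a, star (f x) * -g'' x =
      (∫ x in (0 : ℝ)..a, star (f' x) * g' x) + (star (f 0) * g' 0 - star (f a) * g' a) := by
  have hs : IntervalIntegrable (fun t => star (f' t)) volume 0 a := by
    refine ContinuousOn.intervalIntegrable ?_
    rw [uIcc_of_le ha]; exact (hf.continuousOn_deriv ha).star
  have h := integral_mul_add_mul_eq_sub ha hs (hg.intervalIntegrable ha)
    (f := fun x => star (f x)) (star_primitive hf.eq) hg.deriv_eq
  simp only [mul_neg, intervalIntegral.integral_neg]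
  linear_combination -h

end IsSobolevTwo

/-! ### The maximal Laplacian and Green's formula on the graph -/

/-- `(F, G)` lies in the graph of the maximal Laplacian `F ↦ -F''` on `H²(Γ)`, and `f`, `f'`, `f''`
represent `F` and its derivatives. -/
structure IsMaxLaplacian {E : ℕ} {l : Fin E → ℝ} (F G : L2 l) (f f' f'' : Fin E → ℝ → ℂ) :
    Prop where
  sobolev : ∀ e, IsSobolevTwo (l e) (f e) (f' e) (f'' e)
  ae_eq : ∀ᵐ x ∂edgeMeasure l, F x = f x.1 x.2
  ae_eq_neg : ∀ᵐ x ∂edgeMeasure l, G x = -f'' x.1 x.2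

namespace IsMaxLaplacian

variable {E : ℕ} {l : Fin E → ℝ} {F G F₁ G₁ : L2 l} {f f' f'' f₁ f₁' f₁'' : Fin E → ℝ → ℂ}

theorem zero : IsMaxLaplacian (0 : L2 l) 0 0 0 0 := by
  refine ⟨fun e => IsSobolevTwo.zero, ?_, ?_⟩ <;>
  · filter_upwards [Lp.coeFn_zero ℂ 2 (edgeMeasure l)] with x hx
    rw [hx]; simp

theorem add (hl : ∀ e, 0 < l e) (h : IsMaxLaplacian F G f f' f'')
    (h₁ : IsMaxLaplacian F₁ G₁ f₁ f₁' f₁'') :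
    IsMaxLaplacian (F + F₁) (G + G₁) (f + f₁) (f' + f₁') (f'' + f₁'') := by
  refine ⟨fun e => (h.sobolev e).add (hl e).le (h₁.sobolev e), ?_, ?_⟩
  · filter_upwards [Lp.coeFn_add F F₁, h.ae_eq, h₁.ae_eq] with x h1 h2 h3
    rw [h1, Pi.add_apply, h2, h3]; rfl
  · filter_upwards [Lp.coeFn_add G G₁, h.ae_eq_neg, h₁.ae_eq_neg] with x h1 h2 h3
    rw [h1, Pi.add_apply, h2, h3, Pi.add_apply, Pi.add_apply, neg_add]

theorem smul (c : ℂ) (h : IsMaxLaplacian F G f f' f'') :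
    IsMaxLaplacian (c • F) (c • G) (c • f) (c • f') (c • f'') := by
  refine ⟨fun e => (h.sobolev e).smul c, ?_, ?_⟩
  · filter_upwards [Lp.coeFn_smul c F, h.ae_eq] with x h1 h2
    simp [h1, h2]
  · filter_upwards [Lp.coeFn_smul c G, h.ae_eq_neg] with x h1 h2
    simp [h1, h2]

theorem sum (hl : ∀ e, 0 < l e) {ι : Type*} (s : Finset ι) {F G : ι → L2 l}
    {f f' f'' : ι → Fin E → ℝ → ℂ} (h : ∀ i, IsMaxLaplacian (F i) (G i) (f i) (f' i) (f'' i))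
    (c : ι → ℂ) :
    IsMaxLaplacian (∑ i ∈ s, c i • F i) (∑ i ∈ s, c i • G i) (∑ i ∈ s, c i • f i)
      (∑ i ∈ s, c i • f' i) (∑ i ∈ s, c i • f'' i) := by
  classical
  induction s using Finset.induction_on with
  | empty => simpa using zero
  | insert a s ha ih =>
    simp only [Finset.sum_insert ha]
    exact ((h a).smul (c a)).add hl ih

/-- The Dirichlet form. -/
def form (l : Fin E → ℝ) (f' g' : Fin E → ℝ → ℂ) : ℂ :=
  ∑ e, ∫ x in (0 : ℝ)..l e, star (f' e x) * g' e x

theorem star_form (hl : ∀ e, 0 < l e) (f' g' : Fin E → ℝ → ℂ) :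
    star (form l f' g') = form l g' f' := by
  rw [form, form, star_sum]
  refine Finset.sum_congr rfl fun e _ => ?_
  simp only [intervalIntegral.integral_of_le (hl e).le]
  refine (integral_conj (𝕜 := ℂ)).symm.trans ?_
  congr 1; funext x
  simp [mul_comm]

theorem form_self_re_nonneg (hl : ∀ e, 0 < l e) (f' : Fin E → ℝ → ℂ) : 0 ≤ (form l f' f').re := by
  rw [form, Complex.re_sum]
  refine Finset.sum_nonneg fun e _ => ?_
  have : ∀ x, star (f' e x) * f' e x = ((‖f' e x‖ ^ 2 : ℝ) : ℂ) := fun x => by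
    simpa using Complex.conj_mul' (f' e x)
  simp_rw [this]
  rw [intervalIntegral.integral_ofReal, Complex.ofReal_re]
  exact intervalIntegral.integral_nonneg (hl e).le fun x _ => by positivity

/-- Green's formula on the graph. -/
theorem inner_eq (hl : ∀ e, 0 < l e) (h : IsMaxLaplacian F G f f' f'')
    (h₁ : IsMaxLaplacian F₁ G₁ f₁ f₁' f₁'') :
    ⟪F, G₁⟫_ℂ = form l f' f₁' + ⟪boundaryValue l f, boundaryDeriv l f₁'⟫_ℂ := by
  rw [inner_eq_sum_intervalIntegral hl (g := fun e x => -f₁'' e x) h.ae_eq h₁.ae_eq_neg, form,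
    PiLp.inner_apply, Fintype.sum_sum_type, ← Finset.sum_add_distrib, ← Finset.sum_add_distrib]
  refine Finset.sum_congr rfl fun e _ => ?_
  rw [(h.sobolev e).integral_star_mul (hl e).le (h₁.sobolev e)]
  simp [boundaryValue, boundaryDeriv]
  ring

/-- The maximal Laplacian is adjoint to the minimal one. -/
theorem inner_eq_inner_of_boundary_eq_zero (hl : ∀ e, 0 < l e) (h : IsMaxLaplacian F G f f' f'')
    (h₁ : IsMaxLaplacian F₁ G₁ f₁ f₁' f₁'') (hv : boundaryValue l f₁ = 0)
    (hd : boundaryDeriv l f₁' = 0) : ⟪F, G₁⟫_ℂ = ⟪G, F₁⟫_ℂ := by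
  rw [h.inner_eq hl h₁, ← inner_conj_symm G, h₁.inner_eq hl h, hv, hd]
  simp only [inner_zero_left, inner_zero_right, add_zero]
  exact (star_form hl _ _).symm

end IsMaxLaplacian

section Laplacian

variable {E : ℕ} {bc : VertexConditions E} {l : Fin E → ℝ}

/-- The boundary values lie in `ker P` and `P` is symmetric, so only the `ker P` part of the
derivative contributes. The vertex condition replaces that part by `-L` applied to the boundary
values. -/
theorem inner_boundaryValue_boundaryDeriv {f f₁ f₁' : Fin E → ℝ → ℂ}
    (h : bc.P (boundaryValue l f) = 0) (h₁ : bc.P (boundaryValue l f₁) = 0)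
    (hd : (boundaryDeriv l f₁' - bc.P (boundaryDeriv l f₁'))
      + (bc.L ⟨boundaryValue l f₁, LinearMap.mem_ker.2 h₁⟩ : BoundarySpace E) = 0) :
    ⟪boundaryValue l f, boundaryDeriv l f₁'⟫_ℂ =
      -@inner ℂ (LinearMap.ker bc.P) InnerProductSpace.toInner
        ⟨boundaryValue l f, LinearMap.mem_ker.2 h⟩
        (bc.L ⟨boundaryValue l f₁, LinearMap.mem_ker.2 h₁⟩) := by
  have h2 : ⟪boundaryValue l f, bc.P (boundaryDeriv l f₁')⟫_ℂ = 0 := by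
    rw [← bc.isProj.isSymmetric, h, inner_zero_left]
  rw [Submodule.coe_inner, ← inner_neg_right, ← eq_neg_of_add_eq_zero_left hd, inner_sub_right, h2,
    sub_zero]

theorem exists_isMaxLaplacian {p : L2 l × L2 l} (hp : p ∈ laplacian bc l) :
    ∃ f f' f'', IsMaxLaplacian p.1 p.2 f f' f'' := by
  obtain ⟨f, f', f'', h1, h2, h3, -⟩ := hp
  exact ⟨f, f', f'', h1, h2, h3⟩

theorem laplacian_symm (hl : ∀ e, 0 < l e) {p q : L2 l × L2 l} (hp : p ∈ laplacian bc l)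
    (hq : q ∈ laplacian bc l) : ⟪p.1, q.2⟫_ℂ = ⟪p.2, q.1⟫_ℂ := by
  obtain ⟨f, f', f'', h1, h2, h3, h4, h5⟩ := hp
  obtain ⟨g, g', g'', k1, k2, k3, k4, k5⟩ := hq
  have hf : IsMaxLaplacian p.1 p.2 f f' f'' := ⟨h1, h2, h3⟩
  have hg : IsMaxLaplacian q.1 q.2 g g' g'' := ⟨k1, k2, k3⟩
  rw [← inner_conj_symm p.2, hf.inner_eq hl hg, hg.inner_eq hl hf,
    inner_boundaryValue_boundaryDeriv h4 k4 k5, inner_boundaryValue_boundaryDeriv k4 h4 h5, map_add,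
    map_neg, inner_conj_symm, bc.isSymm]
  congr 1
  exact (IsMaxLaplacian.star_form hl _ _).symm

/-- Green's formula gives the Dirichlet form minus `⟪F_bv, L F_bv⟫`. This is the point at which the
sign of `L` enters. -/
theorem laplacian_nonneg (hl : ∀ e, 0 < l e) (hneg : bc.NegSemidef) {p : L2 l × L2 l}
    (hp : p ∈ laplacian bc l) : 0 ≤ (⟪p.1, p.2⟫_ℂ).re := by
  obtain ⟨f, f', f'', h1, h2, h3, h4, h5⟩ := hp
  have hf : IsMaxLaplacian p.1 p.2 f f' f'' := ⟨h1, h2, h3⟩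
  rw [hf.inner_eq hl hf, inner_boundaryValue_boundaryDeriv h4 h4 h5, Complex.add_re, Complex.neg_re]
  have := hneg ⟨boundaryValue l f, LinearMap.mem_ker.2 h4⟩
  have := IsMaxLaplacian.form_self_re_nonneg hl f'
  linarith

theorem laplacian_smul (c : ℂ) {p : L2 l × L2 l} (hp : p ∈ laplacian bc l) :
    c • p ∈ laplacian bc l := by
  obtain ⟨f, f', f'', h1, h2, h3, h4, h5⟩ := hp
  have hf : IsMaxLaplacian p.1 p.2 f f' f'' := ⟨h1, h2, h3⟩
  have hs := hf.smul c
  have hbv : boundaryValue l (c • f) = c • boundaryValue l f := by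
    ext i; cases i <;> simp [boundaryValue]
  have hbd : boundaryDeriv l (c • f') = c • boundaryDeriv l f' := by
    ext i; cases i <;> simp [boundaryDeriv]
  refine ⟨c • f, c • f', c • f'', hs.sobolev, hs.ae_eq, hs.ae_eq_neg, by
    rw [hbv, map_smul, h4, smul_zero], ?_⟩
  have h6 : (⟨boundaryValue l (c • f), LinearMap.mem_ker.2 (by
      rw [hbv, map_smul, h4, smul_zero])⟩ : LinearMap.ker bc.P) =
      c • ⟨boundaryValue l f, LinearMap.mem_ker.2 h4⟩ := Subtype.ext hbv
  rw [h6, hbd, map_smul, map_smul, Submodule.coe_smul, ← smul_sub, ← smul_add, h5, smul_zero]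

theorem Eigensystem.val_nonneg (hl : ∀ e, 0 < l e) (hneg : bc.NegSemidef)
    (S : Eigensystem (laplacian bc l)) (n : ℕ) : 0 ≤ S.val n := by
  have h := laplacian_nonneg hl hneg (S.eig n)
  rw [inner_smul_right, inner_self_eq_norm_sq_to_K, S.vec.orthonormal.1 n] at h
  simpa using h

theorem dirichlet_negSemidef (E : ℕ) : (dirichlet E).NegSemidef := fun v => by
  have h : (dirichlet E).L v = 0 := rfl
  rw [h, inner_zero_right, Complex.zero_re]

theorem neumann_negSemidef (E : ℕ) : (neumann E).NegSemidef := fun v => by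
  have h : (neumann E).L v = 0 := rfl
  rw [h, inner_zero_right, Complex.zero_re]

end Laplacian

/-! ### The primitive operator and the resolvent -/

section Primitive

variable {E : ℕ} {l : Fin E → ℝ}

/-- The initial segment of the edge `p.1`, up to the point `p.2`. -/
def segment (p : Fin E × ℝ) : Set (Fin E × ℝ) := {p.1} ×ˢ Ioo 0 p.2

theorem measurableSet_segment (p : Fin E × ℝ) : MeasurableSet (segment p) :=
  (measurableSet_singleton _).prod measurableSet_Ioo

/-- The indicator function of an initial segment. -/
def segmentVec (l : Fin E → ℝ) (p : Fin E × ℝ) : L2 l :=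
  indicatorConstLp 2 (measurableSet_segment p) (measure_ne_top (edgeMeasure l) _) (1 : ℂ)

theorem norm_segmentVec_le (p : Fin E × ℝ) :
    ‖segmentVec l p‖ ≤ (edgeMeasure l).real univ ^ (1 / 2 : ℝ) := by
  refine norm_indicatorConstLp_le.trans ?_
  simp only [norm_one, one_mul, ENNReal.toReal_ofNat]
  exact Real.rpow_le_rpow measureReal_nonneg (measureReal_mono (subset_univ _)) (by norm_num)

theorem Lp_integrable (h : L2 l) : Integrable h (edgeMeasure l) :=
  (Lp.memLp h).integrable (by norm_num)

theorem memLp_edge (h : L2 l) (e : Fin E) :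
    MemLp (fun x => h (e, x)) 2 (volume.restrict (Ioo 0 (l e))) :=
  memLp_edgeMeasure_iff.1 (Lp.memLp h) e

/-- Writing the primitive as an inner product with a vector of bounded norm makes it a
Hilbert-Schmidt kernel operator, and makes endpoint evaluations continuous. -/
theorem inner_segmentVec (hl : ∀ e, 0 < l e) (h : L2 l) (e : Fin E) {x : ℝ}
    (hx : x ∈ Icc 0 (l e)) : ⟪segmentVec l (e, x), h⟫_ℂ = ∫ t in (0 : ℝ)..x, h (e, t) := by
  rw [segmentVec, L2.inner_indicatorConstLp_one, ← integral_indicator (measurableSet_segment _),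
    integral_edgeMeasure hl ((Lp_integrable h).indicator (measurableSet_segment _)),
    Finset.sum_eq_single e]
  · have h1 : ∀ t, (segment (e, x)).indicator (h : Fin E × ℝ → ℂ) (e, t) =
        (Ioo 0 x).indicator (fun t => h (e, t)) t := by
      intro t
      by_cases ht : t ∈ Ioo 0 x
      · rw [indicator_of_mem ht, indicator_of_mem (show (e, t) ∈ segment (e, x) from ⟨rfl, ht⟩)]
      · rw [indicator_of_notMem ht, indicator_of_notMem fun h2 => ht h2.2]
    simp_rw [h1]
    rw [intervalIntegral.integral_of_le (hl e).le, intervalIntegral.integral_of_le hx.1,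
      setIntegral_indicator measurableSet_Ioo, integral_Ioc_eq_integral_Ioo]
    congr 2
    ext t; simp only [mem_inter_iff, mem_Ioc, mem_Ioo]
    exact ⟨fun h => h.2, fun h => ⟨⟨h.1, h.2.le.trans hx.2⟩, h⟩⟩
  · intro e' _ he
    have h1 : ∀ t, (segment (e, x)).indicator (h : Fin E × ℝ → ℂ) (e', t) = 0 := fun t =>
      indicator_of_notMem (fun h2 => he h2.1) _
    simp [h1]
  · simp

theorem intervalIntegrable_edge (hl : ∀ e, 0 < l e) (h : L2 l) (e : Fin E) :
    IntervalIntegrable (fun t => h (e, t)) volume 0 (l e) :=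
  intervalIntegrable_of_memLp (hl e).le (memLp_edge h e)

theorem continuousOn_primitive_edge (hl : ∀ e, 0 < l e) (h : L2 l) (e : Fin E) :
    ContinuousOn (fun x => ∫ t in (0 : ℝ)..x, h (e, t)) (Icc 0 (l e)) := by
  have := intervalIntegral.continuousOn_primitive_interval' (a := 0)
    (intervalIntegrable_edge hl h e) (left_mem_uIcc)
  rwa [uIcc_of_le (hl e).le] at this

theorem aestronglyMeasurable_inner_segmentVec (hl : ∀ e, 0 < l e) (h : L2 l) :
    AEStronglyMeasurable (fun p => ⟪segmentVec l p, h⟫_ℂ) (edgeMeasure l) := by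
  refine aestronglyMeasurable_edgeMeasure_iff.2 fun e => ?_
  refine AEStronglyMeasurable.congr (((continuousOn_primitive_edge hl h e).mono
    Ioo_subset_Icc_self).aestronglyMeasurable measurableSet_Ioo) ?_
  refine (ae_restrict_iff' measurableSet_Ioo).2 (Eventually.of_forall fun x hx => ?_)
  exact (inner_segmentVec hl h e (Ioo_subset_Icc_self hx)).symm

theorem norm_inner_segmentVec_le (h : L2 l) (p : Fin E × ℝ) :
    ‖⟪segmentVec l p, h⟫_ℂ‖ ≤ (edgeMeasure l).real univ ^ (1 / 2 : ℝ) * ‖h‖ :=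
  (norm_inner_le_norm _ _).trans (by gcongr; exact norm_segmentVec_le p)

theorem memLp_inner_segmentVec (hl : ∀ e, 0 < l e) (h : L2 l) :
    MemLp (fun p => ⟪segmentVec l p, h⟫_ℂ) 2 (edgeMeasure l) :=
  MemLp.of_bound (aestronglyMeasurable_inner_segmentVec hl h) _
    (Eventually.of_forall (norm_inner_segmentVec_le h))

/-- The operator `h ↦ ∫₀ˣ h` on `L²(Γ)`. -/
def primitive (hl : ∀ e, 0 < l e) : L2 l →L[ℂ] L2 l :=
  LinearMap.mkContinuous
    { toFun := fun h => (memLp_inner_segmentVec hl h).toLp _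
      map_add' := fun h k => by
        rw [← MemLp.toLp_add]
        congr 1; funext p; exact inner_add_right _ _ _
      map_smul' := fun c h => by
        rw [RingHom.id_apply, ← MemLp.toLp_const_smul]
        congr 1; funext p; exact inner_smul_right _ _ _ }
    ((measureUnivNNReal (edgeMeasure l) : ℝ) ^ (2 : ℝ≥0∞).toReal⁻¹ *
      (edgeMeasure l).real univ ^ (1 / 2 : ℝ)) fun h => by
      rw [mul_assoc]
      refine Lp.norm_le_of_ae_bound (by positivity) ?_
      filter_upwards [(memLp_inner_segmentVec hl h).coeFn_toLp] with p hp
      exact (congrArg norm hp).trans_le (norm_inner_segmentVec_le h p)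

theorem primitive_ae (hl : ∀ e, 0 < l e) (h : L2 l) :
    ∀ᵐ p ∂edgeMeasure l, primitive hl h p = ⟪segmentVec l p, h⟫_ℂ :=
  (memLp_inner_segmentVec hl h).coeFn_toLp

/-- The Hilbert-Schmidt norm is finite: the sum of `‖V (b i)‖ ^ 2`, for the primitive operator `V`,
is the integral over `p` of `∑ i, ‖⟪segmentVec l p, b i⟫‖ ^ 2`, and Bessel bounds the integrand by a
constant. -/
theorem isCompactOperator_primitive (hl : ∀ e, 0 < l e) : IsCompactOperator (primitive hl) := by
  obtain ⟨w, b, -⟩ := exists_hilbertBasis ℂ (L2 l)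
  refine isCompactOperator_of_sum_norm_sq_le b (primitive hl)
    (∫ _, ((edgeMeasure l).real univ ^ (1 / 2 : ℝ)) ^ 2 ∂edgeMeasure l) fun s => ?_
  have h1 : ∀ h : L2 l, ‖primitive hl h‖ ^ 2 = ∫ p, ‖⟪segmentVec l p, h⟫_ℂ‖ ^ 2 ∂edgeMeasure l := by
    intro h
    have : ((‖primitive hl h‖ ^ 2 : ℝ) : ℂ) = ⟪primitive hl h, primitive hl h⟫_ℂ := by
      rw [inner_self_eq_norm_sq_to_K]; simp
    rw [L2.inner_def] at this
    apply Complex.ofReal_injective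
    rw [this]
    refine Eq.trans (integral_congr_ae ?_) integral_complex_ofReal
    filter_upwards [primitive_ae hl h] with p hp
    rw [hp, inner_self_eq_norm_sq_to_K]; simp
  simp_rw [h1]
  rw [← integral_finsetSum]
  · refine integral_mono_of_nonneg (Eventually.of_forall fun p => ?_) (integrable_const _)
      (Eventually.of_forall fun p => ?_)
    · exact Finset.sum_nonneg fun i _ => by positivity
    · simp only
      simp_rw [← inner_conj_symm (segmentVec l p), RCLike.norm_conj]
      refine (b.orthonormal.sum_inner_products_le (segmentVec l p)).trans ?_
      gcongr
      exact norm_segmentVec_le p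
  · intro i _
    exact (memLp_two_iff_integrable_sq_norm (aestronglyMeasurable_inner_segmentVec hl _)).1
      (memLp_inner_segmentVec hl _)

theorem memLp_edgewise_const (a : Fin E → ℂ) :
    MemLp (fun p : Fin E × ℝ => a p.1) 2 (edgeMeasure l) :=
  memLp_edgeMeasure_iff.2 fun e => memLp_const (a e)

/-- The functions that are constant on every edge. -/
def edgewiseConst (l : Fin E → ℝ) : (Fin E → ℂ) →ₗ[ℂ] L2 l where
  toFun a := (memLp_edgewise_const a).toLp _
  map_add' a b := by rw [← MemLp.toLp_add]; rfl
  map_smul' c a := by rw [RingHom.id_apply, ← MemLp.toLp_const_smul]; rfl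

theorem edgewiseConst_ae (a : Fin E → ℂ) :
    ∀ᵐ p ∂edgeMeasure l, edgewiseConst l a p = a p.1 :=
  (memLp_edgewise_const a).coeFn_toLp

/-- If a primitive vanishes almost everywhere, then so does the function. -/
theorem ae_eq_zero_of_primitive {a : ℝ} (ha : 0 < a) {u v : ℝ → ℂ}
    (hv : IntervalIntegrable v volume 0 a) (h : ∀ x ∈ Icc 0 a, u x = u 0 + ∫ t in (0 : ℝ)..x, v t)
    (hu : ∀ᵐ x ∂volume.restrict (Ioo 0 a), u x = 0) :
    (∀ᵐ x ∂volume.restrict (Ioo 0 a), v x = 0) ∧ u 0 = 0 := by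
  have hc := continuousOn_of_eq_primitive hv ha.le h
  have h0 : EqOn u 0 (Ioo 0 a) := Measure.eqOn_open_of_ae_eq (μ := volume) hu isOpen_Ioo
    (hc.mono Ioo_subset_Icc_self) continuousOn_const
  have hv0 : ∀ᵐ x ∂volume.restrict (Ioo 0 a), v x = 0 := by
    rw [ae_restrict_iff' measurableSet_Ioo]
    filter_upwards [hv.ae_hasDerivAt_integral] with x hx hxa
    rw [uIcc_of_le ha.le] at hx
    have h1 := hx (Ioo_subset_Icc_self hxa) 0 ⟨le_rfl, ha.le⟩
    have h2 : (fun x => ∫ t in (0 : ℝ)..x, v t) =ᶠ[𝓝 x] fun _ => -u 0 := by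
      filter_upwards [isOpen_Ioo.mem_nhds hxa] with y hy
      have := h y (Ioo_subset_Icc_self hy)
      rw [h0 hy] at this
      exact eq_neg_of_add_eq_zero_right this.symm
    exact h1.unique ((hasDerivAt_const x (-u 0)).congr_of_eventuallyEq h2)
  refine ⟨hv0, ?_⟩
  have hm : a / 2 ∈ Ioo 0 a := ⟨by linarith, by linarith⟩
  have h3 := h (a / 2) (Ioo_subset_Icc_self hm)
  rw [h0 hm, intervalIntegral.integral_zero_ae, add_zero] at h3
  · exact h3.symm
  · rw [ae_restrict_iff' measurableSet_Ioo] at hv0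
    filter_upwards [hv0, compl_mem_ae_iff.2 (measure_singleton (a / 2))] with x hx hx2 hx3
    rw [uIoc_of_le hm.1.le] at hx3
    exact hx ⟨hx3.1, hx3.2.trans_lt hm.2⟩

end Primitive

/-! ### Parametrisation of `H²(Γ)` by initial data, and the resolvent through the Fredholm
alternative -/

section Resolvent

variable {E : ℕ} {l : Fin E → ℝ}

/-- The parameters of a function in `H²(Γ)`: the second derivative, and the values of the function
and of the first derivative at the initial points. -/
abbrev SobolevParam (l : Fin E → ℝ) : Type := L2 l × ((Fin E → ℂ) × (Fin E → ℂ))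

namespace SobolevParam

/-- The representative of the first derivative. -/
def deriv (x : SobolevParam l) (e : Fin E) (t : ℝ) : ℂ :=
  x.2.2 e + ∫ s in (0 : ℝ)..t, x.1 (e, s)

/-- The representative of the function. -/
def fn (x : SobolevParam l) (e : Fin E) (t : ℝ) : ℂ :=
  x.2.1 e + ∫ s in (0 : ℝ)..t, x.deriv e s

variable (hl : ∀ e, 0 < l e)

/-- The first derivative, as an element of `L²(Γ)`. -/
def derivL : SobolevParam l →L[ℂ] L2 l :=
  (LinearMap.toContinuousLinearMap (edgewiseConst l)).comp
      ((ContinuousLinearMap.snd ℂ _ _).comp (ContinuousLinearMap.snd ℂ _ _)) +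
    (primitive hl).comp (ContinuousLinearMap.fst ℂ _ _)

/-- The function, as an element of `L²(Γ)`. -/
def fnL : SobolevParam l →L[ℂ] L2 l :=
  (LinearMap.toContinuousLinearMap (edgewiseConst l)).comp
      ((ContinuousLinearMap.fst ℂ _ _).comp (ContinuousLinearMap.snd ℂ _ _)) +
    (primitive hl).comp (derivL hl)

theorem derivL_ae (x : SobolevParam l) :
    ∀ᵐ p ∂edgeMeasure l, derivL hl x p = x.deriv p.1 p.2 := by
  have h : ∀ᵐ p ∂edgeMeasure l, ⟪segmentVec l p, x.1⟫_ℂ = ∫ t in (0 : ℝ)..p.2, x.1 (p.1, t) := by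
    refine ae_edgeMeasure_iff.2 fun e => (ae_restrict_iff' measurableSet_Ioo).2 ?_
    exact Eventually.of_forall fun t ht => inner_segmentVec hl _ _ (Ioo_subset_Icc_self ht)
  filter_upwards [Lp.coeFn_add (edgewiseConst l x.2.2) (primitive hl x.1), primitive_ae hl x.1,
    edgewiseConst_ae (l := l) x.2.2, h] with p h1 h2 h3 h4
  refine h1.trans ?_
  rw [Pi.add_apply, h2, h3, h4, deriv]

theorem inner_segmentVec_derivL (x : SobolevParam l) (e : Fin E) {t : ℝ} (ht : t ∈ Icc 0 (l e)) :
    ⟪segmentVec l (e, t), derivL hl x⟫_ℂ = ∫ s in (0 : ℝ)..t, x.deriv e s := by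
  rw [inner_segmentVec hl _ _ ht]
  refine intervalIntegral.integral_congr_ae ?_
  have h := (ae_restrict_iff' measurableSet_Ioo).1 (ae_edgeMeasure_iff.1 (derivL_ae hl x) e)
  filter_upwards [h, compl_mem_ae_iff.2 (measure_singleton (l e))] with s hs hs2 hs3
  rw [uIoc_of_le ht.1] at hs3
  exact hs ⟨hs3.1, lt_of_le_of_ne (hs3.2.trans ht.2) hs2⟩

theorem fnL_ae (x : SobolevParam l) : ∀ᵐ p ∂edgeMeasure l, fnL hl x p = x.fn p.1 p.2 := by
  have h : ∀ᵐ p ∂edgeMeasure l,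
      ⟪segmentVec l p, derivL hl x⟫_ℂ = ∫ t in (0 : ℝ)..p.2, x.deriv p.1 t := by
    refine ae_edgeMeasure_iff.2 fun e => (ae_restrict_iff' measurableSet_Ioo).2 ?_
    exact Eventually.of_forall fun t ht => inner_segmentVec_derivL hl _ _ (Ioo_subset_Icc_self ht)
  filter_upwards [Lp.coeFn_add (edgewiseConst l x.2.1) (primitive hl (derivL hl x)),
    primitive_ae hl (derivL hl x), edgewiseConst_ae (l := l) x.2.1, h] with p h1 h2 h3 h4
  refine h1.trans ?_
  rw [Pi.add_apply, h2, h3, h4, fn]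

theorem isSobolevTwo (x : SobolevParam l) (e : Fin E) :
    IsSobolevTwo (l e) (x.fn e) (x.deriv e) fun t => x.1 (e, t) :=
  ⟨memLp_edge x.1 e, fun t _ => by simp [deriv], fun t _ => by simp [fn]⟩

theorem isMaxLaplacian (x : SobolevParam l) :
    IsMaxLaplacian (fnL hl x) (-x.1) x.fn x.deriv fun e t => x.1 (e, t) := by
  refine ⟨isSobolevTwo x, fnL_ae hl x, ?_⟩
  filter_upwards [Lp.coeFn_neg x.1] with p hp
  rw [hp]; rfl

/-- Two differentiations recover the parameters from the function; each is one use of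
`ae_eq_zero_of_primitive`. -/
theorem eq_zero_of_fnL_eq_zero (x : SobolevParam l) (hx : fnL hl x = 0) : x = 0 := by
  have h1 : ∀ᵐ p ∂edgeMeasure l, x.fn p.1 p.2 = 0 := by
    filter_upwards [fnL_ae hl x, Lp.coeFn_zero ℂ 2 (edgeMeasure l)] with p h1 h2
    rw [← h1, hx, h2, Pi.zero_apply]
  have h2 : ∀ e, (∀ᵐ t ∂volume.restrict (Ioo 0 (l e)), x.deriv e t = 0) ∧ x.fn e 0 = 0 := fun e =>
    ae_eq_zero_of_primitive (hl e) ((isSobolevTwo x e).intervalIntegrable_deriv (hl e).le)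
      (isSobolevTwo x e).eq (ae_edgeMeasure_iff.1 h1 e)
  have h3 : ∀ e, (∀ᵐ t ∂volume.restrict (Ioo 0 (l e)), x.1 (e, t) = 0) ∧ x.deriv e 0 = 0 := fun e =>
    ae_eq_zero_of_primitive (hl e) ((isSobolevTwo x e).intervalIntegrable (hl e).le)
      (isSobolevTwo x e).deriv_eq (h2 e).1
  refine Prod.ext ?_ (Prod.ext ?_ ?_)
  · refine Lp.ext ?_
    filter_upwards [(ae_edgeMeasure_iff (p := fun p => x.1 p = 0)).2 fun e => (h3 e).1,
      Lp.coeFn_zero ℂ 2 (edgeMeasure l)]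
      with p k1 k2
    rw [k1]; exact k2.symm
  · funext e; simpa [fn] using (h2 e).2
  · funext e; simpa [deriv] using (h3 e).2

/-- The boundary values, as a function of the parameters. -/
def boundaryValueL : SobolevParam l →L[ℂ] BoundarySpace E :=
  (EuclideanSpace.equiv (Fin E ⊕ Fin E) ℂ).symm.toContinuousLinearMap.comp
    (ContinuousLinearMap.pi (Sum.elim
      (fun e => (ContinuousLinearMap.proj e).comp
        ((ContinuousLinearMap.fst ℂ _ _).comp (ContinuousLinearMap.snd ℂ _ _)))
      (fun e => (ContinuousLinearMap.proj e).comp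
        ((ContinuousLinearMap.fst ℂ _ _).comp (ContinuousLinearMap.snd ℂ _ _)) +
        (innerSL ℂ (segmentVec l (e, l e))).comp (derivL hl))))

/-- The boundary derivatives, as a function of the parameters. -/
def boundaryDerivL : SobolevParam l →L[ℂ] BoundarySpace E :=
  (EuclideanSpace.equiv (Fin E ⊕ Fin E) ℂ).symm.toContinuousLinearMap.comp
    (ContinuousLinearMap.pi (Sum.elim
      (fun e => (ContinuousLinearMap.proj (R := ℂ) (φ := fun _ : Fin E => ℂ) e).comp
        ((ContinuousLinearMap.snd ℂ _ _).comp (ContinuousLinearMap.snd ℂ _ _)))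
      (fun e => -((ContinuousLinearMap.proj (R := ℂ) (φ := fun _ : Fin E => ℂ) e).comp
        ((ContinuousLinearMap.snd ℂ _ _).comp (ContinuousLinearMap.snd ℂ _ _)) +
        (innerSL ℂ (segmentVec l (e, l e))).comp (ContinuousLinearMap.fst ℂ _ _)))))

theorem boundaryValueL_eq (x : SobolevParam l) : boundaryValueL hl x = boundaryValue l x.fn := by
  ext i
  cases i with
  | inl e => simp [boundaryValueL, boundaryValue, fn]
  | inr e =>
    simp [boundaryValueL, boundaryValue, fn, inner_segmentVec_derivL hl x e ⟨(hl e).le, le_rfl⟩]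

theorem boundaryDerivL_eq (hl : ∀ e, 0 < l e) (x : SobolevParam l) : boundaryDerivL x = boundaryDeriv l x.deriv := by
  ext i
  cases i with
  | inl e => simp [boundaryDerivL, boundaryDeriv, deriv]
  | inr e =>
    simp [boundaryDerivL, boundaryDeriv, deriv, inner_segmentVec hl x.1 e ⟨(hl e).le, le_rfl⟩]

end SobolevParam

open SobolevParam

variable (bc : VertexConditions E)

/-- The projection onto `ker P`. -/
def VertexConditions.projKer : BoundarySpace E →ₗ[ℂ] LinearMap.ker bc.P :=
  LinearMap.codRestrict _ (LinearMap.id - bc.P) fun v => by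
    have h := LinearMap.congr_fun bc.isProj.isIdempotentElem.eq v
    rw [Module.End.mul_apply] at h
    simp [h]

/-- The vertex conditions, as the kernel of a map into `ℂ^{2E}`. -/
def vertexMap (hl : ∀ e, 0 < l e) : SobolevParam l →L[ℂ] BoundarySpace E :=
  (LinearMap.toContinuousLinearMap (LinearMap.id - bc.P)).comp boundaryDerivL +
    (LinearMap.toContinuousLinearMap ((LinearMap.ker bc.P).subtype ∘ₗ bc.L ∘ₗ bc.projKer)).comp
      (boundaryValueL hl) +
    (LinearMap.toContinuousLinearMap bc.P).comp (boundaryValueL hl)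

/-- The first two terms of `vertexMap` lie in `ker P` and the third in the range of `P`, so one
equation in `ℂ^{2E}` encodes both vertex conditions. Applying `P` separates them. -/
theorem mem_laplacian_of_vertexMap_eq_zero (hl : ∀ e, 0 < l e) {x : SobolevParam l}
    (hx : vertexMap bc hl x = 0) : (fnL hl x, -x.1) ∈ laplacian bc l := by
  have hPP : ∀ v, bc.P (bc.P v) = bc.P v := fun v =>
    LinearMap.congr_fun bc.isProj.isIdempotentElem.eq v
  have h : boundaryDeriv l x.deriv - bc.P (boundaryDeriv l x.deriv)
      + (bc.L (bc.projKer (boundaryValue l x.fn)) : BoundarySpace E)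
      + bc.P (boundaryValue l x.fn) = 0 := by
    rw [← boundaryDerivL_eq hl, ← boundaryValueL_eq hl]
    simpa [vertexMap] using hx
  have hP : bc.P (boundaryValue l x.fn) = 0 := by
    have h2 := congrArg bc.P h
    rwa [map_add, map_add, map_sub, hPP, sub_self, hPP, map_zero, zero_add,
      LinearMap.mem_ker.1 (bc.L _).2, zero_add] at h2
  have hm := isMaxLaplacian hl x
  refine ⟨x.fn, x.deriv, _, hm.sobolev, hm.ae_eq, hm.ae_eq_neg, hP, ?_⟩
  rw [hP, add_zero] at h
  rw [← h]
  congr 3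
  exact Subtype.ext (by simp [VertexConditions.projKer, hP])

theorem isCompactOperator_fnL (hl : ∀ e, 0 < l e) : IsCompactOperator (fnL hl) := by
  have h : IsCompactOperator (LinearMap.toContinuousLinearMap (edgewiseConst l)) :=
    isCompactOperator_of_locallyCompactSpace_rng _
  exact (h.comp_clm ((ContinuousLinearMap.fst ℂ _ _).comp (ContinuousLinearMap.snd ℂ _ _))).add
    ((isCompactOperator_primitive hl).comp_clm (derivL hl))

/-- The resolvent of the Laplacian. -/
theorem exists_resolvent (hl : ∀ e, 0 < l e) (hneg : bc.NegSemidef) :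
    ∃ R : L2 l →L[ℂ] L2 l, IsCompactOperator R ∧ Function.Injective R ∧
      ∀ g, (R g, g - R g) ∈ laplacian bc l := by
  let e : BoundarySpace E ≃L[ℂ] (Fin E → ℂ) × (Fin E → ℂ) :=
    (EuclideanSpace.equiv (Fin E ⊕ Fin E) ℂ).trans
      (LinearEquiv.sumArrowLequivProdArrow (Fin E) (Fin E) ℂ ℂ).toContinuousLinearEquiv
  let B : SobolevParam l →L[ℂ] (Fin E → ℂ) × (Fin E → ℂ) :=
    e.toContinuousLinearMap.comp (vertexMap bc hl) + ContinuousLinearMap.snd ℂ _ _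
  -- Here `x - K x = (x.1 - fnL hl x, -e (vertexMap bc hl x))`. Hence `x - K x = (-g, 0)` says `F''
  -- - F = -g` together with the vertex conditions.
  let K : SobolevParam l →L[ℂ] SobolevParam l := (fnL hl).prod B
  have hB : IsCompactOperator B := by
    have : IsCompactOperator (id : (Fin E → ℂ) × (Fin E → ℂ) → _) := isCompactOperator_id
    exact this.comp_clm B
  have hK : IsCompactOperator K := by
    have h1 := (isCompactOperator_fnL hl).clm_comp (ContinuousLinearMap.inl ℂ (L2 l)
      ((Fin E → ℂ) × (Fin E → ℂ)))
    have h2 := hB.clm_comp (ContinuousLinearMap.inr ℂ (L2 l) ((Fin E → ℂ) × (Fin E → ℂ)))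
    have h3 : (K : SobolevParam l → SobolevParam l) = ContinuousLinearMap.inl ℂ (L2 l)
        ((Fin E → ℂ) × (Fin E → ℂ)) ∘ fnL hl + ContinuousLinearMap.inr ℂ (L2 l)
        ((Fin E → ℂ) × (Fin E → ℂ)) ∘ B := by
      funext x
      simp [K]
    rw [h3]
    exact h1.add h2
  -- A fixed point of `K` is an `F` in the domain with `-F'' = -F`, which nonnegativity of the
  -- Laplacian forbids unless `F = 0`.
  have hinj : ¬ Module.End.HasEigenvalue (K : Module.End ℂ (SobolevParam l)) 1 := by
    intro h
    obtain ⟨x, hx⟩ := h.exists_hasEigenvector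
    have hx1 : K x = x := by simpa using Module.End.mem_eigenspace_iff.1 hx.1
    have h1 : fnL hl x = x.1 := congrArg Prod.fst hx1
    have h2 : vertexMap bc hl x = 0 := by
      have h3 : e (vertexMap bc hl x) + x.2 = x.2 := congrArg Prod.snd hx1
      exact e.injective (by rw [map_zero]; exact add_eq_right.1 h3)
    have h4 := laplacian_nonneg hl hneg (mem_laplacian_of_vertexMap_eq_zero bc hl h2)
    have h5 : fnL hl x = 0 := by
      rw [← h1, inner_neg_right, Complex.neg_re] at h4
      have h6 : (⟪fnL hl x, fnL hl x⟫_ℂ).re = ‖fnL hl x‖ ^ 2 := inner_self_eq_norm_sq (𝕜 := ℂ) _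
      have : ‖fnL hl x‖ ^ 2 ≤ 0 := by linarith
      exact norm_eq_zero.1 (pow_eq_zero_iff two_ne_zero |>.1 (le_antisymm this (by positivity)))
    exact hx.2 (eq_zero_of_fnL_eq_zero hl x h5)
  -- Fredholm alternative for the compact operator `K`: since `1` is not an eigenvalue, `1 - K` is
  -- invertible.
  have hres := (hK.hasEigenvalue_or_mem_resolventSet one_ne_zero).resolve_left hinj
  rw [spectrum.mem_resolventSet_iff] at hres
  obtain ⟨u, hu⟩ := hres
  let S : SobolevParam l →L[ℂ] SobolevParam l := ((u⁻¹ : (SobolevParam l →L[ℂ] SobolevParam l)ˣ) :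
    SobolevParam l →L[ℂ] SobolevParam l)
  have hS : ∀ y, S y - K (S y) = y := by
    intro y
    have h1 : (u : SobolevParam l →L[ℂ] SobolevParam l) (S y) = y := by
      change ((u : SobolevParam l →L[ℂ] SobolevParam l) * S) y = y
      simp [S]
    rw [hu] at h1
    simpa using h1
  let R : L2 l →L[ℂ] L2 l := (fnL hl).comp (S.comp (-ContinuousLinearMap.inl ℂ _ _))
  have key : ∀ g, (R g, g - R g) ∈ laplacian bc l ∧
      (S (-ContinuousLinearMap.inl ℂ _ _ g)).1 = R g - g := by
    intro g
    have h1 := hS (-ContinuousLinearMap.inl ℂ _ _ g)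
    set x := S (-ContinuousLinearMap.inl ℂ _ _ g) with hx
    have h2 : x.1 - fnL hl x = -g := by simpa [K] using congrArg Prod.fst h1
    have h3 : vertexMap bc hl x = 0 := by
      have h3 : x.2 - (e (vertexMap bc hl x) + x.2) = 0 := by
        simpa [K, B] using congrArg Prod.snd h1
      refine e.injective ?_
      rw [map_zero]
      have := sub_eq_zero.1 h3
      exact add_eq_right.1 this.symm
    have h4 : x.1 = R g - g := by
      rw [sub_eq_iff_eq_add] at h2
      rw [h2]; exact (neg_add_eq_sub _ _)
    refine ⟨?_, h4⟩
    have h5 := mem_laplacian_of_vertexMap_eq_zero bc hl h3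
    rwa [h4, neg_sub] at h5
  refine ⟨R, (isCompactOperator_fnL hl).comp_clm (S.comp (-ContinuousLinearMap.inl ℂ _ _)), ?_,
    fun g => (key g).1⟩
  rw [injective_iff_map_eq_zero]
  intro g hg
  have h1 := eq_zero_of_fnL_eq_zero hl _ hg
  have h2 := (key g).2
  rw [hg, zero_sub] at h2
  have h3 : (S (-ContinuousLinearMap.inl ℂ _ _ g)).1 = 0 := congrArg Prod.fst h1
  exact neg_eq_zero.1 (h2.symm.trans h3)

/-- The operator `R` is the inverse of `1 + (-Δ₁)`, so an eigenvalue `r` of `R` becomes the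
eigenvalue `r⁻¹ - 1` of `-Δ₁`. Symmetry of `R` is inherited from the Laplacian. -/
theorem nonempty_eigensystem_laplacian (hl : ∀ e, 0 < l e) (hneg : bc.NegSemidef) {κ : Type*}
    [Countable κ] [Infinite κ] (b : HilbertBasis κ ℂ (L2 l)) :
    Nonempty (Eigensystem (laplacian bc l)) := by
  obtain ⟨R, hc, hi, hR⟩ := exists_resolvent bc hl hneg
  have hs : (R : L2 l →ₗ[ℂ] L2 l).IsSymmetric := by
    intro g k
    have h := laplacian_symm hl (hR g) (hR k)
    simp only [inner_sub_right, inner_sub_left] at h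
    exact sub_left_inj.1 h
  obtain ⟨w, r, hw⟩ := exists_hilbertBasis_eigenvectors b R hc hs hi
  refine ⟨⟨w, fun n => (r n)⁻¹ - 1, fun n => ?_⟩⟩
  have h := laplacian_smul (bc := bc) ((r n : ℂ)⁻¹) (hR (w n))
  have h0 : (r n : ℂ) ≠ 0 := by exact_mod_cast (hw n).1
  have h1 : ((r n : ℂ)⁻¹ • (R (w n), w n - R (w n))) = (w n, (((r n)⁻¹ - 1 : ℝ) : ℂ) • w n) := by
    rw [(hw n).2, Prod.smul_mk, smul_sub, inv_smul_smul₀ h0]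
    push_cast
    rw [sub_smul, one_smul]
  rwa [h1] at h

end Resolvent

/-! ### Exponentials on the edges -/

section Exponentials

variable {E : ℕ} {l : Fin E → ℝ}

/-- The exponential functions on the edges. -/
def edgeExp (l : Fin E → ℝ) (i : Fin E × ℤ) (e : Fin E) (x : ℝ) : ℂ :=
  if e = i.1 then ((√(l e))⁻¹ : ℝ) * Complex.exp (2 * Real.pi * Complex.I * i.2 * x / l e) else 0

/-- The wave numbers of the exponential functions. -/
def edgeFreq (l : Fin E → ℝ) (i : Fin E × ℤ) : ℝ := 2 * Real.pi * i.2 / l i.1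

theorem hasDerivAt_edgeExp (i : Fin E × ℤ) (e : Fin E) (x : ℝ) :
    HasDerivAt (edgeExp l i e) (Complex.I * edgeFreq l i * edgeExp l i e x) x := by
  unfold edgeExp edgeFreq
  split_ifs with h
  · subst h
    have h1 : HasDerivAt (fun x : ℝ => 2 * Real.pi * Complex.I * i.2 * (x : ℂ) / l i.1)
        (2 * Real.pi * Complex.I * i.2 * 1 / l i.1) x :=
      ((Complex.ofRealCLM.hasDerivAt (x := x)).const_mul _).div_const _
    refine (h1.cexp.const_mul (((√(l i.1))⁻¹ : ℝ) : ℂ)).congr_deriv ?_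
    push_cast
    ring
  · simpa using hasDerivAt_const x (0 : ℂ)

theorem continuous_edgeExp (i : Fin E × ℤ) (e : Fin E) : Continuous (edgeExp l i e) :=
  continuous_iff_continuousAt.2 fun x => (hasDerivAt_edgeExp i e x).continuousAt

theorem memLp_of_continuous {a : ℝ} {f : ℝ → ℂ} (hf : Continuous f) :
    MemLp f 2 (volume.restrict (Ioo 0 a)) := by
  obtain ⟨C, hC⟩ := isCompact_Icc.exists_bound_of_continuousOn (s := Icc 0 a) hf.continuousOn
  refine MemLp.of_bound hf.aestronglyMeasurable C ?_
  exact (ae_restrict_iff' measurableSet_Ioo).2 (Eventually.of_forall fun x hx =>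
    hC x (Ioo_subset_Icc_self hx))

theorem memLp_edgeExp (i : Fin E × ℤ) :
    MemLp (fun p : Fin E × ℝ => edgeExp l i p.1 p.2) 2 (edgeMeasure l) :=
  memLp_edgeMeasure_iff.2 fun e => memLp_of_continuous (continuous_edgeExp i e)

/-- The exponential functions, as elements of `L²(Γ)`. -/
def edgeExpL (l : Fin E → ℝ) (i : Fin E × ℤ) : L2 l := (memLp_edgeExp i).toLp _

theorem edgeExpL_ae (i : Fin E × ℤ) :
    ∀ᵐ p ∂edgeMeasure l, edgeExpL l i p = edgeExp l i p.1 p.2 :=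
  (memLp_edgeExp i).coeFn_toLp

theorem isMaxLaplacian_edgeExpL (i : Fin E × ℤ) :
    IsMaxLaplacian (edgeExpL l i) (((edgeFreq l i ^ 2 : ℝ) : ℂ) • edgeExpL l i) (edgeExp l i)
      (fun e x => Complex.I * edgeFreq l i * edgeExp l i e x)
      (fun e x => Complex.I * edgeFreq l i * (Complex.I * edgeFreq l i * edgeExp l i e x)) := by
  have hc := continuous_edgeExp (l := l) i
  refine ⟨fun e => ⟨memLp_of_continuous (by have := hc e; fun_prop), fun x _ => ?_, fun x _ => ?_⟩,
    edgeExpL_ae i, ?_⟩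
  · rw [intervalIntegral.integral_eq_sub_of_hasDerivAt
      (fun y _ => (hasDerivAt_edgeExp i e y).const_mul (Complex.I * edgeFreq l i))]
    · ring
    · exact (by have := hc e; fun_prop : Continuous fun x =>
        Complex.I * edgeFreq l i * (Complex.I * edgeFreq l i * edgeExp l i e x)).intervalIntegrable _ _
  · rw [intervalIntegral.integral_eq_sub_of_hasDerivAt (fun y _ => hasDerivAt_edgeExp i e y)]
    · ring
    · exact (by have := hc e; fun_prop : Continuous fun x =>
        Complex.I * edgeFreq l i * edgeExp l i e x).intervalIntegrable _ _
  · filter_upwards [Lp.coeFn_smul ((edgeFreq l i ^ 2 : ℝ) : ℂ) (edgeExpL l i), edgeExpL_ae i]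
      with p h1 h2
    rw [h1, Pi.smul_apply, h2, smul_eq_mul]
    push_cast
    linear_combination ((edgeFreq l i : ℂ) ^ 2 * edgeExp l i p.1 p.2) * Complex.I_sq

theorem star_edgeExp_mul (e : Fin E) (n m : ℤ) (x : ℝ) (hl : 0 < l e) :
    star (edgeExp l (e, n) e x) * edgeExp l (e, m) e x =
      (l e : ℂ)⁻¹ * Complex.exp ((m - n : ℤ) * (2 * Real.pi * Complex.I) / l e * x) := by
  have h1 : (((√(l e))⁻¹ : ℝ) : ℂ) * ((√(l e))⁻¹ : ℝ) = (l e : ℂ)⁻¹ := by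
    rw [← Complex.ofReal_mul, ← mul_inv, Real.mul_self_sqrt hl.le]; simp
  simp only [edgeExp, if_true, star_mul']
  rw [← h1, ← starRingEnd_apply, ← starRingEnd_apply, Complex.conj_ofReal, ← Complex.exp_conj]
  rw [mul_mul_mul_comm, ← Complex.exp_add]
  congr 2
  simp only [map_div₀, map_mul, Complex.conj_ofReal, Complex.conj_I, map_ofNat, map_intCast]
  push_cast; ring

theorem inner_edgeExpL (hl : ∀ e, 0 < l e) (i : Fin E × ℤ) {F : L2 l} :
    ⟪edgeExpL l i, F⟫_ℂ = ∫ x in (0 : ℝ)..l i.1, star (edgeExp l i i.1 x) * F (i.1, x) := by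
  rw [inner_eq_sum_intervalIntegral hl (g := fun e x => F (e, x)) (edgeExpL_ae i)
    (Eventually.of_forall fun _ => rfl), Finset.sum_eq_single i.1]
  · intro e _ he
    simp [edgeExp, he]
  · simp

theorem orthonormal_edgeExpL (hl : ∀ e, 0 < l e) : Orthonormal ℂ (edgeExpL l) := by
  rw [orthonormal_iff_ite]
  rintro ⟨e, n⟩ ⟨e', m⟩
  rw [inner_eq_sum_intervalIntegral hl (edgeExpL_ae _) (edgeExpL_ae _), Finset.sum_eq_single e]
  rotate_left
  · intro e'' _ he
    simp [edgeExp, he]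
  · simp
  by_cases he : e = e'
  · subst he
    simp_rw [star_edgeExp_mul e n m _ (hl e)]
    have hle : (l e : ℂ) ≠ 0 := by exact_mod_cast (hl e).ne'
    rw [intervalIntegral.integral_const_mul]
    by_cases hnm : n = m
    · subst hnm
      simp [hle]
    · have h2 : ((m - n : ℤ) : ℂ) * (2 * Real.pi * Complex.I) / l e ≠ 0 := by
        refine div_ne_zero (mul_ne_zero ?_ Complex.two_pi_I_ne_zero) hle
        exact_mod_cast sub_ne_zero.2 (Ne.symm hnm)
      rw [integral_exp_mul_complex h2, div_mul_cancel₀ _ hle, Complex.exp_int_mul_two_pi_mul_I]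
      simp [hnm]
  · simp [edgeExp, he]

/-- On each edge the inner products are, up to a factor, the Fourier coefficients, so Parseval's
identity gives `∫ ‖F‖ ^ 2 = 0`. -/
theorem edgeExpL_complete (hl : ∀ e, 0 < l e) {F : L2 l} (hF : ∀ i, ⟪edgeExpL l i, F⟫_ℂ = 0) :
    F = 0 := by
  have h : ∀ e, ∀ᵐ x ∂volume.restrict (Ioo 0 (l e)), F (e, x) = 0 := by
    intro e
    have hm : MemLp (fun x => F (e, x)) 2 (volume.restrict (Ioc 0 (l e))) := by
      rw [← restrict_Ioo_eq_restrict_Ioc]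
      exact memLp_edge F e
    have hs := hasSum_sq_fourierCoeffOn (hl e) hm
    have h0 : ∀ n, fourierCoeffOn (hl e) (fun x => F (e, x)) n = 0 := by
      intro n
      have h1 := hF (e, n)
      rw [inner_edgeExpL hl] at h1
      rw [fourierCoeffOn_eq_integral]
      have h2 : ∀ x : ℝ, fourier (-n) (x : AddCircle (l e - 0)) • F (e, x) =
          (√(l e) : ℂ) * (star (edgeExp l (e, n) e x) * F (e, x)) := by
        intro x
        have h3 : (√(l e) : ℂ) * ((√(l e))⁻¹ : ℝ) = 1 := by
          rw [← Complex.ofReal_mul, mul_inv_cancel₀ (Real.sqrt_pos.2 (hl e)).ne', Complex.ofReal_one]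
        rw [fourier_coe_apply, smul_eq_mul, ← mul_assoc]
        congr 1
        simp only [edgeExp, if_true, star_mul']
        rw [← starRingEnd_apply, ← starRingEnd_apply, Complex.conj_ofReal, ← Complex.exp_conj,
          ← mul_assoc, h3, one_mul]
        congr 1
        simp only [map_div₀, map_mul, Complex.conj_ofReal, Complex.conj_I, map_ofNat, map_intCast]
        push_cast; ring
      simp_rw [h2]
      rw [intervalIntegral.integral_const_mul, h1]
      simp
    simp only [h0, norm_zero, ne_eq, OfNat.ofNat_ne_zero, not_false_eq_true, zero_pow] at hs
    have h4 := hs.unique hasSum_zero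
    rw [sub_zero, smul_eq_mul, mul_eq_zero, or_iff_right (inv_ne_zero (hl e).ne'),
      intervalIntegral.integral_of_le (hl e).le, setIntegral_eq_zero_iff_of_nonneg_ae
        (Eventually.of_forall fun x => by positivity)
        ((memLp_two_iff_integrable_sq_norm hm.1).1 hm), ← restrict_Ioo_eq_restrict_Ioc] at h4
    filter_upwards [h4] with x hx
    simpa using hx
  refine Lp.ext ?_
  filter_upwards [(ae_edgeMeasure_iff (p := fun p => F p = 0)).2 h,
    Lp.coeFn_zero ℂ 2 (edgeMeasure l)] with p k1 k2
  rw [k1]; exact k2.symm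

/-- The Hilbert basis of exponential functions. -/
def edgeBasis (hl : ∀ e, 0 < l e) : HilbertBasis (Fin E × ℤ) ℂ (L2 l) :=
  HilbertBasis.mkOfOrthogonalEqBot (orthonormal_edgeExpL hl) (by
    rw [eq_bot_iff]
    intro F hF
    exact edgeExpL_complete hl fun i =>
      (Submodule.mem_orthogonal _ _).1 hF _ (Submodule.subset_span ⟨i, rfl⟩))

theorem edgeBasis_apply (hl : ∀ e, 0 < l e) (i : Fin E × ℤ) : edgeBasis hl i = edgeExpL l i := by
  simp [edgeBasis]

end Exponentials

/-! ### Comparison of spectra -/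

section Comparison

variable {E : ℕ} {l : Fin E → ℝ}

theorem boundaryValue_sum {ι : Type*} (s : Finset ι) (c : ι → ℂ) (f : ι → Fin E → ℝ → ℂ) :
    boundaryValue l (∑ i ∈ s, c i • f i) = ∑ i ∈ s, c i • boundaryValue l (f i) := by
  ext j
  cases j <;> simp [boundaryValue, Finset.sum_apply]

theorem boundaryDeriv_sum {ι : Type*} (s : Finset ι) (c : ι → ℂ) (f : ι → Fin E → ℝ → ℂ) :
    boundaryDeriv l (∑ i ∈ s, c i • f i) = ∑ i ∈ s, c i • boundaryDeriv l (f i) := by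
  ext j
  cases j <;> simp [boundaryDeriv, Finset.sum_apply]

/-- Two complete orthonormal systems of eigenvectors of the maximal Laplacian have the same number of
eigenvalues below any threshold, up to `4 E`. -/
theorem card_le_card_add (hl : ∀ e, 0 < l e) {ι κ : Type*} (b : HilbertBasis ι ℂ (L2 l)) (a : ι → ℝ)
    (hb : ∀ i, ∃ f f' f'', IsMaxLaplacian (b i) ((a i : ℂ) • b i) f f' f'')
    (b' : HilbertBasis κ ℂ (L2 l)) (a' : κ → ℝ)
    (hb' : ∀ i, ∃ f f' f'', IsMaxLaplacian (b' i) ((a' i : ℂ) • b' i) f f' f'') (K : ℝ)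
    (s : Finset ι) (hs : ∀ i ∈ s, a i ≤ K) (t : Finset κ) (ht : ∀ j, a' j ≤ K → j ∈ t) :
    s.card ≤ t.card + 4 * E := by
  classical
  choose f f' f'' hf using hb
  by_contra! hlt
  -- The target has dimension `2E + 2E + t.card < s.card`. A kernel element gives a combination `v`
  -- of low eigenvectors `b i` with zero boundary data and orthogonal to `b' j` for all `j ∈ t`.
  let Φ : (s → ℂ) →ₗ[ℂ] BoundarySpace E × BoundarySpace E × (t → ℂ) :=
    Fintype.linearCombination ℂ fun i : s =>
      (boundaryValue l (f i), boundaryDeriv l (f' i), fun j : t => ⟪b' j, b i⟫_ℂ)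
  have hker : LinearMap.ker Φ ≠ ⊥ := by
    refine LinearMap.ker_ne_bot_of_finrank_lt ?_
    simp only [Module.finrank_prod, finrank_euclideanSpace, Fintype.card_sum, Fintype.card_fin,
      Module.finrank_fintype_fun_eq_card, Fintype.card_coe]
    omega
  obtain ⟨c, hc, hc0⟩ := (Submodule.ne_bot_iff _).1 hker
  rw [LinearMap.mem_ker, Fintype.linearCombination_apply] at hc
  have hbv : ∑ i : s, c i • boundaryValue l (f i) = 0 := by
    simpa [Prod.fst_sum] using congrArg Prod.fst hc
  have hbd : ∑ i : s, c i • boundaryDeriv l (f' i) = 0 := by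
    simpa [Prod.fst_sum, Prod.snd_sum] using congrArg (fun z => z.2.1) hc
  have hin : ∀ j ∈ t, ∑ i : s, c i * ⟪b' j, b i⟫_ℂ = 0 := by
    intro j hj
    simpa [Prod.snd_sum, Finset.sum_apply] using congrFun (congrArg (fun z => z.2.2) hc) ⟨j, hj⟩
  set v : L2 l := ∑ i : s, c i • b i with hv
  set G : L2 l := ∑ i : s, c i • ((a i : ℂ) • b i) with hG
  have hmax := IsMaxLaplacian.sum hl Finset.univ (fun i : s => hf i) c
  have hon : Orthonormal ℂ fun i : s => b i := b.orthonormal.comp _ Subtype.val_injective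
  have hvn : ‖v‖ ^ 2 = ∑ i : s, ‖c i‖ ^ 2 := by
    have h : ⟪v, v⟫_ℂ = ∑ i : s, star (c i) * c i := by
      rw [hv]; exact hon.inner_sum c c Finset.univ
    have h2 := congrArg Complex.re h
    rw [show (⟪v, v⟫_ℂ).re = ‖v‖ ^ 2 from inner_self_eq_norm_sq (𝕜 := ℂ) _, Complex.re_sum] at h2
    rw [h2]
    refine Finset.sum_congr rfl fun i _ => ?_
    have := Complex.conj_mul' (c i)
    simp only [Complex.star_def, this]
    norm_cast
  have hvG : (⟪v, G⟫_ℂ).re = ∑ i : s, a i * ‖c i‖ ^ 2 := by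
    have hG' : G = ∑ i : s, (c i * a i) • b i := by
      simp only [hG, smul_smul]
    have h : ⟪v, G⟫_ℂ = ∑ i : s, star (c i) * (c i * a i) := by
      rw [hv, hG']; exact hon.inner_sum c (fun i : s => c i * a i) Finset.univ
    rw [h, Complex.re_sum]
    refine Finset.sum_congr rfl fun i _ => ?_
    have := Complex.conj_mul' (c i)
    rw [← mul_assoc, Complex.star_def, this, mul_comm]
    norm_cast
  have hle : (⟪v, G⟫_ℂ).re ≤ K * ‖v‖ ^ 2 := by
    rw [hvG, hvn, Finset.mul_sum]
    exact Finset.sum_le_sum fun i _ => by gcongr; exact hs i i.2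
  -- As `v` has zero boundary data, Green's formula has no boundary terms, whatever conditions `b'
  -- j` satisfies.
  have hinner : ∀ j, ⟪b' j, G⟫_ℂ = a' j * ⟪b' j, v⟫_ℂ := by
    intro j
    obtain ⟨g, g', g'', hg⟩ := hb' j
    rw [hg.inner_eq_inner_of_boundary_eq_zero hl hmax (by rw [boundaryValue_sum, hbv])
      (by rw [boundaryDeriv_sum, hbd]), inner_smul_left, Complex.conj_ofReal]
  have hsum : HasSum (fun j => (a' j - K) * ‖⟪b' j, v⟫_ℂ‖ ^ 2) ((⟪v, G⟫_ℂ).re - K * ‖v‖ ^ 2) := by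
    have h1 := Complex.hasSum_re (b'.hasSum_inner_mul_inner v G)
    have h2 := (HilbertBasis.hasSum_norm_sq b' v).mul_left K
    refine (h1.sub h2).congr_fun fun j => ?_
    rw [hinner j, ← inner_conj_symm v (b' j), mul_left_comm, Complex.conj_mul']
    norm_cast
    ring
  have hvb : ∀ j ∈ t, ⟪b' j, v⟫_ℂ = 0 := by
    intro j hj
    rw [hv, inner_sum, ← hin j hj]
    simp [inner_smul_right]
  -- Only components with `a' j > K` survive. Expanding in `b'` gives `⟪v, G⟫ ≥ K * ‖v‖ ^ 2`,
  -- against `hle`; equality forces `v = 0`.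
  have hnn : ∀ j, 0 ≤ (a' j - K) * ‖⟪b' j, v⟫_ℂ‖ ^ 2 := by
    intro j
    by_cases hj : j ∈ t
    · simp [hvb j hj]
    · have : K < a' j := not_le.1 fun h => hj (ht j h)
      have : 0 ≤ a' j - K := by linarith
      positivity
  have hz : (⟪v, G⟫_ℂ).re - K * ‖v‖ ^ 2 = 0 := le_antisymm (by linarith) (hsum.nonneg hnn)
  rw [hz, hasSum_zero_iff_of_nonneg hnn] at hsum
  have hv0 : v = 0 := HilbertBasis.eq_zero_of_inner b' fun j => by
    by_cases hj : j ∈ t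
    · exact hvb j hj
    · have h1 : K < a' j := not_le.1 fun h => hj (ht j h)
      have h2 := congrFun hsum j
      simp only [Pi.zero_apply, mul_eq_zero, sub_eq_zero, h1.ne', false_or] at h2
      simpa using h2
  exact hc0 (funext fun i => by
    have := Fintype.linearIndependent_iff.1 hon.linearIndependent c hv0 i
    simpa using this)

end Comparison

/-- A comparison of sums of antitone functions, by means of Hall's marriage theorem. -/
theorem summable_and_tsum_le {ι κ : Type*} {a : ι → ℝ} {b : κ → ℝ} (ha : ∀ i, 0 ≤ a i)
    (hb : ∀ j, 0 ≤ b j) (D : ℕ) (hfin : ∀ K, {j | b j ≤ K}.Finite)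
    (hcard : ∀ K (s : Finset ι), (∀ i ∈ s, a i ≤ K) → s.card ≤ (hfin K).toFinset.card + D)
    {g : ℝ → ℝ} (hg : AntitoneOn g (Ici 0)) (hg0 : ∀ x, 0 ≤ x → 0 ≤ g x)
    (hs : Summable fun j => g (b j)) :
    (Summable fun i => g (a i)) ∧ ∑' i, g (a i) ≤ ∑' j, g (b j) + D * g 0 := by
  classical
  -- An index `i` may be matched with any `j` such that `b j ≤ a i`, or with one of `D` spare slots,
  -- each contributing `g 0`. These sets grow with `a i`, so Hall's condition for `s` need only be
  -- checked at the maximiser of `a` on `s`.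
  let t : ι → Finset (κ ⊕ Fin D) := fun i => (hfin (a i)).toFinset.disjSum Finset.univ
  have hall : ∀ s : Finset ι, s.card ≤ (s.biUnion t).card := by
    intro s
    rcases s.eq_empty_or_nonempty with rfl | hne
    · simp
    obtain ⟨i, his, hi⟩ := s.exists_max_image a hne
    calc s.card ≤ (hfin (a i)).toFinset.card + D := hcard _ s hi
      _ = (t i).card := by simp [t, Finset.card_disjSum]
      _ ≤ (s.biUnion t).card := Finset.card_le_card (Finset.subset_biUnion_of_mem t his)
  obtain ⟨φ, hφ, hφt⟩ := (Finset.all_card_le_biUnion_card_iff_exists_injective t).1 hall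
  let G : κ ⊕ Fin D → ℝ := Sum.elim (fun j => g (b j)) fun _ => g 0
  have hG : HasSum G (∑' j, g (b j) + D * g 0) := by
    refine HasSum.sum ?_ ?_
    · exact hs.hasSum
    · have := hasSum_fintype fun _ : Fin D => g 0
      simpa [G, Function.comp_def] using this
  have hG0 : ∀ z, 0 ≤ G z := by
    rintro (j | _)
    · exact hg0 _ (hb j)
    · exact hg0 _ le_rfl
  have hle : ∀ i, g (a i) ≤ G (φ i) := by
    intro i
    have h := hφt i
    rcases hφi : φ i with j | k
    · rw [hφi] at h
      simp only [t, Finset.inl_mem_disjSum, Finite.mem_toFinset, mem_ofPred_eq] at h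
      exact hg (hb j) (ha i) h
    · exact hg self_mem_Ici (ha i) (ha i)
  have hGs : Summable fun i => G (φ i) := hG.summable.comp_injective hφ
  have hsa : Summable fun i => g (a i) := Summable.of_nonneg_of_le (fun i => hg0 _ (ha i)) hle hGs
  refine ⟨hsa, (hsa.tsum_le_tsum hle hGs).trans ?_⟩
  rw [← hG.tsum_eq]
  exact tsum_comp_le_tsum_of_inj hG.summable hG0 hφ

/-! ### Asymptotics of sums over the spectrum -/

/-- The integral test, for a sum with spacing `δ`. -/
theorem summable_and_abs_sub_integral_le {h : ℝ → ℝ} (hh : AntitoneOn h (Ici 0))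
    (h0 : ∀ x, 0 ≤ x → 0 ≤ h x) (hint : IntegrableOn h (Ioi 0)) {δ : ℝ} (hδ : 0 < δ) :
    (Summable fun n : ℕ => h (δ * (n + 1))) ∧
      ∑' n : ℕ, h (δ * (n + 1)) ≤ δ⁻¹ * ∫ x in Ioi (0 : ℝ), h x ∧
      δ⁻¹ * ∫ x in Ioi (0 : ℝ), h x ≤ h 0 + ∑' n : ℕ, h (δ * (n + 1)) := by
  have hI : ∫ x in Ioi (0 : ℝ), h (δ * x) = δ⁻¹ * ∫ x in Ioi (0 : ℝ), h x := by
    have := integral_comp_mul_left_Ioi h 0 hδ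
    rwa [mul_zero, smul_eq_mul] at this
  have hint' : IntegrableOn (fun x => h (δ * x)) (Ioi 0) := by
    have := (integrableOn_Ioi_comp_mul_left_iff h 0 hδ).2
    rw [mul_zero] at this
    exact this hint
  have hanti : ∀ n : ℕ, AntitoneOn (fun x => h (δ * x)) (Icc 0 (0 + (n : ℝ))) := by
    intro n x hx y hy hxy
    exact hh (mul_nonneg hδ.le hx.1) (mul_nonneg hδ.le hy.1) (by gcongr)
  have hnn : ∀ n : ℕ, 0 ≤ h (δ * (n + 1)) := fun n => h0 _ (by positivity)
  have hle : ∀ n : ℕ, ∑ i ∈ Finset.range n, h (δ * (i + 1)) ≤ ∫ x in Ioi (0 : ℝ), h (δ * x) := by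
    intro n
    have h1 := (hanti n).sum_le_integral
    simp only [zero_add, Nat.cast_add, Nat.cast_one] at h1
    refine h1.trans ?_
    rw [intervalIntegral.integral_of_le (by positivity)]
    refine setIntegral_mono_set hint' ?_ (Eventually.of_forall Ioc_subset_Ioi_self)
    exact (ae_restrict_iff' measurableSet_Ioi).2 (Eventually.of_forall fun x hx =>
      h0 _ (mul_nonneg hδ.le (le_of_lt hx)))
  have hsum : Summable fun n : ℕ => h (δ * (n + 1)) := summable_of_sum_range_le hnn hle
  rw [← hI]
  refine ⟨hsum, hsum.tsum_le_of_sum_range_le hle, ?_⟩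
  have hlim := intervalIntegral_tendsto_integral_Ioi 0 hint' tendsto_natCast_atTop_atTop
  refine le_of_tendsto' hlim fun n => ?_
  have h1 := (hanti n).integral_le_sum
  simp only [zero_add] at h1
  refine h1.trans ?_
  rcases n with _ | n
  · simpa using add_nonneg (h0 0 le_rfl) (tsum_nonneg hnn)
  rw [Finset.sum_range_succ']
  simp only [Nat.cast_zero, mul_zero, Nat.cast_add, Nat.cast_one]
  rw [add_comm]
  gcongr
  exact hsum.sum_le_tsum _ fun i _ => hnn i

section Asymptotics

variable {E : ℕ} {l : Fin E → ℝ}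

theorem finite_edgeFreq_le (hl : ∀ e, 0 < l e) (K : ℝ) : {i | edgeFreq l i ^ 2 ≤ K}.Finite := by
  have h : ∀ e, ∃ M : ℕ, ∀ n : ℤ, edgeFreq l (e, n) ^ 2 ≤ K → |n| ≤ M := by
    intro e
    obtain ⟨M, hM⟩ := exists_nat_ge (√K / (2 * Real.pi / l e))
    refine ⟨M, fun n hn => ?_⟩
    have hc : 0 < 2 * Real.pi / l e := div_pos Real.two_pi_pos (hl e)
    have h1 : |edgeFreq l (e, n)| ≤ √K := Real.abs_le_sqrt hn
    have h2 : edgeFreq l (e, n) = 2 * Real.pi / l e * n := by simp only [edgeFreq]; ring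
    rw [h2, abs_mul, abs_of_pos hc, mul_comm, ← le_div_iff₀ hc] at h1
    exact_mod_cast h1.trans hM
  choose M hM using h
  refine Set.Finite.subset (s := ⋃ e, Prod.mk e '' Icc (-(M e : ℤ)) (M e))
    (Set.finite_iUnion fun e => (finite_Icc _ _).image _) ?_
  rintro ⟨e, n⟩ hn
  exact mem_iUnion.2 ⟨e, n, abs_le.1 (hM e n hn), rfl⟩

/-- On one edge the sum over `ℤ` is `g 0` plus twice a half-line sum with spacing `2π / l e`. The
half-line sum falls short of its integral by between `0` and `g 0`, so the error per edge lies
between `-g 0` and `g 0`. -/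
theorem tsum_edgeFreq (hl : ∀ e, 0 < l e) {g : ℝ → ℝ} (hg : AntitoneOn g (Ici 0))
    (hg0 : ∀ x, 0 ≤ x → 0 ≤ g x) (hint : IntegrableOn (fun k : ℝ => g (k ^ 2)) (Ioi 0)) :
    (Summable fun i => g (edgeFreq l i ^ 2)) ∧
      |∑' i, g (edgeFreq l i ^ 2) - totalLength l / Real.pi * ∫ k in Ioi (0 : ℝ), g (k ^ 2)| ≤
        E * g 0 := by
  set I := ∫ k in Ioi (0 : ℝ), g (k ^ 2)
  have hanti : AntitoneOn (fun k : ℝ => g (k ^ 2)) (Ici 0) := fun x hx y hy hxy =>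
    hg (sq_nonneg x) (sq_nonneg y) (pow_le_pow_left₀ hx hxy 2)
  have hedge : ∀ e, ∃ s, HasSum (fun n : ℤ => g (edgeFreq l (e, n) ^ 2)) s ∧
      |s - l e / Real.pi * I| ≤ g 0 := by
    intro e
    have hc : 0 < 2 * Real.pi / l e := div_pos Real.two_pi_pos (hl e)
    obtain ⟨h1, h2, h3⟩ := summable_and_abs_sub_integral_le hanti (fun x _ => hg0 _ (sq_nonneg x))
      hint hc
    have hpos : HasSum (fun n : ℕ => g (edgeFreq l (e, (n : ℤ) + 1) ^ 2))
        (∑' n : ℕ, g ((2 * Real.pi / l e * (n + 1)) ^ 2)) := by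
      convert h1.hasSum using 4 with n
      simp only [edgeFreq]; push_cast; ring
    have hneg : HasSum (fun n : ℕ => g (edgeFreq l (e, -((n : ℤ) + 1)) ^ 2))
        (∑' n : ℕ, g ((2 * Real.pi / l e * (n + 1)) ^ 2)) := by
      convert h1.hasSum using 3 with n
      simp only [edgeFreq]; push_cast; ring
    refine ⟨_, HasSum.of_add_one_of_neg_add_one hpos hneg, ?_⟩
    have h4 : l e / Real.pi * I = 2 * ((2 * Real.pi / l e)⁻¹ * I) := by
      rw [inv_div]; ring
    have h5 : g (edgeFreq l (e, 0) ^ 2) = g 0 := by simp [edgeFreq]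
    simp only [ne_eq, OfNat.ofNat_ne_zero, not_false_eq_true, zero_pow] at h3
    rw [h4, h5, abs_le]
    constructor <;> linarith
  choose s hs hsI using hedge
  have hsum : HasSum (fun i : Fin E × ℤ => g (edgeFreq l i ^ 2)) (∑ e, s e) := by
    have h1 : Summable fun i : Fin E × ℤ => g (edgeFreq l i ^ 2) :=
      (summable_prod_of_nonneg fun i => hg0 _ (sq_nonneg _)).2
        ⟨fun e => (hs e).summable, Summable.of_finite⟩
    exact (h1.hasSum.prod_fiberwise hs).unique (hasSum_fintype s) ▸ h1.hasSum
  refine ⟨hsum.summable, ?_⟩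
  rw [hsum.tsum_eq, totalLength, Finset.sum_div, Finset.sum_mul, ← Finset.sum_sub_distrib]
  refine (Finset.abs_sum_le_sum_abs _ _).trans ((Finset.sum_le_sum fun e _ => hsI e).trans ?_)
  simp

/-- Sums over the spectrum are given by an integral, up to a bound that depends only on the number of
edges. -/
theorem Eigensystem.summable_and_abs_tsum_sub_le {bc : VertexConditions E} (hl : ∀ e, 0 < l e)
    (hneg : bc.NegSemidef) (S : Eigensystem (laplacian bc l)) {g : ℝ → ℝ}
    (hg : AntitoneOn g (Ici 0)) (hg0 : ∀ x, 0 ≤ x → 0 ≤ g x)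
    (hint : IntegrableOn (fun k : ℝ => g (k ^ 2)) (Ioi 0)) :
    (Summable fun n => g (S.val n)) ∧
      |∑' n, g (S.val n) - totalLength l / Real.pi * ∫ k in Ioi (0 : ℝ), g (k ^ 2)| ≤
        5 * E * g 0 := by
  obtain ⟨h1, h2⟩ := tsum_edgeFreq hl hg hg0 hint
  have hS : ∀ n, ∃ f f' f'', IsMaxLaplacian (S.vec n) ((S.val n : ℂ) • S.vec n) f f' f'' :=
    fun n => exists_isMaxLaplacian (S.eig n)
  have hb : ∀ i, ∃ f f' f'', IsMaxLaplacian (edgeBasis hl i)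
      (((edgeFreq l i ^ 2 : ℝ) : ℂ) • edgeBasis hl i) f f' f'' := fun i => by
    rw [edgeBasis_apply]
    exact ⟨_, _, _, isMaxLaplacian_edgeExpL i⟩
  have hnn := S.val_nonneg hl hneg
  have hc1 : ∀ K (s : Finset ℕ), (∀ n ∈ s, S.val n ≤ K) →
      s.card ≤ (finite_edgeFreq_le hl K).toFinset.card + 4 * E := fun K s hs =>
    card_le_card_add hl S.vec S.val hS (edgeBasis hl) _ hb K s hs _ (by simp)
  -- Discreteness of the spectrum follows from the counting bound, and is what the comparison in the
  -- opposite direction needs.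
  have hfin : ∀ K, {n | S.val n ≤ K}.Finite := by
    intro K
    by_contra hinf
    obtain ⟨s, hs, hcard⟩ := Set.Infinite.exists_subset_card_eq hinf
      ((finite_edgeFreq_le hl K).toFinset.card + 4 * E + 1)
    have := hc1 K s fun n hn => hs hn
    omega
  obtain ⟨h3, h4⟩ := summable_and_tsum_le hnn (fun i => sq_nonneg (edgeFreq l i)) (4 * E)
    (finite_edgeFreq_le hl) hc1 hg hg0 h1
  obtain ⟨-, h5⟩ := summable_and_tsum_le (fun i => sq_nonneg (edgeFreq l i)) hnn (4 * E) hfin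
    (fun K s hs => card_le_card_add hl (edgeBasis hl) _ hb S.vec S.val hS K s hs _ (by simp))
    hg hg0 h3
  -- The constant `5E` is `4E` from the comparison of spectra plus `E` from the integral test.
  refine ⟨h3, ?_⟩
  push_cast at h4 h5
  rw [abs_le] at h2 ⊢
  constructor <;> linarith

end Asymptotics

/-! ### Occupation numbers and the limiting density -/

section Occupation

variable {β : ℝ}

theorem occupation_pos (hβ : 0 < β) {μ ε : ℝ} (h : μ < ε) : 0 < occupation β μ ε := by
  have : 1 < Real.exp (β * (ε - μ)) := Real.one_lt_exp_iff.2 (mul_pos hβ (sub_pos.2 h))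
  exact one_div_pos.2 (sub_pos.2 this)

theorem occupation_le_occupation (hβ : 0 < β) {μ ε ε' μ' : ℝ} (h : μ' < ε') (hε : ε' ≤ ε)
    (hμ : μ ≤ μ') : occupation β μ ε ≤ occupation β μ' ε' := by
  have : 1 < Real.exp (β * (ε' - μ')) := Real.one_lt_exp_iff.2 (mul_pos hβ (sub_pos.2 h))
  refine one_div_le_one_div_of_le (sub_pos.2 this) ?_
  gcongr

theorem occupation_lt_occupation (hβ : 0 < β) {μ ε μ' : ℝ} (h : μ' < ε) (hμ : μ < μ') :
    occupation β μ ε < occupation β μ' ε := by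
  have : 1 < Real.exp (β * (ε - μ')) := Real.one_lt_exp_iff.2 (mul_pos hβ (sub_pos.2 h))
  refine one_div_lt_one_div_of_lt (sub_pos.2 this) ?_
  gcongr

/-- With `x = exp (-(β * (ε - μ)))` the occupation is `x / (1 - x)`, and the denominator is smallest
at `ε = m`. Summability and integrability are thereby inherited from Boltzmann factors, and the
prefactor `exp (β * μ)` supplies the decay as `μ → -∞`. -/
theorem occupation_le_mul_exp (hβ : 0 < β) {μ m ε : ℝ} (hm : μ < m) (hε : m ≤ ε) :
    occupation β μ ε ≤
      Real.exp (β * μ) / (1 - Real.exp (-(β * (m - μ)))) * Real.exp (-β * ε) := by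
  have h1 : Real.exp (-(β * (m - μ))) < 1 :=
    Real.exp_lt_one_iff.2 (neg_lt_zero.2 (mul_pos hβ (sub_pos.2 hm)))
  have h2 : Real.exp (-(β * (ε - μ))) ≤ Real.exp (-(β * (m - μ))) := by gcongr
  have h3 : occupation β μ ε = Real.exp (-(β * (ε - μ))) / (1 - Real.exp (-(β * (ε - μ)))) := by
    have h4 : Real.exp (β * (ε - μ)) * Real.exp (-(β * (ε - μ))) = 1 := by
      rw [← Real.exp_add, add_neg_cancel, Real.exp_zero]
    have h5 : Real.exp (β * (ε - μ)) - 1 ≠ 0 := by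
      have : 1 < Real.exp (β * (ε - μ)) :=
        Real.one_lt_exp_iff.2 (mul_pos hβ (sub_pos.2 (hm.trans_le hε)))
      linarith
    rw [occupation, div_eq_div_iff h5 (by linarith)]
    linear_combination -h4
  have h6 : Real.exp (-(β * (ε - μ))) = Real.exp (β * μ) * Real.exp (-β * ε) := by
    rw [← Real.exp_add]; ring_nf
  rw [h3, div_mul_eq_mul_div, ← h6]
  gcongr

theorem continuousOn_occupation (hβ : 0 < β) (μ : ℝ) : ContinuousOn (occupation β μ) (Ioi μ) := by
  refine ContinuousOn.div continuousOn_const (by fun_prop) fun ε hε => ?_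
  have : 1 < Real.exp (β * (ε - μ)) := Real.one_lt_exp_iff.2 (mul_pos hβ (sub_pos.2 hε))
  linarith

theorem continuousOn_occupation_left (hβ : 0 < β) (ε : ℝ) :
    ContinuousOn (fun μ => occupation β μ ε) (Iio ε) := by
  refine ContinuousOn.div continuousOn_const (by fun_prop) fun μ hμ => ?_
  have : 1 < Real.exp (β * (ε - μ)) := Real.one_lt_exp_iff.2 (mul_pos hβ (sub_pos.2 hμ))
  linarith

theorem integrableOn_exp_neg_mul_sq (hβ : 0 < β) :
    IntegrableOn (fun k : ℝ => Real.exp (-β * k ^ 2)) (Ioi 0) :=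
  (integrable_exp_neg_mul_sq hβ).integrableOn

theorem continuous_occupation_sq (hβ : 0 < β) {μ : ℝ} (hμ : μ < 0) :
    Continuous fun k : ℝ => occupation β μ (k ^ 2) :=
  (continuousOn_occupation hβ μ).comp_continuous (by fun_prop) fun k =>
    hμ.trans_le (sq_nonneg k)

theorem integrableOn_occupation (hβ : 0 < β) {μ : ℝ} (hμ : μ < 0) :
    IntegrableOn (fun k : ℝ => occupation β μ (k ^ 2)) (Ioi 0) := by
  refine Integrable.mono' ((integrableOn_exp_neg_mul_sq hβ).const_mul
      (Real.exp (β * μ) / (1 - Real.exp (-(β * (0 - μ))))))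
    (continuous_occupation_sq hβ hμ).aestronglyMeasurable ?_
  refine Eventually.of_forall fun k => ?_
  rw [Real.norm_eq_abs, abs_of_pos (occupation_pos hβ (hμ.trans_le (sq_nonneg k)))]
  exact occupation_le_mul_exp hβ hμ (sq_nonneg k)

theorem setIntegral_Ioi_pos {f : ℝ → ℝ} (hf : IntegrableOn f (Ioi 0)) (h : ∀ x, 0 < f x) :
    0 < ∫ x in Ioi (0 : ℝ), f x := by
  rw [setIntegral_pos_iff_support_of_nonneg_ae (Eventually.of_forall fun x => (h x).le) hf]
  have : Function.support f = univ := eq_univ_of_forall fun x => (h x).ne'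
  rw [this, univ_inter, Real.volume_Ioi]
  exact ENNReal.zero_lt_top

theorem limitDensity_pos (hβ : 0 < β) {μ : ℝ} (hμ : μ < 0) : 0 < limitDensity β μ :=
  mul_pos (by positivity) (setIntegral_Ioi_pos (integrableOn_occupation hβ hμ) fun k =>
    occupation_pos hβ (hμ.trans_le (sq_nonneg k)))

theorem limitDensity_strictMonoOn (hβ : 0 < β) : StrictMonoOn (limitDensity β) (Iio 0) := by
  intro μ hμ μ' hμ' h
  have h1 := setIntegral_Ioi_pos
    ((integrableOn_occupation hβ hμ').sub (integrableOn_occupation hβ hμ)) fun k =>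
      sub_pos.2 (occupation_lt_occupation hβ (lt_of_lt_of_le hμ' (sq_nonneg k)) h)
  have h2 := integral_sub (integrableOn_occupation hβ hμ') (integrableOn_occupation hβ hμ)
  refine mul_lt_mul_of_pos_left ?_ (by positivity)
  rw [← sub_pos, ← h2]
  exact h1

theorem limitDensity_continuousOn (hβ : 0 < β) : ContinuousOn (limitDensity β) (Iio 0) := by
  intro μ₀ hμ₀
  rw [mem_Iio] at hμ₀
  refine ContinuousAt.continuousWithinAt (ContinuousAt.mul continuousAt_const ?_)
  have hm : μ₀ / 2 < 0 := by linarith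
  have hev : ∀ᶠ μ in 𝓝 μ₀, μ < μ₀ / 2 := Iio_mem_nhds (by linarith)
  refine continuousAt_of_dominated (bound := fun k => occupation β (μ₀ / 2) (k ^ 2)) ?_ ?_
    (integrableOn_occupation hβ hm) ?_
  · filter_upwards [hev] with μ hμ
    exact (continuous_occupation_sq hβ (hμ.trans hm)).aestronglyMeasurable
  · filter_upwards [hev] with μ hμ
    refine Eventually.of_forall fun k => ?_
    have hk := sq_nonneg k
    rw [Real.norm_eq_abs, abs_of_pos (occupation_pos hβ ((hμ.trans hm).trans_le hk))]
    exact occupation_le_occupation hβ (hm.trans_le hk) le_rfl hμ.le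
  · refine Eventually.of_forall fun k => ?_
    exact (continuousOn_occupation_left hβ (k ^ 2)).continuousAt
      (Iio_mem_nhds (hμ₀.trans_le (sq_nonneg k)))

theorem exists_limitDensity_lt (hβ : 0 < β) {ρ : ℝ} (hρ : 0 < ρ) :
    ∃ μ < 0, limitDensity β μ < ρ := by
  -- For `μ ≤ -1` the denominators in `occupation_le_mul_exp` are at least `1 - exp (-β)`, so the
  -- density is at most `exp (β * μ) * C`.
  set C := 1 / Real.pi * ∫ k in Ioi (0 : ℝ), (1 - Real.exp (-β))⁻¹ * Real.exp (-β * k ^ 2) with hC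
  have hlim : Tendsto (fun μ => Real.exp (β * μ) * C) atBot (𝓝 0) := by
    have h1 : Tendsto (fun μ => Real.exp (β * μ)) atBot (𝓝 0) :=
      Real.tendsto_exp_atBot.comp (tendsto_id.const_mul_atBot hβ)
    simpa using h1.mul_const C
  obtain ⟨μ, h1, h2⟩ := ((hlim.eventually (Iio_mem_nhds hρ)).and (eventually_le_atBot (-1))).exists
  have hμ : μ < 0 := by linarith
  refine ⟨μ, hμ, lt_of_le_of_lt ?_ h1⟩
  rw [hC, limitDensity, mul_left_comm, ← integral_const_mul (Real.exp (β * μ))]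
  refine mul_le_mul_of_nonneg_left ?_ (by positivity)
  have h3 : Real.exp (-β) < 1 := Real.exp_lt_one_iff.2 (by linarith)
  refine setIntegral_mono (integrableOn_occupation hβ hμ)
    (((integrableOn_exp_neg_mul_sq hβ).const_mul _).const_mul _) fun k => ?_
  refine (occupation_le_mul_exp hβ hμ (sq_nonneg k)).trans ?_
  rw [div_eq_mul_inv, mul_assoc]
  have h4 : Real.exp (-(β * (0 - μ))) ≤ Real.exp (-β) := by
    refine Real.exp_le_exp.2 ?_
    nlinarith
  have h5 : (1 - Real.exp (-(β * (0 - μ))))⁻¹ ≤ (1 - Real.exp (-β))⁻¹ :=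
    inv_anti₀ (by linarith) (by linarith)
  gcongr

/-- This is where dimension one matters. At `μ = -s ^ 2` every `k ∈ (0, s]` has `k ^ 2 - μ ≤ 2 * s ^
2`, hence occupation at least `1 / (4 * β * s ^ 2)` by `exp x - 1 ≤ 2 * x` on `(0, 1]`. An interval
of length `s` thus contributes a multiple of `1 / s`. -/
theorem exists_lt_limitDensity (hβ : 0 < β) (ρ : ℝ) : ∃ μ < 0, ρ < limitDensity β μ := by
  have key : ∀ s, 0 < s → 2 * β * s ^ 2 ≤ 1 →
      1 / Real.pi * (s * (1 / (4 * β * s ^ 2))) ≤ limitDensity β (-s ^ 2) := by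
    intro s hs hs1
    have hμ : -s ^ 2 < 0 := neg_lt_zero.2 (by positivity)
    refine mul_le_mul_of_nonneg_left ?_ (by positivity)
    have h1 : occupation β (-s ^ 2) (s ^ 2) ≥ 1 / (4 * β * s ^ 2) := by
      have h2 : β * (s ^ 2 - -s ^ 2) = 2 * β * s ^ 2 := by ring
      have h3 : 0 < 2 * β * s ^ 2 := by positivity
      have h4 := Real.abs_exp_sub_one_le (x := 2 * β * s ^ 2) (by rwa [abs_of_pos h3])
      rw [abs_of_pos h3] at h4
      refine one_div_le_one_div_of_le ?_ ?_
      · rw [h2]; exact sub_pos.2 (Real.one_lt_exp_iff.2 h3)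
      · rw [h2]; linarith [le_abs_self (Real.exp (2 * β * s ^ 2) - 1)]
    calc s * (1 / (4 * β * s ^ 2)) = ∫ _ in Ioc 0 s, 1 / (4 * β * s ^ 2) := by
          simp [hs.le]
      _ ≤ ∫ k in Ioc 0 s, occupation β (-s ^ 2) (k ^ 2) := by
          refine setIntegral_mono_on (integrable_const _)
            ((integrableOn_occupation hβ hμ).mono_set Ioc_subset_Ioi_self) measurableSet_Ioc
            fun k hk => h1.le.trans ?_
          exact occupation_le_occupation hβ (hμ.trans_le (sq_nonneg k))
            (pow_le_pow_left₀ hk.1.le hk.2 2) le_rfl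
      _ ≤ _ := setIntegral_mono_set (integrableOn_occupation hβ hμ)
          (Eventually.of_forall fun k => (occupation_pos hβ (hμ.trans_le (sq_nonneg k))).le)
          (Eventually.of_forall Ioc_subset_Ioi_self)
  have hlim : Tendsto (fun s : ℝ => (1 / (4 * Real.pi * β)) * s⁻¹) (𝓝[>] 0) atTop :=
    tendsto_inv_nhdsGT_zero.const_mul_atTop (by positivity)
  have hsmall : ∀ᶠ s : ℝ in 𝓝[>] 0, 2 * β * s ^ 2 < 1 := by
    have : Tendsto (fun s : ℝ => 2 * β * s ^ 2) (𝓝 0) (𝓝 (2 * β * 0 ^ 2)) :=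
      (by fun_prop : Continuous fun s : ℝ => 2 * β * s ^ 2).tendsto 0
    refine (this.mono_left nhdsWithin_le_nhds).eventually (Iio_mem_nhds (by simp))
  obtain ⟨s, ⟨h1, h2⟩, h3⟩ := ((hlim.eventually_gt_atTop ρ).and hsmall |>.and
    self_mem_nhdsWithin).exists
  have h3' : 0 < s := h3
  refine ⟨-s ^ 2, neg_lt_zero.2 (by positivity), h1.trans_le (le_trans (le_of_eq ?_) (key s h3' h2.le))⟩
  field_simp

theorem limitDensity_bijOn (hβ : 0 < β) : BijOn (limitDensity β) (Iio 0) (Ioi 0) := by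
  refine ⟨fun μ hμ => limitDensity_pos hβ hμ, (limitDensity_strictMonoOn hβ).injOn, fun ρ hρ => ?_⟩
  obtain ⟨a, ha, ha'⟩ := exists_limitDensity_lt hβ hρ
  obtain ⟨b, hb, hb'⟩ := exists_lt_limitDensity hβ ρ
  exact (convex_Iio 0).isPreconnected.intermediate_value ha hb (limitDensity_continuousOn hβ)
    ⟨ha'.le, hb'.le⟩

end Occupation

/-! ### The grand-canonical ensemble -/

section ChemicalPotential

variable {β : ℝ} {a : ℕ → ℝ}

/-- Only finitely many Boltzmann factors reach that of index `0`, so a largest one exists. This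
provides the ground state. -/
theorem exists_forall_le_of_summable_exp (hβ : 0 < β)
    (hs : Summable fun k => Real.exp (-β * a k)) : ∃ k₀, ∀ k, a k₀ ≤ a k := by
  have hfin : {k | Real.exp (-β * a 0) ≤ Real.exp (-β * a k)}.Finite := by
    have h := hs.tendsto_cofinite_zero.eventually (Iio_mem_nhds (Real.exp_pos (-β * a 0)))
    rw [eventually_cofinite] at h
    simpa using h
  obtain ⟨k₀, h1, h2⟩ := Set.exists_max_image _ (fun k => Real.exp (-β * a k)) hfin ⟨0, by simp⟩
  refine ⟨k₀, fun k => ?_⟩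
  have h3 : Real.exp (-β * a k) ≤ Real.exp (-β * a k₀) := by
    by_cases hk : Real.exp (-β * a 0) ≤ Real.exp (-β * a k)
    · exact h2 k hk
    · exact (not_le.1 hk).le.trans h1
  rw [Real.exp_le_exp] at h3
  nlinarith

theorem summable_occupation (hβ : 0 < β) (hs : Summable fun k => Real.exp (-β * a k)) {μ m : ℝ}
    (hμ : μ < m) (hm : ∀ k, m ≤ a k) : Summable fun k => occupation β μ (a k) :=
  Summable.of_nonneg_of_le (fun k => (occupation_pos hβ (hμ.trans_le (hm k))).le)
    (fun k => occupation_le_mul_exp hβ hμ (hm k)) (hs.mul_left _)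

/-- Below the ground-state energy the total occupation is continuous and strictly increasing. It
tends to `0` as `μ → -∞`, and near the ground-state energy a single term exceeds any bound. -/
theorem existsUnique_chemicalPotential (hβ : 0 < β) (hs : Summable fun k => Real.exp (-β * a k))
    {c : ℝ} (hc : 0 < c) :
    ∃! μ : ℝ, (∀ k, μ < a k) ∧ HasSum (fun k => occupation β μ (a k)) c := by
  obtain ⟨k₀, hk₀⟩ := exists_forall_le_of_summable_exp hβ hs
  set m := a k₀ with hm
  have hsum : ∀ {μ}, μ < m → Summable fun k => occupation β μ (a k) := fun hμ =>
    summable_occupation hβ hs hμ hk₀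
  set F : ℝ → ℝ := fun μ => ∑' k, occupation β μ (a k)
  have hmono : StrictMonoOn F (Iio m) := by
    intro μ hμ μ' hμ' h
    refine Summable.tsum_lt_tsum (i := 0)
      (fun k => occupation_le_occupation hβ (lt_of_lt_of_le hμ' (hk₀ k)) le_rfl h.le)
      (occupation_lt_occupation hβ (lt_of_lt_of_le hμ' (hk₀ 0)) h) (hsum hμ) (hsum hμ')
  have hcont : ContinuousOn F (Iio m) := by
    intro μ₀ hμ₀
    rw [mem_Iio] at hμ₀
    have h1 : (μ₀ + m) / 2 < m := by linarith
    have h2 : ContinuousOn F (Iic ((μ₀ + m) / 2)) := by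
      refine continuousOn_tsum (u := fun k => occupation β ((μ₀ + m) / 2) (a k)) (fun k => ?_)
        (hsum h1) fun k μ hμ => ?_
      · exact (continuousOn_occupation_left hβ (a k)).mono fun μ hμ =>
          (lt_of_le_of_lt hμ h1).trans_le (hk₀ k)
      · rw [Real.norm_eq_abs, abs_of_pos (occupation_pos hβ ((lt_of_le_of_lt hμ h1).trans_le (hk₀ k)))]
        exact occupation_le_occupation hβ (h1.trans_le (hk₀ k)) le_rfl hμ
    exact (h2.continuousAt (Iic_mem_nhds (by linarith))).continuousWithinAt
  have hlow : ∃ μ < m, F μ < c := by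
    set C := (1 - Real.exp (-β))⁻¹ * ∑' k, Real.exp (-β * a k)
    have hlim : Tendsto (fun μ => Real.exp (β * μ) * C) atBot (𝓝 0) := by
      have h1 : Tendsto (fun μ => Real.exp (β * μ)) atBot (𝓝 0) :=
        Real.tendsto_exp_atBot.comp (tendsto_id.const_mul_atBot hβ)
      simpa using h1.mul_const C
    obtain ⟨μ, h1, h2⟩ := ((hlim.eventually (Iio_mem_nhds hc)).and
      (eventually_le_atBot (m - 1))).exists
    have hμ : μ < m := by linarith
    refine ⟨μ, hμ, lt_of_le_of_lt ?_ h1⟩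
    have h3 : Real.exp (-β) < 1 := Real.exp_lt_one_iff.2 (by linarith)
    have h4 : Real.exp (-(β * (m - μ))) ≤ Real.exp (-β) := by
      refine Real.exp_le_exp.2 ?_
      nlinarith
    have h5 : (1 - Real.exp (-(β * (m - μ))))⁻¹ ≤ (1 - Real.exp (-β))⁻¹ :=
      inv_anti₀ (by linarith) (by linarith)
    calc F μ ≤ ∑' k, Real.exp (β * μ) / (1 - Real.exp (-(β * (m - μ)))) * Real.exp (-β * a k) :=
          (hsum hμ).tsum_le_tsum (fun k => occupation_le_mul_exp hβ hμ (hk₀ k)) (hs.mul_left _)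
      _ = Real.exp (β * μ) * ((1 - Real.exp (-(β * (m - μ))))⁻¹ * ∑' k, Real.exp (-β * a k)) := by
          rw [tsum_mul_left, div_eq_mul_inv, mul_assoc]
      _ ≤ _ := by
          have : 0 ≤ ∑' k, Real.exp (-β * a k) := tsum_nonneg fun k => (Real.exp_pos _).le
          exact mul_le_mul_of_nonneg_left (mul_le_mul_of_nonneg_right h5 this) (Real.exp_pos _).le
  have hhigh : ∃ μ < m, c ≤ F μ := by
    -- The witness solves `exp (β * (m - μ)) = 1 + 1 / c`, so that the ground state alone has
    -- occupation `c`.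
    have hlog : 0 < Real.log (1 + 1 / c) := Real.log_pos (by simp [hc])
    have hμ : m - Real.log (1 + 1 / c) / β < m := by
      have := div_pos hlog hβ
      linarith
    refine ⟨m - Real.log (1 + 1 / c) / β, hμ, ?_⟩
    have h1 : occupation β (m - Real.log (1 + 1 / c) / β) m = c := by
      rw [occupation, sub_sub_cancel, mul_div_cancel₀ _ hβ.ne', Real.exp_log (by positivity)]
      simp
    refine h1.ge.trans ?_
    exact (hsum hμ).le_tsum k₀ fun k _ => (occupation_pos hβ (hμ.trans_le (hk₀ k))).le
  obtain ⟨x, hx, hx'⟩ := hlow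
  obtain ⟨y, hy, hy'⟩ := hhigh
  obtain ⟨μ, hμ, hμc⟩ := (convex_Iio m).isPreconnected.intermediate_value hx hy hcont ⟨hx'.le, hy'⟩
  refine ⟨μ, ⟨fun k => lt_of_lt_of_le hμ (hk₀ k), hμc ▸ (hsum hμ).hasSum⟩, fun ν hν => ?_⟩
  exact hmono.injOn (hν.1 k₀) hμ ((hν.2.tsum_eq).trans hμc.symm)

end ChemicalPotential

/-! ### Thermodynamical limit of the grand-canonical ensemble -/

section GrandCanonical

variable {E : ℕ} {l : Fin E → ℝ} {bc : VertexConditions E} {β : ℝ}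

theorem totalLength_pos (hE : 0 < E) (hl : ∀ e, 0 < l e) : 0 < totalLength l :=
  Finset.sum_pos (fun e _ => hl e) ⟨⟨0, hE⟩, Finset.mem_univ _⟩

theorem totalLength_smul (η : ℝ) : totalLength (η • l) = η * totalLength l := by
  simp [totalLength, Finset.mul_sum]

theorem smul_length_pos (hl : ∀ e, 0 < l e) {η : ℝ} (hη : 0 < η) : ∀ e, 0 < (η • l) e :=
  fun e => mul_pos hη (hl e)

theorem Eigensystem.summable_exp (hl : ∀ e, 0 < l e) (hneg : bc.NegSemidef) (hβ : 0 < β)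
    (S : Eigensystem (laplacian bc l)) : Summable fun k => Real.exp (-β * S.val k) :=
  (S.summable_and_abs_tsum_sub_le hl hneg (g := fun x => Real.exp (-β * x))
    (fun x _ y _ hxy => Real.exp_le_exp.2 (by nlinarith)) (fun x _ => (Real.exp_pos _).le)
    (integrableOn_exp_neg_mul_sq hβ)).1

/-- Scaling keeps the number of edges, so the error `5 * E * g 0` is fixed and vanishes after
division by the length. -/
theorem tendsto_div_totalLength (hE : 0 < E) (hl : ∀ e, 0 < l e) (hneg : bc.NegSemidef)
    {η : ℕ → ℝ} (hη : ∀ n, 0 < η n) (hlim : Tendsto η atTop atTop)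
    (S : ∀ n, Eigensystem (laplacian bc (η n • l))) {g : ℝ → ℝ}
    (hg : AntitoneOn g (Ici 0)) (hg0 : ∀ x, 0 ≤ x → 0 ≤ g x)
    (hint : IntegrableOn (fun k : ℝ => g (k ^ 2)) (Ioi 0)) :
    Tendsto (fun n => (∑' k, g ((S n).val k)) / totalLength (η n • l)) atTop
      (𝓝 (1 / Real.pi * ∫ k in Ioi (0 : ℝ), g (k ^ 2))) := by
  have hL := totalLength_pos hE hl
  rw [tendsto_iff_norm_sub_tendsto_zero]
  have h0 : Tendsto (fun n => 5 * E * g 0 / (η n * totalLength l)) atTop (𝓝 0) :=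
    tendsto_const_nhds.div_atTop (hlim.atTop_mul_const hL)
  refine squeeze_zero (fun n => norm_nonneg _) (fun n => ?_) h0
  have h1 := ((S n).summable_and_abs_tsum_sub_le (smul_length_pos hl (hη n)) hneg hg hg0 hint).2
  have hpos : 0 < η n * totalLength l := mul_pos (hη n) hL
  rw [totalLength_smul] at h1 ⊢
  rw [Real.norm_eq_abs, le_div_iff₀ hpos]
  refine le_trans (le_of_eq ?_) h1
  nth_rewrite 2 [← abs_of_pos hpos]
  rw [← abs_mul]
  congr 1
  rw [sub_mul, div_mul_cancel₀ _ hpos.ne']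
  ring

theorem occupation_antitoneOn (hβ : 0 < β) {μ : ℝ} (hμ : μ < 0) :
    AntitoneOn (occupation β μ) (Ici 0) := fun _ hx _ _ hxy =>
  occupation_le_occupation hβ (lt_of_lt_of_le hμ hx) hxy le_rfl

theorem tendsto_density (hE : 0 < E) (hl : ∀ e, 0 < l e) (hneg : bc.NegSemidef) (hβ : 0 < β)
    {η : ℕ → ℝ} (hη : ∀ n, 0 < η n) (hlim : Tendsto η atTop atTop)
    (S : ∀ n, Eigensystem (laplacian bc (η n • l))) {μ : ℝ} (hμ : μ < 0) :
    (∀ n, Summable fun k => occupation β μ ((S n).val k)) ∧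
      Tendsto (fun n => (∑' k, occupation β μ ((S n).val k)) / totalLength (η n • l)) atTop
        (𝓝 (limitDensity β μ)) := by
  have h0 : ∀ x, 0 ≤ x → 0 ≤ occupation β μ x := fun x hx => (occupation_pos hβ (hμ.trans_le hx)).le
  exact ⟨fun n => ((S n).summable_and_abs_tsum_sub_le (smul_length_pos hl (hη n)) hneg
      (occupation_antitoneOn hβ hμ) h0 (integrableOn_occupation hβ hμ)).1,
    tendsto_div_totalLength hE hl hneg hη hlim S (occupation_antitoneOn hβ hμ) h0
      (integrableOn_occupation hβ hμ)⟩

/-- Take `ν < 0` with limiting density above `ρ`. Eventually the density at `ν` exceeds `ρ`, so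
monotonicity gives `μ n < ν`. All occupations are then at most `occupation β ν 0`, which does not
depend on `n`. -/
theorem eventually_occupation_div_lt (hE : 0 < E) (hl : ∀ e, 0 < l e) (hneg : bc.NegSemidef)
    (hβ : 0 < β) {η : ℕ → ℝ} (hη : ∀ n, 0 < η n) (hlim : Tendsto η atTop atTop)
    (S : ∀ n, Eigensystem (laplacian bc (η n • l))) {ρ : ℝ} {μ : ℕ → ℝ}
    (hμ : ∀ n, (∀ k, μ n < (S n).val k) ∧
      HasSum (fun k => occupation β (μ n) ((S n).val k)) (ρ * totalLength (η n • l)))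
    {ε : ℝ} (hε : 0 < ε) :
    ∀ᶠ n in atTop, ∀ k, occupation β (μ n) ((S n).val k) / totalLength (η n • l) < ε := by
  have hL := totalLength_pos hE hl
  obtain ⟨ν, hν, hνρ⟩ := exists_lt_limitDensity hβ ρ
  obtain ⟨h1, h2⟩ := tendsto_density hE hl hneg hβ hη hlim S hν
  have h3 : Tendsto (fun n => occupation β ν 0 / totalLength (η n • l)) atTop (𝓝 0) := by
    simp_rw [totalLength_smul]
    exact tendsto_const_nhds.div_atTop (hlim.atTop_mul_const hL)
  filter_upwards [h2.eventually (Ioi_mem_nhds hνρ), h3.eventually (Iio_mem_nhds hε)] with n h4 h5 k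
  have hpos : 0 < totalLength (η n • l) := totalLength_pos hE (smul_length_pos hl (hη n))
  have hval := (S n).val_nonneg (smul_length_pos hl (hη n)) hneg
  have h6 : μ n < ν := by
    by_contra! h
    have h7 : ∑' k, occupation β ν ((S n).val k) ≤ ρ * totalLength (η n • l) := by
      rw [← (hμ n).2.tsum_eq]
      exact (h1 n).tsum_le_tsum (fun k => occupation_le_occupation hβ ((hμ n).1 k) le_rfl h)
        (hμ n).2.summable
    have h8 := (lt_div_iff₀ hpos).1 h4
    linarith
  refine lt_of_le_of_lt ?_ h5
  gcongr
  exact occupation_le_occupation hβ hν (hval k) h6.le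

end GrandCanonical

/-! ### Elementary tensors -/

section Tensor

variable {E : ℕ} {l : Fin E → ℝ}

theorem tensor_ae {N : ℕ} (φ : Fin N → L2 l) :
    ∀ᵐ x ∂Measure.pi fun _ : Fin N => edgeMeasure l, tensor φ x = ∏ j, φ j (x j) :=
  (memLp_prod l φ).coeFn_toLp

theorem tensorCons_ae {N : ℕ} (φ : L2 l) (Ψ : L2N l N) :
    ∀ᵐ x ∂Measure.pi fun _ : Fin (N + 1) => edgeMeasure l,
      tensorCons φ Ψ x = φ (x 0) * Ψ fun i => x i.succ :=
  (memLp_cons l φ Ψ).coeFn_toLp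

theorem quasiMeasurePreserving_tail {N : ℕ} :
    Measure.QuasiMeasurePreserving (fun (x : Fin (N + 1) → Fin E × ℝ) (i : Fin N) => x i.succ)
      (Measure.pi fun _ : Fin (N + 1) => edgeMeasure l)
      (Measure.pi fun _ : Fin N => edgeMeasure l) :=
  Measure.quasiMeasurePreserving_snd.comp
    (measurePreserving_piFinSuccAbove (fun _ : Fin (N + 1) => edgeMeasure l) 0).quasiMeasurePreserving

theorem inner_tensor {N : ℕ} (φ ψ : Fin N → L2 l) :
    ⟪tensor φ, tensor ψ⟫_ℂ = ∏ j, ⟪φ j, ψ j⟫_ℂ := by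
  simp_rw [L2.inner_def]
  rw [← integral_fintype_prod_eq_prod (fun j x => ⟪φ j x, ψ j x⟫_ℂ)]
  refine integral_congr_ae ?_
  filter_upwards [tensor_ae φ, tensor_ae ψ] with x h1 h2
  rw [h1, h2]
  simp [RCLike.inner_apply, Finset.prod_mul_distrib]

theorem tensor_update_smul {N : ℕ} (φ : Fin N → L2 l) (j : Fin N) (c : ℂ) :
    tensor (Function.update φ j (c • φ j)) = c • tensor φ := by
  refine Lp.ext ?_
  have h : ∀ᵐ x ∂Measure.pi fun _ : Fin N => edgeMeasure l,
      (c • φ j : L2 l) (x j) = c * φ j (x j) :=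
    (Measure.quasiMeasurePreserving_eval (fun _ : Fin N => edgeMeasure l) j).ae
      (Lp.coeFn_smul c (φ j))
  filter_upwards [tensor_ae (Function.update φ j (c • φ j)), tensor_ae φ, h,
    Lp.coeFn_smul c (tensor φ)] with x h1 h2 h3 h4
  rw [h1, h4, Pi.smul_apply, h2, smul_eq_mul, ← Finset.mul_prod_erase _ _ (Finset.mem_univ j),
    ← Finset.mul_prod_erase _ (fun i => φ i (x i)) (Finset.mem_univ j), Function.update_self, h3,
    mul_assoc]
  congr 2
  refine Finset.prod_congr rfl fun i hi => ?_
  rw [Function.update_of_ne (Finset.ne_of_mem_erase hi)]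

theorem tensorCons_tensor {N : ℕ} (φ : L2 l) (ψ : Fin N → L2 l) :
    tensorCons φ (tensor ψ) = tensor (Fin.cons φ ψ : Fin (N + 1) → L2 l) := by
  refine Lp.ext ?_
  filter_upwards [tensorCons_ae φ (tensor ψ), tensor_ae (Fin.cons φ ψ : Fin (N + 1) → L2 l),
    quasiMeasurePreserving_tail.ae (tensor_ae ψ)] with x h1 h2 h3
  rw [h1, h2, h3, Fin.prod_univ_succ]
  simp

theorem inner_tensorCons {N : ℕ} (φ φ' : L2 l) (Ψ Ψ' : L2N l N) :
    ⟪tensorCons φ Ψ, tensorCons φ' Ψ'⟫_ℂ = ⟪φ, φ'⟫_ℂ * ⟪Ψ, Ψ'⟫_ℂ := by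
  have hp := measurePreserving_piFinSuccAbove (fun _ : Fin (N + 1) => edgeMeasure l) 0
  have h1 : ∀ᵐ x ∂Measure.pi fun _ : Fin (N + 1) => edgeMeasure l,
      ⟪tensorCons φ Ψ x, tensorCons φ' Ψ' x⟫_ℂ =
        (fun z : (Fin E × ℝ) × (Fin N → Fin E × ℝ) =>
          ⟪φ z.1, φ' z.1⟫_ℂ * ⟪Ψ z.2, Ψ' z.2⟫_ℂ)
          (MeasurableEquiv.piFinSuccAbove (fun _ : Fin (N + 1) => Fin E × ℝ) 0 x) := by
    filter_upwards [tensorCons_ae φ Ψ, tensorCons_ae φ' Ψ'] with x h1 h2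
    rw [h1, h2]
    have h3 : MeasurableEquiv.piFinSuccAbove (fun _ : Fin (N + 1) => Fin E × ℝ) 0 x =
      (x 0, fun i => x i.succ) := rfl
    rw [h3]
    simp only [RCLike.inner_apply, map_mul]
    ring
  rw [L2.inner_def, integral_congr_ae h1]
  refine (hp.integral_comp' (fun z : (Fin E × ℝ) × (Fin N → Fin E × ℝ) =>
    ⟪φ z.1, φ' z.1⟫_ℂ * ⟪Ψ z.2, Ψ' z.2⟫_ℂ)).trans ?_
  rw [L2.inner_def, L2.inner_def]
  exact integral_prod_mul (L := ℂ) (fun x => ⟪φ x, φ' x⟫_ℂ) fun y => ⟪Ψ y, Ψ' y⟫_ℂ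

theorem norm_tensorCons {N : ℕ} (φ : L2 l) (Ψ : L2N l N) : ‖tensorCons φ Ψ‖ = ‖φ‖ * ‖Ψ‖ := by
  have h := inner_tensorCons φ φ Ψ Ψ
  simp only [inner_self_eq_norm_sq_to_K] at h
  norm_cast at h
  rw [← mul_pow] at h
  exact (pow_left_inj₀ (norm_nonneg _) (by positivity) two_ne_zero).1 (by exact_mod_cast h)

theorem tensorCons_add_right {N : ℕ} (φ : L2 l) (Ψ Ψ' : L2N l N) :
    tensorCons φ (Ψ + Ψ') = tensorCons φ Ψ + tensorCons φ Ψ' := by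
  refine Lp.ext ?_
  filter_upwards [tensorCons_ae φ (Ψ + Ψ'), tensorCons_ae φ Ψ, tensorCons_ae φ Ψ',
    quasiMeasurePreserving_tail.ae (Lp.coeFn_add Ψ Ψ'),
    Lp.coeFn_add (tensorCons φ Ψ) (tensorCons φ Ψ')] with x h1 h2 h3 h4 h5
  rw [h1, h4, h5, Pi.add_apply, Pi.add_apply, h2, h3, mul_add]

theorem tensorCons_smul_right {N : ℕ} (c : ℂ) (φ : L2 l) (Ψ : L2N l N) :
    tensorCons φ (c • Ψ) = c • tensorCons φ Ψ := by
  refine Lp.ext ?_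
  filter_upwards [tensorCons_ae φ (c • Ψ), tensorCons_ae φ Ψ,
    quasiMeasurePreserving_tail.ae (Lp.coeFn_smul c Ψ), Lp.coeFn_smul c (tensorCons φ Ψ)]
    with x h1 h2 h3 h4
  rw [h1, h3, h4, Pi.smul_apply, Pi.smul_apply, h2, smul_eq_mul, smul_eq_mul, mul_left_comm]

theorem quasiMeasurePreserving_head {N : ℕ} :
    Measure.QuasiMeasurePreserving (fun (x : Fin (N + 1) → Fin E × ℝ) => x 0)
      (Measure.pi fun _ : Fin (N + 1) => edgeMeasure l) (edgeMeasure l) :=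
  Measure.quasiMeasurePreserving_eval (fun _ : Fin (N + 1) => edgeMeasure l) 0

theorem tensorCons_add_left {N : ℕ} (φ φ' : L2 l) (Ψ : L2N l N) :
    tensorCons (φ + φ') Ψ = tensorCons φ Ψ + tensorCons φ' Ψ := by
  refine Lp.ext ?_
  filter_upwards [tensorCons_ae (φ + φ') Ψ, tensorCons_ae φ Ψ, tensorCons_ae φ' Ψ,
    quasiMeasurePreserving_head.ae (Lp.coeFn_add φ φ'),
    Lp.coeFn_add (tensorCons φ Ψ) (tensorCons φ' Ψ)] with x h1 h2 h3 h4 h5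
  rw [h1, h4, h5, Pi.add_apply, Pi.add_apply, h2, h3, add_mul]

theorem tensorCons_smul_left {N : ℕ} (c : ℂ) (φ : L2 l) (Ψ : L2N l N) :
    tensorCons (c • φ) Ψ = c • tensorCons φ Ψ := by
  refine Lp.ext ?_
  filter_upwards [tensorCons_ae (c • φ) Ψ, tensorCons_ae φ Ψ,
    quasiMeasurePreserving_head.ae (Lp.coeFn_smul c φ), Lp.coeFn_smul c (tensorCons φ Ψ)]
    with x h1 h2 h3 h4
  rw [h1, h3, h4, Pi.smul_apply, Pi.smul_apply, h2, smul_eq_mul, smul_eq_mul, mul_assoc]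

/-- The tensor product of a one-particle and an `N`-particle vector, as a bilinear map. -/
def tensorConsL (l : Fin E → ℝ) (N : ℕ) : L2 l →L[ℂ] L2N l N →L[ℂ] L2N l (N + 1) :=
  LinearMap.mkContinuous₂
    (LinearMap.mk₂ ℂ tensorCons tensorCons_add_left tensorCons_smul_left tensorCons_add_right
      fun c φ Ψ => tensorCons_smul_right c φ Ψ) 1
    fun φ Ψ => by rw [LinearMap.mk₂_apply, norm_tensorCons, one_mul]

theorem tensorConsL_apply {N : ℕ} (φ : L2 l) (Ψ : L2N l N) :
    tensorConsL l N φ Ψ = tensorCons φ Ψ := rfl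

/-- Indicator functions as test vectors show that `F` has zero integral over every measurable
rectangle, and the π-λ theorem extends this to all measurable sets. -/
theorem eq_zero_of_inner_tensorCons {N : ℕ} {F : L2N l (N + 1)}
    (hF : ∀ φ Ψ, ⟪tensorCons φ Ψ, F⟫_ℂ = 0) : F = 0 := by
  set μ := edgeMeasure l
  set ν := Measure.pi fun _ : Fin N => edgeMeasure l
  set e := MeasurableEquiv.piFinSuccAbove (fun _ : Fin (N + 1) => Fin E × ℝ) 0
  have hp : MeasurePreserving e (Measure.pi fun _ : Fin (N + 1) => edgeMeasure l) (μ.prod ν) :=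
    measurePreserving_piFinSuccAbove (fun _ : Fin (N + 1) => edgeMeasure l) 0
  have hint : Integrable F (Measure.pi fun _ : Fin (N + 1) => edgeMeasure l) :=
    (Lp.memLp F).integrable (by norm_num)
  set f : (Fin E × ℝ) × (Fin N → Fin E × ℝ) → ℂ := fun z => F (e.symm z)
  have hf : Integrable f (μ.prod ν) := hp.symm.integrable_comp_emb
    e.symm.measurableEmbedding |>.2 hint
  have hrect : ∀ A B, MeasurableSet A → MeasurableSet B → ∫ z in A ×ˢ B, f z ∂(μ.prod ν) = 0 := by
    intro A B hA hB
    have h1 := hF (indicatorConstLp 2 hA (measure_ne_top _ _) (1 : ℂ))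
      (indicatorConstLp 2 hB (measure_ne_top ν _) (1 : ℂ))
    rw [L2.inner_def] at h1
    rw [← h1, ← integral_indicator (hA.prod hB), ← hp.integral_comp']
    refine integral_congr_ae ?_
    filter_upwards [tensorCons_ae (indicatorConstLp 2 hA (measure_ne_top _ _) (1 : ℂ))
      (indicatorConstLp 2 hB (measure_ne_top ν _) (1 : ℂ)),
      quasiMeasurePreserving_head.ae
        (indicatorConstLp_coeFn (hs := hA) (hμs := measure_ne_top μ _) (p := 2) (c := (1 : ℂ))),
      quasiMeasurePreserving_tail.ae
        (indicatorConstLp_coeFn (hs := hB) (hμs := measure_ne_top ν _) (p := 2) (c := (1 : ℂ)))]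
      with x h2 h3 h4
    have h5 : e x = (x 0, fun i => x i.succ) := rfl
    have h6 : f (e x) = F x := by simp [f]
    rw [h2, h3, h4]
    by_cases ha : x 0 ∈ A <;> by_cases hb : (fun i : Fin N => x i.succ) ∈ B
    · rw [indicator_of_mem (show e x ∈ A ×ˢ B by rw [h5]; exact ⟨ha, hb⟩), h6]
      simp [ha, hb]
    all_goals
      rw [indicator_of_notMem (show e x ∉ A ×ˢ B by rw [h5]; simp [ha, hb])]
      simp [ha, hb]
  have hall : ∀ s, MeasurableSet s → ∫ z in s, f z ∂(μ.prod ν) = 0 := by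
    intro s hs
    induction s, hs using MeasurableSpace.induction_on_inter generateFrom_prod.symm
      isPiSystem_prod with
    | empty => simp
    | basic t ht =>
      obtain ⟨A, hA, B, hB, rfl⟩ := ht
      exact hrect A B hA hB
    | compl t ht ih =>
      have h1 := integral_add_compl ht hf
      rw [ih, zero_add] at h1
      rw [h1, ← setIntegral_univ, ← univ_prod_univ]
      exact hrect _ _ MeasurableSet.univ MeasurableSet.univ
    | iUnion g hd hm ih =>
      rw [integral_iUnion hm hd hf.integrableOn]
      simp [ih]
  have hz : f =ᵐ[μ.prod ν] 0 :=
    hf.ae_eq_zero_of_forall_setIntegral_eq_zero fun s hs _ => hall s hs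
  refine Lp.ext ?_
  filter_upwards [hp.quasiMeasurePreserving.ae hz, Lp.coeFn_zero ℂ 2
    (Measure.pi fun _ : Fin (N + 1) => edgeMeasure l)] with x h1 h2
  rw [h2]
  simpa [f] using h1

theorem eq_zero_of_inner_tensor_zero {F : L2N l 0}
    (hF : ⟪tensor (fun j : Fin 0 => j.elim0 : Fin 0 → L2 l), F⟫_ℂ = 0) : F = 0 := by
  have h0 : (Measure.pi fun _ : Fin 0 => edgeMeasure l) =
      Measure.dirac (fun j : Fin 0 => j.elim0) := Measure.pi_of_empty _ _
  have h1 : ∀ᵐ x ∂Measure.pi fun _ : Fin 0 => edgeMeasure l,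
      ⟪tensor (fun j : Fin 0 => j.elim0 : Fin 0 → L2 l) x, F x⟫_ℂ = F x := by
    filter_upwards [tensor_ae (fun j : Fin 0 => j.elim0 : Fin 0 → L2 l)] with x hx
    rw [hx]; simp
  have h2 : ∀ f : (Fin 0 → Fin E × ℝ) → ℂ,
      ∫ x, f x ∂(Measure.pi fun _ : Fin 0 => edgeMeasure l) = f fun j => j.elim0 := fun f => by
    rw [h0, integral_dirac]
  rw [L2.inner_def, integral_congr_ae h1, h2] at hF
  refine Lp.ext ?_
  filter_upwards [Lp.coeFn_zero ℂ 2 (Measure.pi fun _ : Fin 0 => edgeMeasure l)] with x hx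
  rw [hx, Subsingleton.elim x (fun j : Fin 0 => j.elim0), hF]; rfl

variable (b : HilbertBasis ℕ ℂ (L2 l))

/-- The tensors of the vectors of a one-particle basis. -/
def basisTensor {N : ℕ} (m : Fin N → ℕ) : L2N l N := tensor fun j => b (m j)

theorem orthonormal_basisTensor (N : ℕ) : Orthonormal ℂ (basisTensor b (N := N)) := by
  rw [orthonormal_iff_ite]
  intro m m'
  rw [basisTensor, basisTensor, inner_tensor]
  simp_rw [orthonormal_iff_ite.1 b.orthonormal]
  by_cases h : m = m'
  · simp [h]
  · obtain ⟨j, hj⟩ := Function.ne_iff.1 h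
    rw [if_neg h]
    exact Finset.prod_eq_zero (Finset.mem_univ j) (if_neg hj)

theorem basisTensor_cons {N : ℕ} (i : ℕ) (m : Fin N → ℕ) :
    tensorCons (b i) (basisTensor b m) = basisTensor b (Fin.cons i m : Fin (N + 1) → ℕ) := by
  rw [basisTensor, tensorCons_tensor, basisTensor]
  congr 1
  funext j
  refine Fin.cases ?_ (fun j => ?_) j <;> simp

/-- The adjoint of `Ψ ↦ φ ⊗ Ψ`. -/
def contract {N : ℕ} (φ : L2 l) : L2N l (N + 1) →L[ℂ] L2N l N :=
  ContinuousLinearMap.adjoint (tensorConsL l N φ)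

theorem inner_contract {N : ℕ} (φ : L2 l) (Ψ : L2N l N) (F : L2N l (N + 1)) :
    ⟪Ψ, contract φ F⟫_ℂ = ⟪tensorCons φ Ψ, F⟫_ℂ :=
  ContinuousLinearMap.adjoint_inner_right _ _ _

/-- Induction on `N`: contracting the first particle with `b i` leaves a vector orthogonal to all
`N`-particle basis tensors, hence zero. Expanding an arbitrary `φ` in `b` then gives orthogonality
to all `φ ⊗ Ψ`. -/
theorem basisTensor_complete (N : ℕ) : ∀ {F : L2N l N},
    (∀ m, ⟪basisTensor b m, F⟫_ℂ = 0) → F = 0 := by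
  induction N with
  | zero =>
    intro F hF
    refine eq_zero_of_inner_tensor_zero ?_
    have := hF fun j => j.elim0
    rw [basisTensor] at this
    convert this using 3
  | succ N ih =>
    intro F hF
    have h1 : ∀ i, contract (b i) F = 0 := fun i => ih fun m => by
      rw [inner_contract, basisTensor_cons]
      exact hF _
    refine eq_zero_of_inner_tensorCons fun φ Ψ => ?_
    have h2 : ∀ i, ⟪tensorCons (b i) Ψ, F⟫_ℂ = 0 := fun i => by
      rw [← inner_contract, h1, inner_zero_right]
    have h3 : HasSum (fun i => ⟪F, b.repr φ i • tensorCons (b i) Ψ⟫_ℂ) ⟪F, tensorCons φ Ψ⟫_ℂ :=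
      ((b.hasSum_repr φ).mapL ((tensorConsL l N).flip Ψ)).mapL (innerSL ℂ F) |>.congr_fun
        fun i => by simp [tensorConsL_apply, inner_smul_right]
    have h4 : ∀ i, ⟪F, b.repr φ i • tensorCons (b i) Ψ⟫_ℂ = 0 := fun i => by
      rw [inner_smul_right, ← inner_conj_symm, h2 i]; simp
    simp_rw [h4] at h3
    rw [← inner_conj_symm, h3.unique hasSum_zero, map_zero]

/-- The Hilbert basis of the `N`-particle space. -/
def tensorBasis (N : ℕ) : HilbertBasis (Fin N → ℕ) ℂ (L2N l N) :=
  HilbertBasis.mkOfOrthogonalEqBot (orthonormal_basisTensor b N) (by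
    rw [eq_bot_iff]
    intro F hF
    exact basisTensor_complete b N fun i =>
      (Submodule.mem_orthogonal _ _).1 hF _ (Submodule.subset_span ⟨i, rfl⟩))

theorem tensorBasis_apply {N : ℕ} (m : Fin N → ℕ) : tensorBasis b N m = basisTensor b m := by
  simp [tensorBasis]

end Tensor

/-! ### Bosons -/

section Bosons

variable {E : ℕ} {l : Fin E → ℝ} {N : ℕ}

/-- The unitary operator that permutes the particles. -/
def permOp (l : Fin E → ℝ) (σ : Equiv.Perm (Fin N)) : L2N l N →ₗᵢ[ℂ] L2N l N :=
  Lp.compMeasurePreservingₗᵢ ℂ _ (measurePreserving_perm l σ)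

theorem permOp_ae (σ : Equiv.Perm (Fin N)) (Ψ : L2N l N) :
    ∀ᵐ x ∂Measure.pi fun _ : Fin N => edgeMeasure l, permOp l σ Ψ x = Ψ fun i => x (σ i) :=
  Lp.coeFn_compMeasurePreserving Ψ (measurePreserving_perm l σ)

theorem mem_bosonic_iff {Ψ : L2N l N} : Ψ ∈ bosonic l N ↔ ∀ σ, permOp l σ Ψ = Ψ := by
  simp only [bosonic, Submodule.mem_iInf, LinearMap.mem_eqLocus, LinearMap.id_apply]
  rfl

theorem isClosed_bosonic : IsClosed (bosonic l N : Set (L2N l N)) := by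
  have : (bosonic l N : Set (L2N l N)) = ⋂ σ, {Ψ | permOp l σ Ψ = Ψ} := by
    ext Ψ
    simp [mem_bosonic_iff]
  rw [this]
  exact isClosed_iInter fun σ => isClosed_eq (permOp l σ).continuous continuous_id

instance : CompleteSpace (bosonic l N) := isClosed_bosonic.completeSpace_coe

theorem permOp_tensor (σ : Equiv.Perm (Fin N)) (φ : Fin N → L2 l) :
    permOp l σ (tensor φ) = tensor fun j => φ (σ.symm j) := by
  refine Lp.ext ?_
  filter_upwards [permOp_ae σ (tensor φ), tensor_ae fun j => φ (σ.symm j),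
    (measurePreserving_perm l σ).quasiMeasurePreserving.ae (tensor_ae φ)] with x h1 h2 h3
  rw [h1, h2, h3, ← Equiv.prod_comp σ fun j => φ (σ.symm j) (x j)]
  simp only [Equiv.symm_apply_apply]

theorem permOp_permOp (σ τ : Equiv.Perm (Fin N)) (Ψ : L2N l N) :
    permOp l σ (permOp l τ Ψ) = permOp l (σ * τ) Ψ := by
  refine Lp.ext ?_
  filter_upwards [permOp_ae σ (permOp l τ Ψ), permOp_ae (σ * τ) Ψ,
    (measurePreserving_perm l σ).quasiMeasurePreserving.ae (permOp_ae τ Ψ)] with x h1 h2 h3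
  rw [h1, h2, h3]
  rfl

/-- The sum over all permutations of the particles. -/
def symmetrize (Ψ : L2N l N) : L2N l N := ∑ σ : Equiv.Perm (Fin N), permOp l σ Ψ

theorem symmetrize_mem (Ψ : L2N l N) : symmetrize Ψ ∈ bosonic l N := by
  rw [mem_bosonic_iff]
  intro τ
  simp only [symmetrize, map_sum, permOp_permOp]
  exact Equiv.sum_comp (Equiv.mulLeft τ) fun σ => permOp l σ Ψ

theorem inner_symmetrize {Ψ : L2N l N} (hΨ : Ψ ∈ bosonic l N) (Φ : L2N l N) :
    ⟪symmetrize Φ, Ψ⟫_ℂ = N.factorial * ⟪Φ, Ψ⟫_ℂ := by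
  have h : ∀ σ, ⟪permOp l σ Φ, Ψ⟫_ℂ = ⟪Φ, Ψ⟫_ℂ := fun σ => by
    nth_rewrite 1 [← mem_bosonic_iff.1 hΨ σ]
    exact (permOp l σ).inner_map_map _ _
  rw [symmetrize, sum_inner]
  simp [h, Fintype.card_perm]

variable (b : HilbertBasis ℕ ℂ (L2 l))

theorem permOp_basisTensor (σ : Equiv.Perm (Fin N)) (m : Fin N → ℕ) :
    permOp l σ (basisTensor b m) = basisTensor b (m ∘ σ.symm) :=
  permOp_tensor _ _

theorem inner_basisTensor_comp {Ψ : L2N l N} (hΨ : Ψ ∈ bosonic l N) (m : Fin N → ℕ)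
    (σ : Equiv.Perm (Fin N)) : ⟪basisTensor b (m ∘ σ), Ψ⟫_ℂ = ⟪basisTensor b m, Ψ⟫_ℂ := by
  have h := permOp_basisTensor b σ.symm m
  rw [Equiv.symm_symm] at h
  rw [← h]
  nth_rewrite 1 [← mem_bosonic_iff.1 hΨ σ.symm]
  exact (permOp l σ.symm).inner_map_map _ _

/-- The occupation numbers of an assignment of states to the particles. -/
def config (m : Fin N → ℕ) : Sym ℕ N := ⟨Finset.univ.val.map m, by simp⟩

theorem config_comp (m : Fin N → ℕ) (σ : Equiv.Perm (Fin N)) : config (m ∘ σ) = config m := by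
  refine Subtype.ext ?_
  change Multiset.map (m ∘ σ) Finset.univ.val = Multiset.map m Finset.univ.val
  rw [← Multiset.map_map]
  congr 1
  exact congrArg Finset.val (Finset.map_univ_equiv σ)

theorem count_config (m : Fin N → ℕ) (i : ℕ) :
    Multiset.count i (config m : Multiset ℕ) = Fintype.card {j // m j = i} := by
  rw [Fintype.card_subtype]
  change Multiset.count i (Multiset.map m Finset.univ.val) = _
  rw [Multiset.count_map, ← Finset.filter_val, Finset.card_val]
  congr 1
  ext j; simp [eq_comm]

/-- Equal occupation numbers give bijections between the fibres of the two assignments, which glue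
to a permutation. -/
theorem exists_perm_of_config_eq {m m' : Fin N → ℕ} (h : config m = config m') :
    ∃ σ : Equiv.Perm (Fin N), m = m' ∘ σ := by
  have hc : ∀ i, Nonempty ({j // m j = i} ≃ {j // m' j = i}) := fun i =>
    Fintype.card_eq.1 (by rw [← count_config, ← count_config, h])
  refine ⟨Equiv.ofFiberEquiv fun i => (hc i).some, funext fun j => ?_⟩
  exact (Equiv.ofFiberEquiv_map (fun i => (hc i).some) j).symm

theorem config_surjective : Function.Surjective (config (N := N)) := by
  rintro ⟨s, hs⟩
  subst hs
  refine ⟨fun j => s.toList.get (j.cast (by simp)), Subtype.ext ?_⟩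
  change Multiset.map _ (Finset.univ : Finset (Fin (Multiset.card s))).val = s
  conv_rhs => rw [← s.coe_toList]
  have h1 : (Finset.univ : Finset (Fin (Multiset.card s))).val =
      (List.finRange (Multiset.card s) : Multiset (Fin (Multiset.card s))) := rfl
  rw [h1, Multiset.map_coe]
  congr 1
  refine List.ext_getElem (by simp) fun n h2 h3 => ?_
  simp

/-- A choice of an assignment with given occupation numbers. -/
def assignment (s : Sym ℕ N) : Fin N → ℕ := Function.surjInv config_surjective s

theorem config_assignment (s : Sym ℕ N) : config (assignment s) = s :=
  Function.surjInv_eq config_surjective s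

/-- The symmetrised basis tensor with given occupation numbers, before normalisation. -/
def symTensor (s : Sym ℕ N) : L2N l N := symmetrize (basisTensor b (assignment s))

theorem inner_basisTensor_symTensor_of_ne {m : Fin N → ℕ} {s : Sym ℕ N} (h : config m ≠ s) :
    ⟪basisTensor b m, symTensor b s⟫_ℂ = 0 := by
  rw [symTensor, symmetrize, inner_sum]
  refine Finset.sum_eq_zero fun σ _ => ?_
  rw [permOp_basisTensor]
  refine (orthonormal_basisTensor b N).2 fun h2 => h ?_
  rw [h2, config_comp, config_assignment]

/-- The overlap with the unsymmetrised tensor counts the permutations that fix the assignment, among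
them the identity. -/
theorem symTensor_ne_zero (s : Sym ℕ N) : symTensor b s ≠ 0 := by
  intro h
  have h1 : ⟪basisTensor b (assignment s), symTensor b s⟫_ℂ = 0 := by rw [h, inner_zero_right]
  rw [symTensor, symmetrize, inner_sum] at h1
  simp_rw [permOp_basisTensor, orthonormal_iff_ite.1 (orthonormal_basisTensor b N)] at h1
  rw [Finset.sum_boole, Nat.cast_eq_zero, Finset.card_eq_zero,
    Finset.filter_eq_empty_iff] at h1
  exact h1 (Finset.mem_univ 1) (by funext j; rfl)

/-- The normalised symmetrised basis tensor with given occupation numbers. -/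
def symVec (s : Sym ℕ N) : L2N l N := ((‖symTensor b s‖⁻¹ : ℝ) : ℂ) • symTensor b s

theorem symVec_mem (s : Sym ℕ N) : symVec b s ∈ bosonic l N :=
  Submodule.smul_mem _ _ (symmetrize_mem _)

theorem norm_symVec (s : Sym ℕ N) : ‖symVec b s‖ = 1 := by
  rw [symVec, norm_smul, Complex.norm_real, norm_inv, norm_norm,
    inv_mul_cancel₀ (norm_ne_zero_iff.2 (symTensor_ne_zero b s))]

theorem inner_basisTensor_symVec_of_ne {m : Fin N → ℕ} {s : Sym ℕ N} (h : config m ≠ s) :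
    ⟪basisTensor b m, symVec b s⟫_ℂ = 0 := by
  rw [symVec, inner_smul_right, inner_basisTensor_symTensor_of_ne b h, mul_zero]

theorem inner_basisTensor_eq_of_config_eq {Ψ : L2N l N} (hΨ : Ψ ∈ bosonic l N) {m m' : Fin N → ℕ}
    (h : config m = config m') : ⟪basisTensor b m, Ψ⟫_ℂ = ⟪basisTensor b m', Ψ⟫_ℂ := by
  obtain ⟨σ, rfl⟩ := exists_perm_of_config_eq h
  exact inner_basisTensor_comp b hΨ m' σ

/-- Different occupation numbers involve disjoint sets of basis tensors. -/
theorem orthonormal_symVec : Orthonormal ℂ (fun s => (⟨symVec b s, symVec_mem b s⟩ : bosonic l N)) := by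
  refine ⟨fun s => norm_symVec b s, fun s s' hs => ?_⟩
  change ⟪symVec b s, symVec b s'⟫_ℂ = 0
  have h := (tensorBasis b N).hasSum_inner_mul_inner (symVec b s) (symVec b s')
  refine h.unique ?_
  convert hasSum_zero with m
  rw [tensorBasis_apply]
  by_cases hm : config m = s
  · rw [inner_basisTensor_symVec_of_ne b (s := s') (by rw [hm]; exact hs), mul_zero]
  · rw [← inner_conj_symm, inner_basisTensor_symVec_of_ne b hm, map_zero, zero_mul]

theorem inner_symVec_eq_zero_iff {Ψ : L2N l N} (hΨ : Ψ ∈ bosonic l N) (s : Sym ℕ N) :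
    ⟪symVec b s, Ψ⟫_ℂ = 0 ↔ ⟪basisTensor b (assignment s), Ψ⟫_ℂ = 0 := by
  have h : (N.factorial : ℂ) ≠ 0 := by exact_mod_cast N.factorial_ne_zero
  have h2 : ((‖symTensor b s‖⁻¹ : ℝ) : ℂ) ≠ 0 := by
    exact_mod_cast inv_ne_zero (norm_ne_zero_iff.2 (symTensor_ne_zero b s))
  rw [symVec, inner_smul_left, Complex.conj_ofReal, symTensor, inner_symmetrize hΨ]
  rw [symTensor] at h2
  simp only [mul_eq_zero, h, h2, false_or]

/-- The Hilbert basis of the bosonic subspace. -/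
def symBasis (N : ℕ) : HilbertBasis (Sym ℕ N) ℂ (bosonic l N) :=
  HilbertBasis.mkOfOrthogonalEqBot (orthonormal_symVec b) (by
    rw [eq_bot_iff]
    intro Ψ hΨ
    have h0 : ∀ s, ⟪symVec b s, (Ψ : L2N l N)⟫_ℂ = 0 := fun s =>
      (Submodule.mem_orthogonal _ _).1 hΨ _ (Submodule.subset_span ⟨s, rfl⟩)
    refine Subtype.ext (basisTensor_complete b N fun m => ?_)
    rw [inner_basisTensor_eq_of_config_eq b Ψ.2 (config_assignment (config m)).symm]
    exact (inner_symVec_eq_zero_iff b Ψ.2 _).1 (h0 _))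

theorem symBasis_apply (s : Sym ℕ N) : (symBasis b N s : L2N l N) = symVec b s := by
  simp [symBasis]

end Bosons

/-! ### The free Laplacian of many particles -/

section FreeLaplacian

variable {E : ℕ} {l : Fin E → ℝ} {bc : VertexConditions E} {N : ℕ}
  (S : Eigensystem (laplacian bc l))

/-- The energy of a configuration of particles. -/
def energy (a : ℕ → ℝ) (s : Sym ℕ N) : ℝ := ((s : Multiset ℕ).map a).sum

theorem energy_config (a : ℕ → ℝ) (m : Fin N → ℕ) : energy a (config m) = ∑ j, a (m j) := by
  change (Multiset.map a (Multiset.map m Finset.univ.val)).sum = _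
  rw [Multiset.map_map]
  rfl

theorem basisTensor_mem_freeLaplacian (m : Fin N → ℕ) :
    (basisTensor S.vec m, ((energy S.val (config m) : ℝ) : ℂ) • basisTensor S.vec m) ∈
      freeLaplacian bc l N := by
  refine Submodule.le_topologicalClosure _ (Submodule.subset_span
    ⟨fun j => (S.vec (m j), (S.val (m j) : ℂ) • S.vec (m j)), fun j => S.eig (m j), ?_⟩)
  refine Prod.ext rfl ?_
  change _ = ∑ j, tensor (Function.update (fun i => S.vec (m i)) j ((S.val (m j) : ℂ) • S.vec (m j)))
  have h : ∀ j, tensor (Function.update (fun i => S.vec (m i)) j ((S.val (m j) : ℂ) • S.vec (m j)))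
      = (S.val (m j) : ℂ) • basisTensor S.vec m := fun j =>
    tensor_update_smul (fun i => S.vec (m i)) j (S.val (m j) : ℂ)
  simp_rw [h]
  rw [← Finset.sum_smul, energy_config]
  push_cast
  rfl

theorem symVec_mem_freeLaplacian (s : Sym ℕ N) :
    (symVec S.vec s, ((energy S.val s : ℝ) : ℂ) • symVec S.vec s) ∈ freeLaplacian bc l N := by
  have h1 : ∀ σ : Equiv.Perm (Fin N), (permOp l σ (basisTensor S.vec (assignment s)),
      ((energy S.val s : ℝ) : ℂ) • permOp l σ (basisTensor S.vec (assignment s))) ∈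
      freeLaplacian bc l N := by
    intro σ
    have := basisTensor_mem_freeLaplacian S (assignment s ∘ σ.symm)
    rwa [config_comp, config_assignment, ← permOp_basisTensor] at this
  have h2 := Submodule.smul_mem (freeLaplacian bc l N) ((‖symTensor S.vec s‖⁻¹ : ℝ) : ℂ)
    (Submodule.sum_mem _ fun σ (_ : σ ∈ Finset.univ) => h1 σ)
  convert h2 using 1
  refine Prod.ext ?_ ?_
  · rw [Prod.smul_fst, Prod.fst_sum]; rfl
  · rw [Prod.smul_snd, Prod.snd_sum, ← Finset.smul_sum, smul_comm]; rfl

/-- The identity is linear and closed in `p`, so it passes from elementary tensors, where it is the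
symmetry of `-Δ₁` in each factor, to the closure. It forces any eigenvector of the `N`-particle
Laplacian to overlap only with basis tensors of its own energy. -/
theorem inner_basisTensor_of_mem_freeLaplacian (hl : ∀ e, 0 < l e) (m : Fin N → ℕ)
    {p : L2N l N × L2N l N} (hp : p ∈ freeLaplacian bc l N) :
    ⟪basisTensor S.vec m, p.2⟫_ℂ = (energy S.val (config m) : ℝ) * ⟪basisTensor S.vec m, p.1⟫_ℂ := by
  let A : L2N l N × L2N l N →L[ℂ] ℂ :=
    (innerSL ℂ (basisTensor S.vec m)).comp (ContinuousLinearMap.snd ℂ _ _) -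
      ((energy S.val (config m) : ℝ) : ℂ) •
        (innerSL ℂ (basisTensor S.vec m)).comp (ContinuousLinearMap.fst ℂ _ _)
  suffices h : freeLaplacian bc l N ≤ LinearMap.ker (A : L2N l N × L2N l N →ₗ[ℂ] ℂ) by
    have h1 := LinearMap.mem_ker.1 (h hp)
    exact sub_eq_zero.1 (by simpa [A] using h1)
  refine Submodule.topologicalClosure_minimal _ (Submodule.span_le.2 ?_) A.isClosed_ker
  rintro _ ⟨p, hp, rfl⟩
  refine LinearMap.mem_ker.2 ?_
  change ⟪basisTensor S.vec m, ∑ j, tensor (Function.update (fun i => (p i).1) j (p j).2)⟫_ℂ -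
    ((energy S.val (config m) : ℝ) : ℂ) • ⟪basisTensor S.vec m, tensor fun i => (p i).1⟫_ℂ = 0
  rw [sub_eq_zero, inner_sum, energy_config]
  push_cast
  rw [smul_eq_mul, Finset.sum_mul]
  refine Finset.sum_congr rfl fun j _ => ?_
  rw [basisTensor, inner_tensor, inner_tensor, ← Finset.mul_prod_erase _ _ (Finset.mem_univ j),
    ← Finset.mul_prod_erase _ (fun i => ⟪S.vec (m i), (p i).1⟫_ℂ) (Finset.mem_univ j),
    Function.update_self]
  have h1 := laplacian_symm hl (S.eig (m j)) (hp j)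
  simp only [inner_smul_left, Complex.conj_ofReal] at h1
  rw [h1, mul_assoc]
  congr 2
  refine Finset.prod_congr rfl fun i hi => ?_
  rw [Function.update_of_ne (Finset.ne_of_mem_erase hi)]

theorem nonempty_eigensystem_bosonicLaplacian (S : Eigensystem (laplacian bc l))
    (hN : 0 < N) : Nonempty (Eigensystem (bosonicLaplacian bc l N)) := by
  -- All particles in one state: these configurations are distinct because there is at least one
  -- particle.
  have : Infinite (Sym ℕ N) := by
    refine Infinite.of_injective (fun n : ℕ => config fun _ : Fin N => n) fun n n' h => ?_
    obtain ⟨σ, hσ⟩ := exists_perm_of_config_eq h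
    exact congrFun hσ ⟨0, hN⟩
  have : Countable (Sym ℕ N) := (config_surjective (N := N)).countable
  obtain ⟨w, e, hw⟩ := exists_hilbertBasis_nat (symBasis S.vec N) (symBasis S.vec N)
  refine ⟨⟨w, fun n => energy S.val (e n), fun n => ?_⟩⟩
  change ((w n : L2N l N), (((energy S.val (e n) : ℝ) : ℂ) • w n : L2N l N)) ∈ freeLaplacian bc l N
  rw [hw, symBasis_apply]
  exact symVec_mem_freeLaplacian S (e n)

end FreeLaplacian

/-! ### The canonical ensemble of occupation numbers -/

section Canonical

variable {a : ℕ → ℝ} {β : ℝ}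

theorem summable_exp_sum (h : Summable fun i => Real.exp (-β * a i)) (N : ℕ) :
    Summable fun m : Fin N → ℕ => Real.exp (-β * ∑ j, a (m j)) := by
  induction N with
  | zero => exact (hasSum_fintype _).summable
  | succ N ih =>
    rw [← (Fin.consEquiv fun _ : Fin (N + 1) => ℕ).summable_iff]
    refine (h.mul_of_nonneg ih (fun _ => (Real.exp_pos _).le) fun _ => (Real.exp_pos _).le).congr
      fun p => ?_
    simp [Fin.consEquiv, Fin.sum_univ_succ, mul_add, Real.exp_add]

theorem summable_exp_energy (h : Summable fun i => Real.exp (-β * a i)) (N : ℕ) :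
    Summable fun s : Sym ℕ N => Real.exp (-β * energy a s) := by
  refine ((summable_exp_sum h N).comp_injective
    (Function.injective_surjInv config_surjective)).congr fun s => ?_
  change Real.exp (-β * ∑ j, a (assignment s j)) = _
  rw [← energy_config, config_assignment]

/-- The canonical partition function in terms of the one-particle energies. -/
def canonicalZ (a : ℕ → ℝ) (β : ℝ) (N : ℕ) : ℝ := ∑' s : Sym ℕ N, Real.exp (-β * energy a s)

/-- The canonical expectation of the occupation number of a one-particle state. -/
def meanOccupation (a : ℕ → ℝ) (β : ℝ) (N : ℕ) (i : ℕ) : ℝ :=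
  (∑' s : Sym ℕ N, (Multiset.count i (s : Multiset ℕ) : ℝ) * Real.exp (-β * energy a s)) /
    canonicalZ a β N

theorem canonicalZ_pos (h : Summable fun i => Real.exp (-β * a i)) (N : ℕ) :
    0 < canonicalZ a β N :=
  (summable_exp_energy h N).tsum_pos (fun _ => (Real.exp_pos _).le) (config fun _ => 0)
    (Real.exp_pos _)

/-- Adding `j` particles in state `i` is a bijection onto the configurations with at least `j`
particles there, and multiplies each weight by `exp (-β * a i) ^ j`. -/
theorem hasSum_ite_le_count (h : Summable fun i => Real.exp (-β * a i)) (N j i : ℕ) :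
    HasSum (fun s : Sym ℕ (N + j) =>
      if j ≤ Multiset.count i (s : Multiset ℕ) then Real.exp (-β * energy a s) else 0)
      (Real.exp (-β * a i) ^ j * canonicalZ a β N) := by
  let g : Sym ℕ N → Sym ℕ (N + j) := fun s =>
    ⟨(s : Multiset ℕ) + Multiset.replicate j i, by rw [Multiset.card_add]; simp⟩
  have hg : Function.Injective g := fun s s' hs =>
    Subtype.ext (add_right_cancel (congrArg Subtype.val hs))
  have hrange : ∀ s ∉ range g, (if j ≤ Multiset.count i (s : Multiset ℕ) then
      Real.exp (-β * energy a s) else 0) = 0 := by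
    refine fun s hs => if_neg fun hj => hs ?_
    have h1 := Multiset.le_count_iff_replicate_le.1 hj
    refine ⟨⟨(s : Multiset ℕ) - Multiset.replicate j i, ?_⟩, Subtype.ext (tsub_add_cancel_of_le h1)⟩
    have h2 : Multiset.card (s : Multiset ℕ) = N + j := s.2
    rw [Multiset.card_sub h1, Multiset.card_replicate, h2, Nat.add_sub_cancel]
  rw [← hg.hasSum_iff hrange]
  refine ((summable_exp_energy h N).hasSum.mul_left _).congr_fun fun s => ?_
  have h1 : ((g s : Sym ℕ (N + j)) : Multiset ℕ) = (s : Multiset ℕ) + Multiset.replicate j i := rfl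
  have h2 : energy a (g s) = energy a s + j * a i := by
    rw [energy, energy, h1]; simp
  simp only [Function.comp_apply]
  rw [if_pos (by rw [h1]; simp), h2, mul_add, Real.exp_add, ← Real.exp_nat_mul, mul_comm]
  congr 2
  ring

theorem summable_count_mul_exp (h : Summable fun i => Real.exp (-β * a i)) (N i : ℕ) :
    Summable fun s : Sym ℕ N =>
      (Multiset.count i (s : Multiset ℕ) : ℝ) * Real.exp (-β * energy a s) := by
  refine Summable.of_nonneg_of_le (fun s => by positivity) (fun s => ?_)
    ((summable_exp_energy h N).mul_left (N : ℝ))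
  have : Multiset.count i (s : Multiset ℕ) ≤ N := (Multiset.count_le_card _ _).trans s.2.le
  gcongr

/-- Layer-cake formula: a number `n ≤ N` is the number of `j ∈ [1, N]` with `j ≤ n`, and the `j`-th
term is the probability of at least `j` particles in state `i`. -/
theorem meanOccupation_eq (h : Summable fun i => Real.exp (-β * a i)) (N i : ℕ) :
    meanOccupation a β N i = ∑ j ∈ Finset.Icc 1 N,
      Real.exp (-β * a i) ^ j * (canonicalZ a β (N - j) / canonicalZ a β N) := by
  simp_rw [meanOccupation, ← mul_div_assoc]
  rw [← Finset.sum_div]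
  congr 1
  have h1 : ∀ j ∈ Finset.Icc 1 N, HasSum (fun s : Sym ℕ N =>
      if j ≤ Multiset.count i (s : Multiset ℕ) then Real.exp (-β * energy a s) else 0)
      (Real.exp (-β * a i) ^ j * canonicalZ a β (N - j)) := by
    intro j hj
    have := hasSum_ite_le_count h (N - j) j i
    rwa [Nat.sub_add_cancel (Finset.mem_Icc.1 hj).2] at this
  rw [← (hasSum_sum h1).tsum_eq]
  refine tsum_congr fun s => ?_
  have h2 : Multiset.count i (s : Multiset ℕ) ≤ N := (Multiset.count_le_card _ _).trans s.2.le
  rw [← Finset.sum_filter, Finset.sum_const, nsmul_eq_mul]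
  congr 2
  have h3 : (Finset.Icc 1 N).filter (fun j => j ≤ Multiset.count i (s : Multiset ℕ)) =
      Finset.Icc 1 (Multiset.count i (s : Multiset ℕ)) := by
    ext j
    simp only [Finset.mem_filter, Finset.mem_Icc]
    omega
  rw [h3]; simp

/-- Both sides are unnormalised tail probabilities of the same occupation number. -/
theorem exp_pow_mul_canonicalZ_le (h : Summable fun i => Real.exp (-β * a i)) (i : ℕ) {N j k : ℕ}
    (hjk : j ≤ k) (hk : k ≤ N) :
    Real.exp (-β * a i) ^ k * canonicalZ a β (N - k) ≤
      Real.exp (-β * a i) ^ j * canonicalZ a β (N - j) := by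
  have h1 := hasSum_ite_le_count h (N - j) j i
  have h2 := hasSum_ite_le_count h (N - k) k i
  rw [Nat.sub_add_cancel (hjk.trans hk)] at h1
  rw [Nat.sub_add_cancel hk] at h2
  refine hasSum_le (fun s => ?_) h2 h1
  split_ifs with h3 h4
  · exact le_rfl
  · exact absurd (hjk.trans h3) h4
  · exact (Real.exp_pos _).le
  · exact le_rfl

theorem sum_meanOccupation_le (h : Summable fun i => Real.exp (-β * a i)) (N : ℕ) (F : Finset ℕ) :
    ∑ i ∈ F, meanOccupation a β N i ≤ N := by
  simp_rw [meanOccupation]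
  rw [← Finset.sum_div, div_le_iff₀ (canonicalZ_pos h N),
    ← Summable.tsum_finsetSum fun i _ => summable_count_mul_exp h N i, canonicalZ, ← tsum_mul_left]
  refine Summable.tsum_le_tsum (fun s => ?_) (summable_sum fun i _ => summable_count_mul_exp h N i)
    ((summable_exp_energy h N).mul_left _)
  rw [← Finset.sum_mul]
  refine mul_le_mul_of_nonneg_right ?_ (Real.exp_pos _).le
  have h1 : ∑ i ∈ F, Multiset.count i (s : Multiset ℕ) ≤ N := by
    refine (Finset.sum_le_sum_of_subset
      (Finset.subset_union_left (s₂ := (s : Multiset ℕ).toFinset))).trans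
      ((Multiset.sum_count_eq_card fun i hi => ?_).le.trans s.2.le)
    exact Finset.mem_union_right _ (Multiset.mem_toFinset.2 hi)
  exact_mod_cast h1

theorem meanOccupation_le_of_le (h : Summable fun i => Real.exp (-β * a i)) (hβ : 0 < β) (N : ℕ)
    {i j : ℕ} (hij : a i ≤ a j) : meanOccupation a β N j ≤ meanOccupation a β N i := by
  rw [meanOccupation_eq h, meanOccupation_eq h]
  refine Finset.sum_le_sum fun k _ => mul_le_mul_of_nonneg_right ?_
    (div_pos (canonicalZ_pos h _) (canonicalZ_pos h _)).le
  refine pow_le_pow_left₀ (Real.exp_pos _).le (Real.exp_le_exp.2 ?_) _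
  nlinarith

theorem meanOccupation_nonneg (i N : ℕ) : 0 ≤ meanOccupation a β N i :=
  div_nonneg (tsum_nonneg fun _ => by positivity) (tsum_nonneg fun _ => (Real.exp_pos _).le)

/-- A macroscopically occupied state forces the gas to contain many particles. -/
theorem mul_sum_tsum_exp_le (ha : ∀ i, 0 ≤ a i) (hβ : 0 < β)
    (h : Summable fun i => Real.exp (-β * a i)) {N J : ℕ} (hN : 0 < N) {c : ℝ}
    (hJ : J ≤ c / 2 * N) {i₀ : ℕ} (hc : c * N ≤ meanOccupation a β N i₀) :
    c / 2 * ∑ j ∈ Finset.Icc 1 J, ∑' i, Real.exp (-(j * β) * a i) ≤ N := by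
  have hN' : (0 : ℝ) < N := by exact_mod_cast hN
  have hZ := canonicalZ_pos h
  set p : ℕ → ℝ := fun j => Real.exp (-β * a i₀) ^ j * (canonicalZ a β (N - j) / canonicalZ a β N)
  have hp : ∀ {j k}, j ≤ k → k ≤ N → p k ≤ p j := fun {j k} hjk hk => by
    simp only [p, ← mul_div_assoc]
    exact div_le_div_of_nonneg_right (exp_pow_mul_canonicalZ_le h i₀ hjk hk) (hZ N).le
  have hp1 : ∀ j ≤ N, p j ≤ 1 := fun j hj => (hp (Nat.zero_le j) hj).trans
    (by simp [p, (hZ N).ne'])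
  have hp0 : ∀ j, 0 ≤ p j := fun j => mul_nonneg (by positivity) (div_pos (hZ _) (hZ _)).le
  have hm : meanOccupation a β N i₀ = ∑ j ∈ Finset.Icc 1 N, p j := meanOccupation_eq h N i₀
  have hc1 : c ≤ 1 := by
    have h1 : ∑ j ∈ Finset.Icc 1 N, p j ≤ ∑ j ∈ Finset.Icc 1 N, 1 :=
      Finset.sum_le_sum fun j hj => hp1 j (Finset.mem_Icc.1 hj).2
    simp only [Finset.sum_const, Nat.card_Icc, nsmul_eq_mul, mul_one, Nat.add_sub_cancel] at h1
    exact le_of_mul_le_mul_right (by linarith) hN'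
  have hJN : J ≤ N := by
    have : (J : ℝ) ≤ N := hJ.trans (by nlinarith)
    exact_mod_cast this
  -- Bounding `p j` by `1` for `j ≤ J` and by `p J` beyond gives `c N ≤ J + N * p J`, and `J ≤ c N /
  -- 2`.
  have hpJ : c / 2 ≤ p J := by
    have h1 : ∑ j ∈ Finset.Icc 1 N, p j ≤ ∑ j ∈ Finset.Icc 1 N, ((if j ≤ J then 1 else 0) + p J) := by
      refine Finset.sum_le_sum fun j hj => ?_
      split_ifs with hjJ
      · linarith [hp1 j (Finset.mem_Icc.1 hj).2, hp0 J]
      · linarith [hp (le_of_not_ge hjJ) (Finset.mem_Icc.1 hj).2]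
    have h2 : (Finset.Icc 1 N).filter (fun j => j ≤ J) = Finset.Icc 1 J := by
      ext j
      simp only [Finset.mem_filter, Finset.mem_Icc]
      omega
    rw [Finset.sum_add_distrib, ← Finset.sum_filter, h2] at h1
    simp only [Finset.sum_const, Nat.card_Icc, nsmul_eq_mul, mul_one, Nat.add_sub_cancel] at h1
    refine le_of_mul_le_mul_right ?_ hN'
    linarith
  have hfin : ∀ F : Finset ℕ, c / 2 * ∑ j ∈ Finset.Icc 1 J, ∑ i ∈ F, Real.exp (-(j * β) * a i) ≤ N := by
    intro F
    refine le_trans ?_ (sum_meanOccupation_le h N F)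
    rw [Finset.sum_comm, Finset.mul_sum]
    refine Finset.sum_le_sum fun i _ => ?_
    rw [meanOccupation_eq h, Finset.mul_sum]
    refine (Finset.sum_le_sum fun j hj => ?_).trans
      (Finset.sum_le_sum_of_subset_of_nonneg (Finset.Icc_subset_Icc_right hJN)
        fun j _ _ => mul_nonneg (by positivity) (div_pos (hZ _) (hZ _)).le)
    have h1 : c / 2 ≤ p j := hpJ.trans (hp (Finset.mem_Icc.1 hj).2 hJN)
    -- Energies are nonnegative, so the Boltzmann factor of `i₀` can be dropped. The remaining ratio
    -- refers to no particular state, so its lower bound applies to the occupation of every `i`.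
    have h2 : p j ≤ canonicalZ a β (N - j) / canonicalZ a β N := by
      refine mul_le_of_le_one_left (div_pos (hZ _) (hZ _)).le
        (pow_le_one₀ (Real.exp_pos _).le (Real.exp_le_one_iff.2 ?_))
      nlinarith [ha i₀]
    have h3 : Real.exp (-(j * β) * a i) = Real.exp (-β * a i) ^ j := by
      rw [← Real.exp_nat_mul]; congr 1; ring
    rw [h3, mul_comm]
    exact mul_le_mul_of_nonneg_left (h1.trans h2) (by positivity)
  have hs : ∀ j ∈ Finset.Icc 1 J, Summable fun i => Real.exp (-(j * β) * a i) := fun j hj => by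
    refine Summable.of_nonneg_of_le (fun i => (Real.exp_pos _).le) (fun i => Real.exp_le_exp.2 ?_) h
    have : (1 : ℝ) ≤ j := by exact_mod_cast (Finset.mem_Icc.1 hj).1
    nlinarith [mul_nonneg hβ.le (ha i)]
  rw [← Summable.tsum_finsetSum hs]
  refine le_of_tendsto ((summable_sum hs).hasSum.mul_left (c / 2)) (Eventually.of_forall fun F => ?_)
  rw [← Finset.mul_sum, Finset.sum_comm]
  exact hfin F

end Canonical

/-! ### Thermal states -/

section Diagonal

variable {H : Type*} [NormedAddCommGroup H] [InnerProductSpace ℂ H]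

/-- The mass of a diagonal density matrix does not depend on the eigenbasis. -/
theorem HilbertBasis.hasSum_of_mul_inner_eq {ι κ : Type*} (u : HilbertBasis ι ℂ H)
    (v : HilbertBasis κ ℂ H) {f : ι → ℝ} {g : κ → ℝ} (hg : ∀ k, 0 ≤ g k)
    (hfg : ∀ i k, (f i : ℂ) * ⟪v k, u i⟫_ℂ = g k * ⟪v k, u i⟫_ℂ) (hs : Summable g) :
    HasSum f (∑' k, g k) := by
  -- The double series of `g k * ‖⟪v k, u i⟫‖ ^ 2` is summed in both orders. Wherever the overlap is
  -- nonzero, `hfg` allows `g k` to be replaced by `f i`.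
  have h1 : ∀ k, HasSum (fun i => g k * ‖⟪v k, u i⟫_ℂ‖ ^ 2) (g k) := fun k => by
    have := (HilbertBasis.hasSum_norm_sq u (v k)).mul_left (g k)
    rw [v.orthonormal.1 k] at this
    simpa [norm_inner_symm] using this
  have h2 : ∀ i, HasSum (fun k => g k * ‖⟪v k, u i⟫_ℂ‖ ^ 2) (f i) := fun i => by
    have := (HilbertBasis.hasSum_norm_sq v (u i)).mul_left (f i)
    rw [u.orthonormal.1 i, one_pow, mul_one] at this
    refine this.congr_fun fun k => ?_
    by_cases h0 : ⟪v k, u i⟫_ℂ = 0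
    · simp [h0]
    · have := mul_right_cancel₀ h0 (hfg i k)
      rw [Complex.ofReal_inj.1 this]
  have h3 : Summable fun p : κ × ι => g p.1 * ‖⟪v p.1, u p.2⟫_ℂ‖ ^ 2 := by
    refine (summable_prod_of_nonneg fun p => mul_nonneg (hg _) (by positivity)).2
      ⟨fun k => (h1 k).summable, ?_⟩
    exact hs.congr fun k => (h1 k).tsum_eq.symm
  have h4 : ∑' p : κ × ι, g p.1 * ‖⟪v p.1, u p.2⟫_ℂ‖ ^ 2 = ∑' k, g k :=
    (h3.hasSum.prod_fiberwise h1).tsum_eq.symm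
  have h5 := (Equiv.prodComm ι κ).hasSum_iff.2 h3.hasSum
  rw [h4] at h5
  exact h5.prod_fiberwise h2

theorem Orthonormal.summable_smul_rankOne [CompleteSpace H] {ι : Type*} {u : ι → H}
    (hu : Orthonormal ℂ u) {f : ι → ℝ} (hf : Summable f) :
    Summable fun i => (f i : ℂ) • InnerProductSpace.rankOne ℂ (u i) (u i) := by
  refine Summable.of_norm (hf.norm.congr fun i => ?_)
  rw [norm_smul, InnerProductSpace.norm_rankOne, hu.1 i, Complex.norm_real]
  simp

/-- A diagonal density matrix does not depend on the eigenbasis. -/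
theorem HilbertBasis.tsum_smul_rankOne_eq [CompleteSpace H] {ι κ : Type*} (u : HilbertBasis ι ℂ H)
    (v : HilbertBasis κ ℂ H) {f : ι → ℝ} {g : κ → ℝ}
    (hfg : ∀ i k, (f i : ℂ) * ⟪v k, u i⟫_ℂ = g k * ⟪v k, u i⟫_ℂ)
    (hf : Summable f) (hg : Summable g) :
    ∑' i, (f i : ℂ) • InnerProductSpace.rankOne ℂ (u i) (u i) =
      ∑' k, (g k : ℂ) • InnerProductSpace.rankOne ℂ (v k) (v k) := by
  classical
  have hF := (Orthonormal.summable_smul_rankOne u.orthonormal hf).hasSum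
  have hG := (Orthonormal.summable_smul_rankOne v.orthonormal hg).hasSum
  refine ContinuousLinearMap.ext fun x => ?_
  rw [← sub_eq_zero]
  refine HilbertBasis.eq_zero_of_inner v fun k => ?_
  have h1 := (hF.mapL (ContinuousLinearMap.apply ℂ H x)).mapL (innerSL ℂ (v k))
  have h2 := (hG.mapL (ContinuousLinearMap.apply ℂ H x)).mapL (innerSL ℂ (v k))
  have h3 : HasSum (fun i => (g k : ℂ) * (⟪v k, u i⟫_ℂ * ⟪u i, x⟫_ℂ)) (g k * ⟪v k, x⟫_ℂ) :=
    (u.hasSum_inner_mul_inner (v k) x).mul_left _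
  have h4 : HasSum (fun i => if i = k then (g k : ℂ) * ⟪v k, x⟫_ℂ else 0) (g k * ⟪v k, x⟫_ℂ) :=
    hasSum_ite_eq k _
  rw [inner_sub_right, sub_eq_zero]
  refine (h1.unique (h3.congr_fun fun i => ?_)).trans (h2.unique (h4.congr_fun fun i => ?_)).symm
  · change ⟪v k, (f i : ℂ) • (⟪u i, x⟫_ℂ • u i)⟫_ℂ = _
    rw [inner_smul_right, inner_smul_right, ← mul_assoc, mul_right_comm, hfg]
    ring
  · change ⟪v k, (g i : ℂ) • (⟪v i, x⟫_ℂ • v i)⟫_ℂ = _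
    rw [inner_smul_right, inner_smul_right, orthonormal_iff_ite.1 v.orthonormal]
    by_cases h : i = k
    · subst h; simp
    · simp [h, Ne.symm h]

/-- Absolute convergence that permits exchanging the partial trace with the sum over configurations.
The product is bounded by a sum of squares, to which Parseval applies. -/
theorem summable_mul_inner_mul_inner {κ σ : Type*} (b : HilbertBasis κ ℂ H) {w : σ → ℝ}
    (hw : Summable w) (hw0 : ∀ s, 0 ≤ w s) {X Y : σ → H} {A B : ℝ} (hX : ∀ s, ‖X s‖ ≤ A)
    (hY : ∀ s, ‖Y s‖ ≤ B) :
    Summable fun p : σ × κ => (w p.1 : ℂ) * (⟪X p.1, b p.2⟫_ℂ * ⟪b p.2, Y p.1⟫_ℂ) := by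
  have hF : ∀ {X : σ → H} {A : ℝ}, (∀ s, ‖X s‖ ≤ A) →
      Summable fun p : σ × κ => w p.1 * ‖⟪b p.2, X p.1⟫_ℂ‖ ^ 2 := fun {X A} hX => by
    have h5 : ∀ s, HasSum (fun k => w s * ‖⟪b k, X s⟫_ℂ‖ ^ 2) (w s * ‖X s‖ ^ 2) := fun s =>
      (HilbertBasis.hasSum_norm_sq b _).mul_left _
    refine (summable_prod_of_nonneg fun p => mul_nonneg (hw0 _) (by positivity)).2
      ⟨fun s => (h5 s).summable, ?_⟩
    refine Summable.of_nonneg_of_le (fun s => tsum_nonneg fun k =>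
      mul_nonneg (hw0 _) (by positivity)) (fun s => ?_) (hw.mul_right (A ^ 2))
    rw [(h5 s).tsum_eq]
    exact mul_le_mul_of_nonneg_left (pow_le_pow_left₀ (norm_nonneg _) (hX s) 2) (hw0 s)
  refine Summable.of_norm_bounded ((hF hX).add (hF hY)) fun p => ?_
  rw [norm_mul, norm_mul, Complex.norm_real, Real.norm_of_nonneg (hw0 _), norm_inner_symm, ← mul_add]
  refine mul_le_mul_of_nonneg_left ?_ (hw0 _)
  have h1 := norm_nonneg ⟪b p.2, X p.1⟫_ℂ
  have h2 := norm_nonneg ⟪b p.2, Y p.1⟫_ℂ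
  nlinarith [two_mul_le_add_sq ‖⟪b p.2, X p.1⟫_ℂ‖ ‖⟪b p.2, Y p.1⟫_ℂ‖, mul_nonneg h1 h2]

end Diagonal

/-! ### The thermal state in the occupation number basis -/

section Thermal

variable {E : ℕ} {l : Fin E → ℝ} {bc : VertexConditions E} {N : ℕ} {β : ℝ}

/-- A nonzero overlap forces the two energies to agree. This is all that is known about an arbitrary
eigenbasis in the presence of degeneracies, and it suffices. -/
theorem exp_mul_inner_symVec (hl : ∀ e, 0 < l e) (S : Eigensystem (laplacian bc l))
    (S' : Eigensystem (bosonicLaplacian bc l N)) (n : ℕ) (s : Sym ℕ N) :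
    (Real.exp (-β * S'.val n) : ℂ) * ⟪symVec S.vec s, (S'.vec n : L2N l N)⟫_ℂ =
      Real.exp (-β * energy S.val s) * ⟪symVec S.vec s, (S'.vec n : L2N l N)⟫_ℂ := by
  by_cases h0 : ⟪symVec S.vec s, (S'.vec n : L2N l N)⟫_ℂ = 0
  · rw [h0, mul_zero, mul_zero]
  · have h1 := (inner_symVec_eq_zero_iff S.vec (S'.vec n).2 s).not.1 h0
    have h2 := inner_basisTensor_of_mem_freeLaplacian S hl (assignment s) (S'.eig n)
    rw [Submodule.coe_smul, inner_smul_right, config_assignment] at h2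
    rw [Complex.ofReal_inj.1 (mul_right_cancel₀ h1 h2)]

theorem hasSum_exp_val (hl : ∀ e, 0 < l e) (S : Eigensystem (laplacian bc l))
    (h : Summable fun i => Real.exp (-β * S.val i)) (S' : Eigensystem (bosonicLaplacian bc l N)) :
    HasSum (fun n => Real.exp (-β * S'.val n)) (canonicalZ S.val β N) := by
  refine HilbertBasis.hasSum_of_mul_inner_eq S'.vec (symBasis S.vec N) (fun _ => (Real.exp_pos _).le)
    (fun n s => ?_) (summable_exp_energy h N)
  rw [Submodule.coe_inner, symBasis_apply]
  exact exp_mul_inner_symVec hl S S' n s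

/-- The thermal state is diagonal with respect to occupation numbers. -/
theorem hasSum_thermalState (hl : ∀ e, 0 < l e) (S : Eigensystem (laplacian bc l))
    (h : Summable fun i => Real.exp (-β * S.val i)) (S' : Eigensystem (bosonicLaplacian bc l N)) :
    HasSum (fun s : Sym ℕ N => ((Real.exp (-β * energy S.val s) / canonicalZ S.val β N : ℝ) : ℂ) •
      InnerProductSpace.rankOne ℂ (symVec S.vec s) (symVec S.vec s)) (thermalState S' β) := by
  have hZ : partitionFunction S' β = canonicalZ S.val β N := (hasSum_exp_val hl S h S').tsum_eq
  have hf := (hasSum_exp_val hl S h S').summable.div_const (canonicalZ S.val β N)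
  have hg := (summable_exp_energy h N).div_const (canonicalZ S.val β N)
  have h1 := HilbertBasis.tsum_smul_rankOne_eq S'.vec (symBasis S.vec N) (fun n s => by
    have := exp_mul_inner_symVec (β := β) hl S S' n s
    rw [Submodule.coe_inner, symBasis_apply]
    push_cast at this ⊢
    rw [div_mul_eq_mul_div, this, div_mul_eq_mul_div]) hf hg
  let J := (bosonic l N).subtypeL
  let C : (bosonic l N →L[ℂ] bosonic l N) →L[ℂ] (L2N l N →L[ℂ] L2N l N) :=
    (ContinuousLinearMap.postcomp (L2N l N) J).comp
      (ContinuousLinearMap.precomp (bosonic l N) (ContinuousLinearMap.adjoint J))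
  have hC : ∀ (c : ℝ) (x : bosonic l N), C ((c : ℂ) • InnerProductSpace.rankOne ℂ x x) =
      (c : ℂ) • InnerProductSpace.rankOne ℂ (x : L2N l N) (x : L2N l N) := fun c x => by
    refine ContinuousLinearMap.ext fun y => ?_
    change ((c : ℂ) • (⟪x, ContinuousLinearMap.adjoint J y⟫_ℂ • x : bosonic l N) : L2N l N) =
      (c : ℂ) • (⟪(x : L2N l N), y⟫_ℂ • (x : L2N l N))
    rw [ContinuousLinearMap.adjoint_inner_right]
    rfl
  have h2 := (Orthonormal.summable_smul_rankOne S'.vec.orthonormal hf).hasSum.mapL C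
  have h3 := (Orthonormal.summable_smul_rankOne (symBasis S.vec N).orthonormal hg).hasSum.mapL C
  simp_rw [hC] at h2 h3
  rw [thermalState, hZ, h2.tsum_eq, h1]
  simpa only [symBasis_apply] using h3

end Thermal

/-! ### The reduced one-particle density matrix -/

section Reduced

variable {E : ℕ} {l : Fin E → ℝ} {N : ℕ} (b : HilbertBasis ℕ ℂ (L2 l))

/-- The sum is the probability that the first particle is in state `i`. By exchange symmetry it is
the same for each of the `N + 1` particles, and these probabilities add up to the occupation number.
-/
theorem hasSum_norm_sq_basisTensor_cons (s : Sym ℕ (N + 1)) (i : ℕ) :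
    HasSum (fun m : Fin N → ℕ =>
      ‖⟪basisTensor b (Fin.cons i m : Fin (N + 1) → ℕ), symVec b s⟫_ℂ‖ ^ 2)
      (Multiset.count i (s : Multiset ℕ) / (N + 1)) := by
  set h : (Fin (N + 1) → ℕ) → ℝ := fun m => ‖⟪basisTensor b m, symVec b s⟫_ℂ‖ ^ 2
  have h1 : HasSum h 1 := by
    have := HilbertBasis.hasSum_norm_sq (tensorBasis b (N + 1)) (symVec b s)
    simpa only [norm_symVec, one_pow, tensorBasis_apply] using this
  have hS : ∀ j, Summable fun m : Fin (N + 1) → ℕ => if m j = i then h m else 0 := fun j =>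
    Summable.of_nonneg_of_le (fun m => by split_ifs <;> positivity)
      (fun m => by split_ifs <;> simp [h]) h1.summable
  have h2 : ∀ j, ∑' m : Fin (N + 1) → ℕ, (if m j = i then h m else 0) =
      ∑' m : Fin (N + 1) → ℕ, (if m 0 = i then h m else 0) := fun j => by
    rw [← (Equiv.arrowCongr (Equiv.swap 0 j) (Equiv.refl ℕ)).tsum_eq]
    refine tsum_congr fun m => ?_
    have h3 : Equiv.arrowCongr (Equiv.swap 0 j) (Equiv.refl ℕ) m = m ∘ Equiv.swap 0 j := by
      funext k; simp
    rw [h3]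
    simp only [h, inner_basisTensor_comp b (symVec_mem b s), Function.comp_apply,
      Equiv.swap_apply_right]
  have h4 : ∑ j, ∑' m : Fin (N + 1) → ℕ, (if m j = i then h m else 0) =
      Multiset.count i (s : Multiset ℕ) := by
    rw [← Summable.tsum_finsetSum fun j _ => hS j, ← (h1.mul_left
      (Multiset.count i (s : Multiset ℕ) : ℝ)).tsum_eq.trans (mul_one _)]
    refine tsum_congr fun m => ?_
    by_cases hm : config m = s
    · rw [← hm, count_config, ← Finset.sum_filter, Finset.sum_const, nsmul_eq_mul,
        Fintype.card_subtype]
    · simp [h, inner_basisTensor_symVec_of_ne b hm]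
  simp_rw [h2] at h4
  rw [Finset.sum_const, Finset.card_univ, Fintype.card_fin, nsmul_eq_mul] at h4
  have h5 : HasSum (fun m : Fin (N + 1) → ℕ => if m 0 = i then h m else 0)
      (Multiset.count i (s : Multiset ℕ) / (N + 1)) := by
    have : ∑' m : Fin (N + 1) → ℕ, (if m 0 = i then h m else 0) =
        Multiset.count i (s : Multiset ℕ) / (N + 1) := by
      rw [eq_div_iff (by positivity), ← h4]; push_cast; ring
    rw [← this]
    exact (hS 0).hasSum
  have hinj : Function.Injective fun m : Fin N → ℕ => (Fin.cons i m : Fin (N + 1) → ℕ) :=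
    fun m m' h => (Fin.cons_inj.1 h).2
  rw [← hinj.hasSum_iff] at h5
  · simpa [Function.comp_def] using h5
  · refine fun m hm => if_neg fun h0 => hm ⟨fun j => m j.succ, ?_⟩
    simp only
    rw [← h0]
    exact Fin.cons_self_tail m

theorem inner_contract_symVec (s : Sym ℕ (N + 1)) (i j : ℕ) :
    ⟪contract (b j) (symVec b s), contract (b i) (symVec b s)⟫_ℂ =
      if i = j then ((Multiset.count i (s : Multiset ℕ) / (N + 1) : ℝ) : ℂ) else 0 := by
  have h1 := (tensorBasis b N).hasSum_inner_mul_inner (contract (b j) (symVec b s))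
    (contract (b i) (symVec b s))
  have h2 : ∀ (k : ℕ) (m : Fin N → ℕ), ⟪basisTensor b m, contract (b k) (symVec b s)⟫_ℂ =
      ⟪basisTensor b (Fin.cons k m : Fin (N + 1) → ℕ), symVec b s⟫_ℂ := fun k m => by
    rw [inner_contract, basisTensor_cons]
  have h2' : ∀ m : Fin N → ℕ, ⟪contract (b j) (symVec b s), basisTensor b m⟫_ℂ =
      starRingEnd ℂ ⟪basisTensor b (Fin.cons j m : Fin (N + 1) → ℕ), symVec b s⟫_ℂ := fun m => by
    rw [← h2, inner_conj_symm]
  simp_rw [tensorBasis_apply, h2, h2'] at h1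
  split_ifs with hij
  · subst hij
    refine h1.unique ((hasSum_norm_sq_basisTensor_cons b s i).mapL Complex.ofRealCLM
      |>.congr_fun fun m => ?_)
    rw [RCLike.conj_mul]
    simp
  · refine h1.unique ?_
    convert hasSum_zero with m
    by_cases hm : config (Fin.cons j m : Fin (N + 1) → ℕ) = s
    · rw [inner_basisTensor_symVec_of_ne b (m := Fin.cons i m), mul_zero]
      intro hm'
      have h3 : config (Fin.cons i m : Fin (N + 1) → ℕ) = config (Fin.cons j m : Fin (N + 1) → ℕ) :=
        hm'.trans hm.symm
      -- With the level `k` given energy `k`, the two configurations have energies differing by `i -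
      -- j`, so equality would give `i = j`.
      have h4 := congrArg (fun s : Sym ℕ (N + 1) => energy (fun k => (k : ℝ)) s) h3
      simp only [energy_config, Fin.sum_univ_succ, Fin.cons_zero, Fin.cons_succ] at h4
      exact hij (by exact_mod_cast add_right_cancel h4)
    · rw [inner_basisTensor_symVec_of_ne b hm, map_zero, zero_mul]

/-- States that are empty in `s` contract to zero, so the expansion of `φ` in the basis becomes a
finite sum. -/
theorem contract_symVec (s : Sym ℕ (N + 1)) (φ : L2 l) :
    contract φ (symVec b s) =
      ∑ i ∈ (s : Multiset ℕ).toFinset, ⟪φ, b i⟫_ℂ • contract (b i) (symVec b s) := by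
  refine ext_inner_left ℂ fun Ψ => ?_
  have h1 : HasSum (fun i => ⟪φ, b i⟫_ℂ * ⟪Ψ, contract (b i) (symVec b s)⟫_ℂ)
      ⟪Ψ, contract φ (symVec b s)⟫_ℂ := by
    have h2 : HasSum (fun i => ⟪symVec b s, b.repr φ i • tensorCons (b i) Ψ⟫_ℂ)
        ⟪symVec b s, tensorCons φ Ψ⟫_ℂ :=
      ((b.hasSum_repr φ).mapL ((tensorConsL l N).flip Ψ)).mapL (innerSL ℂ (symVec b s)) |>.congr_fun
        fun i => by simp [tensorConsL_apply, inner_smul_right]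
    have h3 := h2.mapL (Complex.conjCLE : ℂ →L[ℝ] ℂ)
    simp only [ContinuousLinearEquiv.coe_coe, Complex.conjCLE_apply, inner_conj_symm] at h3
    rw [inner_contract]
    refine h3.congr_fun fun i => ?_
    rw [inner_smul_left, inner_contract, b.repr_apply_apply, inner_conj_symm]
  have h4 : HasSum (fun i => ⟪φ, b i⟫_ℂ * ⟪Ψ, contract (b i) (symVec b s)⟫_ℂ)
      (∑ i ∈ (s : Multiset ℕ).toFinset, ⟪φ, b i⟫_ℂ * ⟪Ψ, contract (b i) (symVec b s)⟫_ℂ) := by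
    refine hasSum_sum_of_ne_finset_zero fun i hi => ?_
    have h5 := inner_contract_symVec b s i i
    rw [if_pos rfl, Multiset.count_eq_zero.2 (fun h => hi (Multiset.mem_toFinset.2 h))] at h5
    have h6 : contract (b i) (symVec b s) = 0 := inner_self_eq_zero.1 (h5.trans (by simp))
    rw [h6, inner_zero_right, mul_zero]
  rw [h1.unique h4, inner_sum]
  simp_rw [inner_smul_right]

/-- The operator with eigenvectors `b i` whose eigenvalues are the occupation numbers. -/
def occupationOp (s : Sym ℕ N) : L2 l →L[ℂ] L2 l :=
  ∑ i ∈ (s : Multiset ℕ).toFinset,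
    ((Multiset.count i (s : Multiset ℕ) : ℝ) : ℂ) • InnerProductSpace.rankOne ℂ (b i) (b i)

theorem norm_occupationOp_le (s : Sym ℕ N) : ‖occupationOp b s‖ ≤ N := by
  refine (norm_sum_le _ _).trans (le_of_eq ?_)
  have h1 : ∀ i, ‖((Multiset.count i (s : Multiset ℕ) : ℝ) : ℂ) •
      InnerProductSpace.rankOne ℂ (b i) (b i)‖ = Multiset.count i (s : Multiset ℕ) := fun i => by
    rw [norm_smul, InnerProductSpace.norm_rankOne, b.orthonormal.1 i, Complex.norm_real]
    simp
  simp_rw [h1]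
  rw [← Nat.cast_sum, Multiset.toFinset_sum_count_eq]
  exact congrArg Nat.cast s.2

theorem inner_occupationOp (s : Sym ℕ N) (i : ℕ) (x : L2 l) :
    ⟪b i, occupationOp b s x⟫_ℂ = ((Multiset.count i (s : Multiset ℕ) : ℝ) : ℂ) * ⟪b i, x⟫_ℂ := by
  rw [occupationOp, sum_apply, inner_sum]
  simp only [smul_apply, InnerProductSpace.rankOne_apply, inner_smul_right,
    orthonormal_iff_ite.1 b.orthonormal, mul_ite, mul_one, mul_zero, Finset.sum_ite_eq,
    Multiset.mem_toFinset]
  split_ifs with h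
  · rfl
  · rw [Multiset.count_eq_zero.2 h]; simp

/-- The one-particle density matrix of `symVec b s` is diagonal with the occupation numbers as
entries; the factor `N + 1` cancels the averaging over particles. -/
theorem inner_contract_contract (s : Sym ℕ (N + 1)) (φ ψ : L2 l) :
    ((N : ℂ) + 1) * ⟪contract ψ (symVec b s), contract φ (symVec b s)⟫_ℂ =
      ⟪φ, occupationOp b s ψ⟫_ℂ := by
  have hN : ((N : ℂ) + 1) ≠ 0 := by exact_mod_cast N.succ_ne_zero
  rw [contract_symVec b s φ, contract_symVec b s ψ, sum_inner, occupationOp,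
    sum_apply, inner_sum, Finset.mul_sum]
  refine Finset.sum_congr rfl fun j hj => ?_
  rw [inner_sum]
  simp only [inner_smul_left, inner_smul_right, inner_contract_symVec, inner_conj_symm,
    mul_ite, mul_zero, Finset.sum_ite_eq', hj, if_true, smul_apply,
    InnerProductSpace.rankOne_apply]
  push_cast
  field_simp

end Reduced

/-! ### Reduction of the thermal state to one particle -/

section ReducedThermal

variable {E : ℕ} {l : Fin E → ℝ} {bc : VertexConditions E} {N : ℕ} {β : ℝ}

/-- The reduced density matrix of the thermal state is diagonal in the one-particle eigenbasis. -/
theorem exists_isReducedDensityMatrix (hl : ∀ e, 0 < l e) (S : Eigensystem (laplacian bc l))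
    (h : Summable fun i => Real.exp (-β * S.val i))
    (S' : Eigensystem (bosonicLaplacian bc l (N + 1))) :
    ∃ T, IsReducedDensityMatrix S' β T ∧
      ∀ i x, ⟪S.vec i, T x⟫_ℂ = (meanOccupation S.val β (N + 1) i : ℂ) * ⟪S.vec i, x⟫_ℂ := by
  set Z := canonicalZ S.val β (N + 1)
  set w : Sym ℕ (N + 1) → ℝ := fun s => Real.exp (-β * energy S.val s) / Z
  have hw : Summable w := (summable_exp_energy h (N + 1)).div_const Z
  have hw0 : ∀ s, 0 ≤ w s := fun s => div_nonneg (Real.exp_pos _).le (canonicalZ_pos h _).le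
  have hsum : Summable fun s => (w s : ℂ) • occupationOp S.vec s := by
    refine Summable.of_norm_bounded (hw.mul_left ((N + 1 : ℕ) : ℝ)) fun s => ?_
    rw [norm_smul, Complex.norm_real, Real.norm_of_nonneg (hw0 s), mul_comm]
    exact mul_le_mul_of_nonneg_right (norm_occupationOp_le S.vec s) (hw0 s)
  have hT : ∀ φ ψ, HasSum (fun s => (w s : ℂ) * ⟪φ, occupationOp S.vec s ψ⟫_ℂ)
      ⟪φ, (∑' s, (w s : ℂ) • occupationOp S.vec s) ψ⟫_ℂ := fun φ ψ =>
    ((hsum.hasSum.mapL (ContinuousLinearMap.apply ℂ (L2 l) ψ)).mapL (innerSL ℂ φ)).congr_fun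
      fun s => (inner_smul_right _ _ _).symm
  have hC : ∀ (χ : L2 l) (s : Sym ℕ (N + 1)),
      ‖contract χ (symVec S.vec s)‖ ≤ ‖contract (l := l) (N := N) χ‖ := fun χ s => by
    simpa only [norm_symVec, mul_one] using
      (contract (l := l) (N := N) χ).le_opNorm (symVec S.vec s)
  refine ⟨∑' s, (w s : ℂ) • occupationOp S.vec s, fun κ b φ ψ => ?_, fun i x => ?_⟩
  · have h1 : ∀ k, HasSum (fun s => (w s : ℂ) * (((N : ℂ) + 1) *
        (⟪contract ψ (symVec S.vec s), b k⟫_ℂ * ⟪b k, contract φ (symVec S.vec s)⟫_ℂ)))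
        ⟪tensorCons φ (b k), (((N : ℂ) + 1) • thermalState S' β) (tensorCons ψ (b k))⟫_ℂ := by
      intro k
      have h2 := (((hasSum_thermalState hl S h S').const_smul ((N : ℂ) + 1)).mapL
        (ContinuousLinearMap.apply ℂ (L2N l (N + 1)) (tensorCons ψ (b k)))).mapL
        (innerSL ℂ (tensorCons φ (b k)))
      refine h2.congr_fun fun s => ?_
      change _ = ⟪tensorCons φ (b k), ((N : ℂ) + 1) • (w s : ℂ) •
        (⟪symVec S.vec s, tensorCons ψ (b k)⟫_ℂ • symVec S.vec s)⟫_ℂ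
      rw [inner_smul_right, inner_smul_right, inner_smul_right, inner_contract,
        ← inner_conj_symm (contract ψ (symVec S.vec s)), inner_contract, inner_conj_symm]
      ring
    have h3 : ∀ s, HasSum (fun k => (w s : ℂ) * (((N : ℂ) + 1) *
        (⟪contract ψ (symVec S.vec s), b k⟫_ℂ * ⟪b k, contract φ (symVec S.vec s)⟫_ℂ)))
        ((w s : ℂ) * ⟪φ, occupationOp S.vec s ψ⟫_ℂ) := fun s => by
      rw [← inner_contract_contract]
      exact ((b.hasSum_inner_mul_inner _ _).mul_left _).mul_left _
    have h4 : Summable fun p : Sym ℕ (N + 1) × κ => (w p.1 : ℂ) * (((N : ℂ) + 1) *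
        (⟪contract ψ (symVec S.vec p.1), b p.2⟫_ℂ *
          ⟪b p.2, contract φ (symVec S.vec p.1)⟫_ℂ)) := by
      have h5 := summable_mul_inner_mul_inner b hw hw0
        (X := fun s => contract ψ (symVec S.vec s)) (Y := fun s => contract φ (symVec S.vec s))
        (hC ψ) (hC φ)
      refine (h5.mul_left ((N : ℂ) + 1)).congr fun p => ?_
      ring
    -- The double series is summed over the traced basis first, which gives `occupationOp`, and over
    -- configurations first, which gives the matrix elements of the thermal state.
    have h5 := h4.hasSum
    rw [(h5.prod_fiberwise h3).unique (hT φ ψ)] at h5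
    exact ((Equiv.prodComm κ (Sym ℕ (N + 1))).hasSum_iff.2 h5).prod_fiberwise h1
  · have h1 := hT (S.vec i) x
    simp_rw [inner_occupationOp, ← mul_assoc] at h1
    refine h1.unique (HasSum.mul_right _ ?_)
    have h2 := ((summable_count_mul_exp h (N + 1) i).hasSum.div_const Z).mapL Complex.ofRealCLM
    refine h2.congr_fun fun s => ?_
    simp only [w, Complex.ofRealCLM_apply]
    push_cast
    ring

/-- Any eigenvector overlaps with some `b i`, so its eigenvalue is one of the `ν i`. -/
theorem isLargestEigenvalue_of_inner_eq {H : Type*} [NormedAddCommGroup H] [InnerProductSpace ℂ H]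
    (b : HilbertBasis ℕ ℂ H) {T : H →L[ℂ] H} {ν : ℕ → ℝ}
    (hT : ∀ i x, ⟪b i, T x⟫_ℂ = (ν i : ℂ) * ⟪b i, x⟫_ℂ) {i₀ : ℕ} (hmax : ∀ i, ν i ≤ ν i₀) :
    IsLargestEigenvalue T (ν i₀) := by
  refine ⟨?_, fun r hr => ?_⟩
  · refine Module.End.hasEigenvalue_of_hasEigenvector (x := b i₀)
      (Module.End.hasEigenvector_iff.2 ⟨Module.End.mem_eigenspace_iff.2 ?_, b.orthonormal.ne_zero i₀⟩)
    change T (b i₀) = (ν i₀ : ℂ) • b i₀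
    rw [← sub_eq_zero]
    refine HilbertBasis.eq_zero_of_inner b fun i => ?_
    rw [inner_sub_right, hT, inner_smul_right, orthonormal_iff_ite.1 b.orthonormal]
    split_ifs with h
    · rw [h, sub_self]
    · simp
  · obtain ⟨x, hx⟩ := Module.End.HasEigenvalue.exists_hasEigenvector hr
    have h1 : T x = (r : ℂ) • x := hx.apply_eq_smul
    obtain ⟨i, hi⟩ : ∃ i, ⟪b i, x⟫_ℂ ≠ 0 := by
      by_contra! h0
      exact hx.2 (HilbertBasis.eq_zero_of_inner b h0)
    have h2 := hT i x
    rw [h1, inner_smul_right] at h2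
    rw [Complex.ofReal_inj.1 (mul_right_cancel₀ hi h2)]
    exact hmax i

end ReducedThermal

/-! ### Absence of condensation in the canonical ensemble -/

section NoCondensation

variable {E : ℕ} {l : Fin E → ℝ} {bc : VertexConditions E} {β : ℝ}

/-- The summand is `1 / π * ∫ exp (-j β k ^ 2)` over `k > 0`, a multiple of `j ^ (-1/2)`. This
divergence is the canonical form of the absence of a critical density. -/
theorem tendsto_sum_sqrt_atTop (hβ : 0 < β) :
    Tendsto (fun J : ℕ => ∑ j ∈ Finset.Icc 1 J, 1 / Real.pi * (√(Real.pi / (j * β)) / 2)) atTop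
      atTop := by
  set κ : ℕ → ℝ := fun j => 1 / Real.pi * (√(Real.pi / (j * β)) / 2)
  have hκ : ∀ j, κ j = 1 / Real.pi * √(Real.pi / β) / 2 * (1 / (j : ℝ) ^ (1 / 2 : ℝ)) := fun j => by
    simp only [κ]
    rw [← Real.sqrt_eq_rpow, mul_comm (j : ℝ) β, ← div_div, Real.sqrt_div' _ (Nat.cast_nonneg j)]
    ring
  have h1 : ¬ Summable κ := by
    have hC : 1 / Real.pi * √(Real.pi / β) / 2 ≠ 0 := by
      have := Real.pi_pos
      positivity
    rw [funext hκ, summable_mul_left_iff hC, Real.summable_one_div_nat_rpow]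
    norm_num
  have h2 := (not_summable_iff_tendsto_nat_atTop_of_nonneg fun j => by positivity).1 h1
  refine ((tendsto_add_atTop_iff_nat 1).2 h2).congr fun J => ?_
  rw [Finset.range_eq_Ico, Finset.sum_eq_sum_Ico_succ_bot (Nat.succ_pos J)]
  -- Division by zero makes the term `j = 0` vanish, so starting at `0` or at `1` is the same.
  have h3 : κ 0 = 0 := by simp [κ]
  rw [h3, zero_add]
  rfl

/-- At fixed density no one-particle state is macroscopically occupied. -/
theorem tendsto_meanOccupation_div (hE : 0 < E) (hl : ∀ e, 0 < l e) (hneg : bc.NegSemidef)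
    (hβ : 0 < β) {η : ℕ → ℝ} (hη : ∀ n, 0 < η n) (hlim : Tendsto η atTop atTop) {ρ : ℝ}
    (hρ : Tendsto (fun N : ℕ => ((N : ℝ) + 1) / totalLength (η N • l)) atTop (𝓝 ρ))
    (S : ∀ N, Eigensystem (laplacian bc (η N • l))) (i : ℕ → ℕ) :
    Tendsto (fun N : ℕ => meanOccupation (S N).val β (N + 1) (i N) / ((N : ℝ) + 1)) atTop (𝓝 0) := by
  have hlen : ∀ N, 0 < totalLength (η N • l) := fun N => totalLength_pos hE (smul_length_pos hl (hη N))
  refine tendsto_order.2 ⟨fun c hc => Eventually.of_forall fun N =>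
    hc.trans_le (div_nonneg (meanOccupation_nonneg _ _) (by positivity)), fun c hc => ?_⟩
  -- `J` depends on `c`, `ρ` and `β` but not on `N`, so only finitely many Weyl asymptotics are
  -- combined below.
  obtain ⟨J, hJ⟩ := ((tendsto_sum_sqrt_atTop hβ).const_mul_atTop (half_pos hc)).eventually
    (eventually_gt_atTop ρ) |>.exists
  have h1 : Tendsto (fun N => c / 2 * ∑ j ∈ Finset.Icc 1 J,
      (∑' k, Real.exp (-(j * β) * (S N).val k)) / totalLength (η N • l)) atTop
      (𝓝 (c / 2 * ∑ j ∈ Finset.Icc 1 J, 1 / Real.pi * (√(Real.pi / (j * β)) / 2))) := by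
    refine (tendsto_finsetSum _ fun j hj => ?_).const_mul _
    have hj1 : (0 : ℝ) < j := by exact_mod_cast (Finset.mem_Icc.1 hj).1
    have hjβ : 0 < j * β := mul_pos hj1 hβ
    rw [← integral_gaussian_Ioi]
    exact tendsto_div_totalLength hE hl hneg hη hlim S (g := fun x => Real.exp (-(j * β) * x))
      (fun x _ y _ hxy => Real.exp_le_exp.2 (by nlinarith)) (fun x _ => (Real.exp_pos _).le)
      (integrableOn_exp_neg_mul_sq hjβ)
  have h2 : Tendsto (fun N : ℕ => c / 2 * ((N : ℝ) + 1)) atTop atTop :=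
    (tendsto_atTop_add_const_right _ _ tendsto_natCast_atTop_atTop).const_mul_atTop (half_pos hc)
  filter_upwards [hρ.eventually_lt h1 hJ, h2.eventually_ge_atTop (J : ℝ)] with N h3 h4
  by_contra! h5
  rw [le_div_iff₀ (by positivity)] at h5
  have hl' := smul_length_pos hl (hη N)
  have h6 := mul_sum_tsum_exp_le (J := J) (c := c) ((S N).val_nonneg hl' hneg) hβ
    ((S N).summable_exp hl' hneg hβ) N.succ_pos (by push_cast; exact h4) (i₀ := i N)
    (by push_cast; exact h5)
  rw [← Finset.sum_div, ← mul_div_assoc] at h3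
  have h7 := (div_lt_div_iff_of_pos_right (hlen N)).1 h3
  push_cast at h6
  linarith

theorem tendsto_scale_atTop (hE : 0 < E) (hl : ∀ e, 0 < l e) {η : ℕ → ℝ} (hη : ∀ n, 0 < η n) {ρ : ℝ}
    (hρ0 : 0 < ρ)
    (hρ : Tendsto (fun N : ℕ => ((N : ℝ) + 1) / totalLength (η N • l)) atTop (𝓝 ρ)) :
    Tendsto η atTop atTop := by
  have hL := totalLength_pos hE hl
  have h1 : 0 < (ρ + 1) * totalLength l := by positivity
  refine tendsto_atTop_mono' _ ?_ (tendsto_natCast_atTop_atTop.atTop_div_const h1)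
  filter_upwards [hρ.eventually_lt_const (lt_add_one ρ)] with N hN
  rw [totalLength_smul, div_lt_iff₀ (mul_pos (hη N) hL)] at hN
  rw [div_le_iff₀ h1]
  nlinarith

theorem not_penroseOnsagerBEC_of_tendsto_zero {r : ℕ → ℝ} (h : Tendsto r atTop (𝓝 0)) :
    ¬ PenroseOnsagerBEC r := by
  rintro ⟨c₁, c₂, N₀, hc, -, hr⟩
  obtain ⟨N, hN, hN'⟩ := ((h.eventually_lt_const hc).and (eventually_ge_atTop N₀)).exists
  exact absurd (hr N hN').1 (not_lt.2 hN.le)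

theorem nonempty_eigensystem (hE : 0 < E) (hl : ∀ e, 0 < l e) (hneg : bc.NegSemidef) :
    Nonempty (Eigensystem (laplacian bc l)) := by
  have : Nonempty (Fin E) := ⟨⟨0, hE⟩⟩
  exact nonempty_eigensystem_laplacian bc hl hneg (edgeBasis hl)

end NoCondensation

end QuantumGraph

end

theorem mainTheorem5 (E : ℕ) (hE : 0 < E) (l : Fin E → ℝ) (hl : ∀ e, 0 < l e)
    (bc : QuantumGraph.VertexConditions E) (hneg : bc.NegSemidef) (β : ℝ) (hβ : 0 < β) :
    -- the Laplacians have complete orthonormal sequences of eigenvectors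
    ((∀ bc' ∈ ({bc, QuantumGraph.dirichlet E, QuantumGraph.neumann E} :
          Set (QuantumGraph.VertexConditions E)), ∀ η : ℝ, 0 < η →
        Nonempty (QuantumGraph.Eigensystem (QuantumGraph.laplacian bc' (η • l)))) ∧
      (∀ η : ℝ, 0 < η → ∀ N : ℕ, 0 < N →
        Nonempty (QuantumGraph.Eigensystem (QuantumGraph.bosonicLaplacian bc (η • l) N)))) ∧
    -- the grand-canonical density converges to the Dirichlet / Neumann one
    (∀ bc' ∈ ({bc, QuantumGraph.dirichlet E, QuantumGraph.neumann E} :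
          Set (QuantumGraph.VertexConditions E)),
      ∀ η : ℕ → ℝ, (∀ n, 0 < η n) → Tendsto η atTop atTop →
      ∀ S : ∀ n, QuantumGraph.Eigensystem (QuantumGraph.laplacian bc' (η n • l)),
      ∀ μ : ℝ, μ < 0 →
        (∀ n, Summable fun k => QuantumGraph.occupation β μ ((S n).val k)) ∧
        Tendsto (fun n => (∑' k, QuantumGraph.occupation β μ ((S n).val k)) /
            QuantumGraph.totalLength (η n • l)) atTop (𝓝 (QuantumGraph.limitDensity β μ))) ∧
    -- every density is attained at exactly one negative chemical potential
    BijOn (QuantumGraph.limitDensity β) (Iio 0) (Ioi 0) ∧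
    -- grand-canonical ensemble at fixed density: no macroscopically occupied one-particle state
    (∀ η : ℕ → ℝ, (∀ n, 0 < η n) → Tendsto η atTop atTop →
      ∀ S : ∀ n, QuantumGraph.Eigensystem (QuantumGraph.laplacian bc (η n • l)),
      ∀ ρ : ℝ, 0 < ρ →
        (∀ n, ∃! μ : ℝ, (∀ k, μ < (S n).val k) ∧
          HasSum (fun k => QuantumGraph.occupation β μ ((S n).val k))
            (ρ * QuantumGraph.totalLength (η n • l))) ∧
        ∀ μ : ℕ → ℝ, (∀ n, (∀ k, μ n < (S n).val k) ∧
            HasSum (fun k => QuantumGraph.occupation β (μ n) ((S n).val k))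
              (ρ * QuantumGraph.totalLength (η n • l))) →
          ∀ ε : ℝ, 0 < ε → ∀ᶠ n in atTop, ∀ k,
            QuantumGraph.occupation β (μ n) ((S n).val k) /
              QuantumGraph.totalLength (η n • l) < ε) ∧
    -- canonical ensemble with `N + 1` particles: no condensation in the sense of Penrose and Onsager
    (∀ ρ : ℝ, 0 < ρ → ∀ η : ℕ → ℝ, (∀ N, 0 < η N) →
      Tendsto (fun N : ℕ => ((N : ℝ) + 1) / QuantumGraph.totalLength (η N • l)) atTop (𝓝 ρ) →
      ∀ S : ∀ N, QuantumGraph.Eigensystem (QuantumGraph.bosonicLaplacian bc (η N • l) (N + 1)),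
        (∀ N, Summable fun n => Real.exp (-β * (S N).val n)) ∧
        ∃ (T : ∀ N, QuantumGraph.L2 (η N • l) →L[ℂ] QuantumGraph.L2 (η N • l)) (lam : ℕ → ℝ),
          (∀ N, QuantumGraph.IsReducedDensityMatrix (S N) β (T N)) ∧
          (∀ N, QuantumGraph.IsLargestEigenvalue (T N) (lam N)) ∧
          ¬ QuantumGraph.PenroseOnsagerBEC (fun N => lam N / ((N : ℝ) + 1)) ∧
          Tendsto (fun N => lam N / ((N : ℝ) + 1)) atTop (𝓝 0)) := by
  have hneg' : ∀ bc' ∈ ({bc, QuantumGraph.dirichlet E, QuantumGraph.neumann E} :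
      Set (QuantumGraph.VertexConditions E)), bc'.NegSemidef := by
    rintro bc' (rfl | rfl | rfl)
    · exact hneg
    · exact QuantumGraph.dirichlet_negSemidef E
    · exact QuantumGraph.neumann_negSemidef E
  refine ⟨⟨fun bc' hbc' η hη => QuantumGraph.nonempty_eigensystem hE
      (QuantumGraph.smul_length_pos hl hη) (hneg' bc' hbc'), fun η hη N hN => ?_⟩,
    fun bc' hbc' η hη hlim S μ hμ =>
      QuantumGraph.tendsto_density hE hl (hneg' bc' hbc') hβ hη hlim S hμ,
    QuantumGraph.limitDensity_bijOn hβ, fun η hη hlim S ρ hρ => ⟨fun n => ?_, fun μ hμ ε hε =>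
      QuantumGraph.eventually_occupation_div_lt hE hl hneg hβ hη hlim S hμ hε⟩,
    fun ρ hρ η hη hdens S => ?_⟩
  · obtain ⟨S⟩ := QuantumGraph.nonempty_eigensystem hE (QuantumGraph.smul_length_pos hl hη) hneg
    exact QuantumGraph.nonempty_eigensystem_bosonicLaplacian S hN
  · have hl' := QuantumGraph.smul_length_pos hl (hη n)
    exact QuantumGraph.existsUnique_chemicalPotential hβ ((S n).summable_exp hl' hneg hβ)
      (mul_pos hρ (QuantumGraph.totalLength_pos hE hl'))
  · have hl' := fun N => QuantumGraph.smul_length_pos hl (hη N)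
    -- Auxiliary one-particle eigenbases; the many-particle eigensystems `S N` are arbitrary and
    -- need not be built from them.
    let S₁ := fun N => (QuantumGraph.nonempty_eigensystem hE (hl' N) hneg).some
    have hs := fun N => (S₁ N).summable_exp (hl' N) hneg hβ
    choose T hT hdiag using fun N =>
      QuantumGraph.exists_isReducedDensityMatrix (hl' N) (S₁ N) (hs N) (S N)
    -- Mean occupation decreases with energy, so a one-particle ground state carries the largest
    -- eigenvalue.
    choose i hi using fun N => QuantumGraph.exists_forall_le_of_summable_exp hβ (hs N)
    have hlim := QuantumGraph.tendsto_meanOccupation_div hE hl hneg hβ hη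
      (QuantumGraph.tendsto_scale_atTop hE hl hη hρ hdens) hdens S₁ i
    exact ⟨fun N => (QuantumGraph.hasSum_exp_val (hl' N) (S₁ N) (hs N) (S N)).summable, T,
      fun N => QuantumGraph.meanOccupation (S₁ N).val β (N + 1) (i N), hT,
      fun N => QuantumGraph.isLargestEigenvalue_of_inner_eq (S₁ N).vec (hdiag N) fun k =>
        QuantumGraph.meanOccupation_le_of_le (hs N) hβ (N + 1) (hi N k),
      QuantumGraph.not_penroseOnsagerBEC_of_tendsto_zero hlim, hlim⟩
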